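/- **Setting.** Fix $L\ge 2$, $C\ge 1$, $\sigma_w>0$, $\sigma_b\in\mathbb R$, $\rho>0$, $\alpha_0,\dots,\alpha_{L-1}>0$, constants $\beta_1,\beta_2,\dots\in\mathbb R$ and non-constant Lipschitz activation functions $\phi_1,\dots,\phi_{L-1}:\mathbb R\to\mathbb R$ (so that each has a bounded weak derivative $\phi_l'$). For $M\in\mathbb N$ consider the network with layer widths $M_l=\lfloor\alpha_l M\rfloor$ ($0\le l\le L-1$), $M_L=C$, given by $h^0=x$, $u^l_i=\sum_j W^l_{ij}h^{l-1}_j+b^l_i$ ($1\le l\le L$), $h^l_i=\phi_l(u^l_i)$ ($1\le l\le L-1$), with independent $W^l_{ij}\sim\mathcal N(0,\sigma_w^2/M_{l-1})$ and $b^l_i\sim\mathcal N(0,\sigma_b^2)$, and, independently of them, $T=\lfloor M/\rho\rfloor$ samples $x(1),\dots,x(T)$ with i.i.d. $\mathcal N(0,1)$ coordinates. Assume the network is non-centered: $\sigma_b\ne0$, or $\int\phi_l(z)\,Dz\neq 0$ for all $1\le l\le L-1$, where $D$ denotes the standard Gaussian measure. Let $\bar f_k(t)=u^L_k(t)-\frac1T\sum_{s}u^L_k(s)+\beta_k$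 (mean subtraction in the last layer), let $F=\sum_{k=1}^C\frac1T\sum_{t=1}^T\nabla_\theta\bar f_k(t)\nabla_\theta\bar f_k(t)^\top$ be the empirical Fisher information matrix with respect to all weights and biases $\theta$, let $\lambda_{\max}$ be its largest eigenvalue, and let $F^*$ be the reversed Gram matrix, $F^*_{(k,s),(k',t)}=\frac1T\nabla_\theta\bar f_k(s)\cdot\nabla_\theta\bar f_{k'}(t)$. **Order parameters.** Put $\hat q^0_t=1$, $\hat q^0_{st}=0$, $q^{l}_t=\sigma_w^2\hat q^{l-1}_t+\sigma_b^2$, $q^{l}_{st}=\sigma_w^2\hat q^{l-1}_{st}+\sigma_b^2$, $\hat q^{l}_t=\int\phi_l(\sqrt{q^l_t}u)^2Du$, $\hat q^l_{st}=I_{\phi_l}[q^l_t,q^l_{st}]$, where $I_f[a,b]=\iint f(\sqrt a\,x)\,f(\sqrt a(cx+\sqrt{1-c^2}\,y))\,Dx\,Dy$, $c=b/a$; and $\tilde q^L_t=\tilde q^L_{st}=1$, $\tilde q^l_t=\sigma_w^2\tilde q^{l+1}_t\int\phi_l'(\sqrt{q^l_t}u)^2Du$, $\tilde q^l_{st}=\sigma_w^2\tilde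 q^{l+1}_{st}I_{\phi_l'}[q^l_t,q^l_{st}]$ for $1\le l\le L-1$ (here $t$ refers to one sample and $st$ to two different ones). Let $\alpha=\sum_{l=1}^{L-1}\alpha_l\alpha_{l-1}$, $\kappa_1=\sum_{l=1}^L\frac{\alpha_{l-1}}\alpha\tilde q^l_t\hat q^{l-1}_t$, $\kappa_2=\sum_{l=1}^L\frac{\alpha_{l-1}}\alpha\tilde q^l_{st}\hat q^{l-1}_{st}$. **Assumption on the rate.** Let $\delta^l_{k,i}=\partial u^L_k/\partial u^l_i$ be given by the chain rule. For some $q>0$, the backward order parameters converge at rate $O(M^{-q})$ in mean square: there is a constant $K$ such that for all large $M$, all $1\le l\le L$, $1\le k\le C$ and $1\le s,t\le T$, the quantity $\sum_i\delta^l_{k,i}(s)\delta^l_{k,i}(t)$ differs from $\tilde q^l_{st}$ (from $\tilde q^l_t$ if $s=t$) by at most $KM^{-q}$ in $L^2$. The gradient independence assumption is not used. Let $q^*=\min\{q,1/2\}$. Let $F_0/T$ be the remainder of $F^*$, that is $\frac1T F_0(k,k')_{st}=F^*_{(k,s),(k',t)}-\alpha\frac MT(\kappa_1-\kappa_2)\left(\delta_{st}-\frac1T\right)\delta_{kk'}$,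 and let $S_M=\frac{M^{2q^*}}{\alpha M^2}\sum_{k,k',s,t}\frac1{T^2}F_0(k,k')_{st}^2\ge 0$. **Theorem.** As $M\to\infty$ (with probability over parameters and samples): 1. (lower bound) for every constant $c_0\ge0$ with $\Pr(S_M<c_0)\to0$ (in particular for $c_0=0$), the constant $c_1=c_0/(C(\kappa_1-\kappa_2))$ is non-negative and asymptotically $\lambda_{\max}\ge\rho\alpha(\kappa_1-\kappa_2)+c_1M^{1-2q^*}$, i.e. for every $\varepsilon>0$ $$\Pr\left(\lambda_{\max}\ge(1-\varepsilon)\left(\rho\alpha(\kappa_1-\kappa_2)+c_1M^{1-2q^*}\right)\right)\to1;$$ 2. (upper bound) for every $\eta>0$ there is a constant $c_2\ge0$ such that, for all large $M$, with probability at least $1-\eta$, $$S_M\le c_2\quad\text{and}\quad\lambda_{\max}\le\sqrt{C\alpha^2\rho(\kappa_1-\kappa_2)^2M+c_2M^{2(1-q^*)}};$$ 3. consequently $\lambda_{\max}=o(M)$ in probability, for every $q>0$: $\Pr(\lambda_{\max}>\varepsilon M)\to0$ for every $\varepsilon>0$. -/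

import Mathlib

open MeasureTheory ProbabilityTheory Filter Topology

noncomputable section

namespace WideNet

/-- Hyperparameters of a fully connected network with `H` hidden layers, i.e. with `L = H + 1`
layers of weights. -/
structure Model where
  /-- number of hidden layers, `L - 1` -/
  H : ℕ
  /-- number of readout units -/
  C : ℕ
  /-- width coefficients: layer `l ≤ H` has `a l * M` units (layer `0` is the input layer) -/
  a : ℕ → ℝ
  /-- weights have variance `σw ^ 2 / (fan-in)` -/
  σw : ℝ
  /-- biases have variance `σb ^ 2` -/
  σb : ℝ
  /-- `φ l` is the activation function of hidden layer `l`, for `1 ≤ l ≤ H` -/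
  φ : ℕ → ℝ → ℝ
  /-- the constant ratio `M / T` -/
  ρ : ℝ
  /-- the constant shifts added to the mean-subtracted outputs -/
  β : ℕ → ℝ

/-! ### The network -/

section Network

/- `n l` is the number of units of layer `l`. -/
variable (n : ℕ → ℕ) (H : ℕ)

/-- Index set of the parameters. For `l ≤ H`, `Sum.inl ⟨l, i, j⟩` is the weight from unit `j` of
layer `l` to unit `i` of layer `l + 1`, and `Sum.inr ⟨l, i⟩` is the bias of unit `i` of
layer `l + 1`. -/
abbrev Param : Type :=
  (Σ l : Fin (H + 1), Fin (n (l + 1)) × Fin (n l)) ⊕ (Σ l : Fin (H + 1), Fin (n (l + 1)))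

variable {n H}

/-- The weight `W^{l+1}_{ij}`. -/
def weight (θ : Param n H → ℝ) (l : ℕ) (i : Fin (n (l + 1))) (j : Fin (n l)) : ℝ :=
  if h : l < H + 1 then θ (Sum.inl ⟨⟨l, h⟩, i, j⟩) else 0

/-- The bias `b^{l+1}_i`. -/
def bias (θ : Param n H → ℝ) (l : ℕ) (i : Fin (n (l + 1))) : ℝ :=
  if h : l < H + 1 then θ (Sum.inr ⟨⟨l, h⟩, i⟩) else 0

/-- The activity `h^l` of layer `l` on the input `x`, for `l ≤ H`. -/
def act (φ : ℕ → ℝ → ℝ) (θ : Param n H → ℝ) (x : Fin (n 0) → ℝ) : (l : ℕ) → Fin (n l) → ℝ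
  | 0 => x
  | l + 1 => fun i => φ (l + 1) (∑ j, weight θ l i j * act φ θ x l j + bias θ l i)

/-- The pre-activation `u^{l+1}` of layer `l + 1`. -/
def preact (φ : ℕ → ℝ → ℝ) (θ : Param n H → ℝ) (x : Fin (n 0) → ℝ) (l : ℕ)
    (i : Fin (n (l + 1))) : ℝ :=
  ∑ j, weight θ l i j * act φ θ x l j + bias θ l i

/-- The network has a linear readout: its `k`-th output is `u^{H+1}_k`. -/
def output (φ : ℕ → ℝ → ℝ) (θ : Param n H → ℝ) (x : Fin (n 0) → ℝ) (k : Fin (n (H + 1))) : ℝ :=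
  preact φ θ x H k

/-- The chain rule, started `d` layers above layer `l + 1` with the indicator of unit `k`. -/
def backAux (φ : ℕ → ℝ → ℝ) (θ : Param n H → ℝ) (x : Fin (n 0) → ℝ) (k : ℕ) :
    ℕ → (l : ℕ) → Fin (n (l + 1)) → ℝ
  | 0, _ => fun i => if (i : ℕ) = k then 1 else 0
  | d + 1, l => fun i => deriv (φ (l + 1)) (preact φ θ x l i) *
      ∑ j, backAux φ θ x k d (l + 1) j * weight θ (l + 1) j i

/-- The backward signal `δ^{l+1}_{k,i}`, the derivative of the `k`-th output with respect to
`u^{l+1}_i`, computed by the chain rule down from the output layer `H + 1`, for `l ≤ H`. -/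
def back (φ : ℕ → ℝ → ℝ) (θ : Param n H → ℝ) (x : Fin (n 0) → ℝ) (k : Fin (n (H + 1)))
    (l : ℕ) (i : Fin (n (l + 1))) : ℝ :=
  backAux φ θ x k (H - l) l i

/-- The finite-width backward order parameter `∑ i, δ^{l+1}_{k,i}(x) δ^{l+1}_{k,i}(y)`. -/
def backOverlap (φ : ℕ → ℝ → ℝ) (θ : Param n H → ℝ) (x y : Fin (n 0) → ℝ)
    (k : Fin (n (H + 1))) (l : ℕ) : ℝ :=
  ∑ i, back φ θ x k l i * back φ θ y k l i

variable {T : ℕ}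

/-- The `k`-th output on the `t`-th sample after mean subtraction over the `T` samples. -/
def normOutput (φ : ℕ → ℝ → ℝ) (β : ℕ → ℝ) (θ : Param n H → ℝ) (X : Fin T → Fin (n 0) → ℝ)
    (k : Fin (n (H + 1))) (t : Fin T) : ℝ :=
  (output φ θ (X t) k - (∑ s, output φ θ (X s) k) / T) + β k

/-- The partial derivative of the `k`-th mean-subtracted output on the `t`-th sample with respect
to the parameter `p`. -/
def grad (φ : ℕ → ℝ → ℝ) (β : ℕ → ℝ) (θ : Param n H → ℝ) (X : Fin T → Fin (n 0) → ℝ)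
    (k : Fin (n (H + 1))) (t : Fin T) (p : Param n H) : ℝ :=
  deriv (fun z => normOutput φ β (Function.update θ p z) X k t) (θ p)

/-- The empirical Fisher information matrix of the network with mean subtraction. -/
def fim (φ : ℕ → ℝ → ℝ) (β : ℕ → ℝ) (θ : Param n H → ℝ) (X : Fin T → Fin (n 0) → ℝ) :
    Matrix (Param n H) (Param n H) ℝ :=
  fun p p' => ∑ k, (∑ t, grad φ β θ X k t p * grad φ β θ X k t p') / T

/-- The reversed Gram matrix of `fim`. -/
def revFim (φ : ℕ → ℝ → ℝ) (β : ℕ → ℝ) (θ : Param n H → ℝ) (X : Fin T → Fin (n 0) → ℝ) :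
    Matrix (Fin (n (H + 1)) × Fin T) (Fin (n (H + 1)) × Fin T) ℝ :=
  fun a b => (∑ p, grad φ β θ X a.1 a.2 p * grad φ β θ X b.1 b.2 p) / T

/-- The largest eigenvalue of the Fisher information matrix. -/
def lamMax (φ : ℕ → ℝ → ℝ) (β : ℕ → ℝ) (θ : Param n H → ℝ) (X : Fin T → Fin (n 0) → ℝ) : ℝ :=
  sSup (spectrum ℝ (fim φ β θ X))

/-- Variance of a parameter at initialization. -/
def paramVar (σw σb : ℝ) : Param n H → ℝ
  | Sum.inl w => σw ^ 2 / n w.1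
  | Sum.inr _ => σb ^ 2

variable (n H T)

/-- Joint law of the parameters and of the `T` samples: everything is independent, parameters are
centered Gaussian with variance `paramVar`, inputs are standard Gaussian. -/
def law (σw σb : ℝ) : Measure ((Param n H → ℝ) × (Fin T → Fin (n 0) → ℝ)) :=
  (Measure.pi fun p => gaussianReal 0 (paramVar (n := n) (H := H) σw σb p).toNNReal).prod
    (Measure.pi fun _ => Measure.pi fun _ => gaussianReal 0 1)

end Network

/-! ### Order parameters in the limit of infinite width -/

/-- Expectation under the standard Gaussian. -/
def gauss1 (f : ℝ → ℝ) : ℝ := ∫ u, f u ∂(gaussianReal 0 1)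

/-- `I_f[a, b]`, the two-dimensional Gaussian integral, with `c = b / a`. -/
def gauss2 (f : ℝ → ℝ) (a b : ℝ) : ℝ :=
  ∫ z : ℝ × ℝ, f (√a * z.1) * f (√a * (b / a * z.1 + √(1 - (b / a) ^ 2) * z.2))
    ∂((gaussianReal 0 1).prod (gaussianReal 0 1))

namespace Model

variable (m : Model)

/-- Forward order parameter `q̂^l_t`. -/
def fwdT : ℕ → ℝ
  | 0 => 1
  | l + 1 => gauss1 fun u => m.φ (l + 1) (√(m.σw ^ 2 * fwdT l + m.σb ^ 2) * u) ^ 2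

/-- Forward order parameter `q̂^l_{st}` for `s ≠ t`. -/
def fwdST : ℕ → ℝ
  | 0 => 0
  | l + 1 => gauss2 (m.φ (l + 1)) (m.σw ^ 2 * m.fwdT l + m.σb ^ 2)
      (m.σw ^ 2 * fwdST l + m.σb ^ 2)

/-- `q^{l+1}_t`, the limiting variance of the pre-activations of layer `l + 1`. -/
def preT (l : ℕ) : ℝ := m.σw ^ 2 * m.fwdT l + m.σb ^ 2

/-- `q^{l+1}_{st}`, the limiting covariance of the pre-activations of layer `l + 1` for two
different samples. -/
def preST (l : ℕ) : ℝ := m.σw ^ 2 * m.fwdST l + m.σb ^ 2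

/-- The backward recursion for `q̃_t`, started with the value `1` at `d` layers above
layer `l + 1`. -/
def bwdTAux : ℕ → ℕ → ℝ
  | 0, _ => 1
  | d + 1, l => m.σw ^ 2 * bwdTAux d (l + 1) *
      gauss1 fun u => deriv (m.φ (l + 1)) (√(m.preT l) * u) ^ 2

/-- The backward recursion for `q̃_{st}`, `s ≠ t`. -/
def bwdSTAux : ℕ → ℕ → ℝ
  | 0, _ => 1
  | d + 1, l => m.σw ^ 2 * bwdSTAux d (l + 1) *
      gauss2 (deriv (m.φ (l + 1))) (m.preT l) (m.preST l)

/-- Backward order parameter `q̃^{l+1}_t`, for `l ≤ H`. -/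
def bwdT (l : ℕ) : ℝ := m.bwdTAux (m.H - l) l

/-- Backward order parameter `q̃^{l+1}_{st}` for `s ≠ t`, for `l ≤ H`. -/
def bwdST (l : ℕ) : ℝ := m.bwdSTAux (m.H - l) l

/-- `α = ∑_{l=1}^{L-1} α_l α_{l-1}`. -/
def alpha : ℝ := ∑ l ∈ Finset.range m.H, m.a (l + 1) * m.a l

/-- `κ₁ = ∑_{l=1}^{L} (α_{l-1} / α) q̃^l_t q̂^{l-1}_t`. -/
def kappa1 : ℝ := ∑ l ∈ Finset.range (m.H + 1), m.a l / m.alpha * m.bwdT l * m.fwdT l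

/-- `κ₂ = ∑_{l=1}^{L} (α_{l-1} / α) q̃^l_{st} q̂^{l-1}_{st}`. -/
def kappa2 : ℝ := ∑ l ∈ Finset.range (m.H + 1), m.a l / m.alpha * m.bwdST l * m.fwdST l

/-- A network with bias terms, or all of whose activation functions have non-zero Gaussian mean. -/
def NonCentered : Prop :=
  m.σb ≠ 0 ∨ ∀ l, 1 ≤ l → l ≤ m.H → gauss1 (m.φ l) ≠ 0

/-! ### The network at scale `M` -/

/-- Number of units of layer `l` at scale `M`. -/
def width (M : ℕ) (l : ℕ) : ℕ := if l ≤ m.H then ⌊m.a l * M⌋₊ else m.C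

/-- Number of samples at scale `M`. -/
def samples (M : ℕ) : ℕ := ⌊M / m.ρ⌋₊

/-- Parameters together with samples, at scale `M`. -/
abbrev Sample (M : ℕ) : Type :=
  (Param (m.width M) m.H → ℝ) × (Fin (m.samples M) → Fin (m.width M 0) → ℝ)

/-- Law of parameters and samples at scale `M`. -/
def P (M : ℕ) : Measure (m.Sample M) := law (m.width M) m.H (m.samples M) m.σw m.σb

/-- The largest eigenvalue of the Fisher information matrix at scale `M`. -/
def lam (M : ℕ) (ω : m.Sample M) : ℝ := lamMax m.φ m.β ω.1 ω.2

/-- The backward order parameters converge at rate `O(M ^ (-q))` in mean square, uniformly over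
layers, readout units and pairs of samples. -/
def BackwardRate (q : ℝ) : Prop :=
  ∃ K : ℝ, ∀ᶠ M : ℕ in atTop, ∀ l ≤ m.H, ∀ k : Fin (m.width M (m.H + 1)),
    ∀ s t : Fin (m.samples M),
      eLpNorm (fun ω : m.Sample M =>
          backOverlap m.φ ω.1 (ω.2 s) (ω.2 t) k l - (if s = t then m.bwdT l else m.bwdST l))
        2 (m.P M) ≤ ENNReal.ofReal (K * (M : ℝ) ^ (-q))

/-- The leading term `α (M / T) K δ_{kk'}` of the reversed Fisher information matrix, where
`K = (κ₁ - κ₂) (I - 11ᵀ / T)`. -/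
def leading (M : ℕ) :
    Matrix (Fin (m.width M (m.H + 1)) × Fin (m.samples M))
      (Fin (m.width M (m.H + 1)) × Fin (m.samples M)) ℝ :=
  fun a b => if a.1 = b.1 then
      m.alpha * (M / m.samples M) *
        ((m.kappa1 - m.kappa2) * ((if a.2 = b.2 then 1 else 0) - 1 / m.samples M))
    else 0

/-- The contribution of the squared remainder (reversed Fisher information matrix minus its leading
term) to the second moment of the eigenvalues, `P ∼ α M²` being the number of parameters, rescaled
by its order `M ^ (-2 r)`. -/
def remainder (r : ℝ) (M : ℕ) (ω : m.Sample M) : ℝ :=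
  (M : ℝ) ^ (2 * r) *
    ((∑ a, ∑ b, (revFim m.φ m.β ω.1 ω.2 a b - m.leading M a b) ^ 2) / (m.alpha * (M : ℝ) ^ 2))

end Model

end WideNet

end

open WideNet

/-! Let J be the matrix of gradients of the mean-subtracted outputs, divided by √T. Then F = JJᵀ and
F* = JᵀJ have the same nonzero eigenvalues, all of them nonnegative, so λ_max² ≤ tr F² ≤ λ_max · tr
F, where tr F² is the squared Frobenius norm of F* (`sSup_spectrum_mul_transpose`). Both bounds on
λ_max therefore reduce to asymptotics of ‖F*‖² and of tr F*.

By the chain rule the derivative in a weight is δ·h, so the inner product of two output gradients is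
a sum over layers of (backward overlap) · (inner product of activities + 1), the 1 coming from the
biases. Mean subtraction replaces this Gram matrix by its double centering (`revFim_eq_center`). To
leading order the entries are αMκ₁ on the diagonal and αMκ₂ off it for equal readout units, and 0
for different ones. Centering kills the constant part, which would carry an eigenvalue of order M,
and leaves α(κ₁-κ₂)M(I - 11ᵀ/T) (`center_ite`).

The entries deviate from these limits by O(M^(1-q*)) in mean square. The forward overlaps converge
at rate M^(-1/2) by induction on layers: given the lower layers, the units of a layer are i.i.d.
functions of Gaussian pairs whose covariance is the empirical one, and Gaussian correlation
integrals are Lipschitz in the covariance (`Regular.exists_forward_step`). The backward overlaps of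
one readout unit converge at rate M^(-q) by assumption. For two different units they are bilinear
forms in independent Gaussian rows of readout weights, and their second moments are bounded by the
fluctuations of the quadratic forms that the assumption controls (`lintegral_crossOverlap_le`).

Centering is a projection, so the remainder keeps squared Frobenius norm O(M^(2(1-q*))); its trace,
an average of entry errors, is O(M^(1-q*)); the entries of its diagonal blocks sum to zero. With x =
α(κ₁-κ₂)M/T this gives ‖F*‖² = Cx²(T-1) + O(M^(1-q*)) + αM^(2(1-q*))S_M, where the cross term
involves only the trace, and tr F* = Cx(T-1) + O(M^(1-q*)) (`Regular.lam_bounds`). The square root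
of the first bounds λ_max from above and the quotient of the two from below. -/

namespace WideNet

/-! ### Largest eigenvalue and traces of a Gram matrix -/

section Spectral

variable {p a : Type*} [Fintype p] [Fintype a]

theorem trace_sq_eq_sum_eigenvalues_sq [DecidableEq p] {A : Matrix p p ℝ} (hA : A.IsHermitian) :
    (A * A).trace = ∑ i, hA.eigenvalues i ^ 2 := by
  conv_lhs => rw [hA.spectral_theorem, ← map_mul, Unitary.conjStarAlgAut_apply,
    Matrix.trace_mul_comm, ← mul_assoc]
  simp [Matrix.diagonal_mul_diagonal, Matrix.trace_diagonal, sq]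

/-- Cyclicity of the trace moves the second moment of the spectrum from the parameter side to the
sample side. -/
theorem trace_sq_mul_transpose (J : Matrix p a ℝ) :
    ((J * J.transpose) * (J * J.transpose)).trace
      = ∑ x, ∑ y, (J.transpose * J) x y ^ 2 := by
  have h : ((J * J.transpose) * (J * J.transpose)).trace
      = ((J.transpose * J) * (J.transpose * J)).trace := by
    rw [Matrix.mul_assoc, Matrix.trace_mul_comm]
    simp only [Matrix.mul_assoc]
  rw [h, Matrix.trace]
  refine Finset.sum_congr rfl fun x _ => ?_
  rw [Matrix.diag_apply, Matrix.mul_apply]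
  refine Finset.sum_congr rfl fun y _ => ?_
  have : (J.transpose * J) y x = (J.transpose * J) x y := by
    simp [Matrix.mul_apply, mul_comm]
  rw [this, sq]

/-- For eigenvalues λᵢ ≥ 0 one has λ_max² ≤ ∑ λᵢ² ≤ λ_max ∑ λᵢ; the two sums are the second moment
and the trace of the Gram matrix `Jᵀ * J`. -/
theorem sSup_spectrum_mul_transpose [DecidableEq p] (J : Matrix p a ℝ) :
    0 ≤ sSup (spectrum ℝ (J * J.transpose)) ∧
    sSup (spectrum ℝ (J * J.transpose)) ^ 2 ≤ ∑ x, ∑ y, (J.transpose * J) x y ^ 2 ∧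
    ∑ x, ∑ y, (J.transpose * J) x y ^ 2
      ≤ sSup (spectrum ℝ (J * J.transpose)) * ∑ x, (J.transpose * J) x x := by
  have hpos : (J * J.transpose).PosSemidef := by
    simpa using Matrix.posSemidef_self_mul_conjTranspose J
  have hA := hpos.isHermitian
  have hn : ∀ i, 0 ≤ hA.eigenvalues i := hpos.eigenvalues_nonneg
  have htr : ∑ x, (J.transpose * J) x x = ∑ i, hA.eigenvalues i := by
    have := hA.trace_eq_sum_eigenvalues
    rw [Matrix.trace_mul_comm] at this
    simpa [Matrix.trace] using this
  rw [← trace_sq_mul_transpose, htr, trace_sq_eq_sum_eigenvalues_sq hA,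
    hA.spectrum_real_eq_range_eigenvalues]
  have hbdd : BddAbove (Set.range hA.eigenvalues) := (Set.finite_range _).bddAbove
  have hle : ∀ i, hA.eigenvalues i ≤ sSup (Set.range hA.eigenvalues) := fun i =>
    le_csSup hbdd ⟨i, rfl⟩
  -- Without rows the spectrum is empty, and `sSup ∅ = 0` makes all claims trivial.
  rcases isEmpty_or_nonempty p with he | he
  · simp [Set.range_eq_empty]
  refine ⟨(hn (Classical.arbitrary p)).trans (hle _), ?_, ?_⟩
  · obtain ⟨i, hi⟩ : sSup (Set.range hA.eigenvalues) ∈ Set.range hA.eigenvalues :=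
      (Set.range_nonempty _).csSup_mem (Set.finite_range _)
    rw [← hi]
    exact Finset.single_le_sum (f := fun i => hA.eigenvalues i ^ 2)
      (fun i _ => sq_nonneg _) (Finset.mem_univ i)
  · rw [Finset.mul_sum]
    refine Finset.sum_le_sum fun i _ => ?_
    rw [sq]
    exact mul_le_mul_of_nonneg_right (hle i) (hn i)

end Spectral

/-! ### The Fisher matrix and its reversed form as `J * Jᵀ` and `Jᵀ * J` -/

section Network

variable {n : ℕ → ℕ} {H T : ℕ} (φ : ℕ → ℝ → ℝ) (β : ℕ → ℝ) (θ : Param n H → ℝ)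
  (X : Fin T → Fin (n 0) → ℝ)

theorem lamMax_bounds :
    0 ≤ lamMax φ β θ X ∧
    lamMax φ β θ X ^ 2 ≤ ∑ x, ∑ y, revFim φ β θ X x y ^ 2 ∧
    ∑ x, ∑ y, revFim φ β θ X x y ^ 2 ≤ lamMax φ β θ X * ∑ x, revFim φ β θ X x x := by
  -- The factor 1/√T on each gradient produces the 1/T of both matrices; for `T = 0` this stays
  -- consistent because division by zero gives 0.
  let J : Matrix (Param n H) (Fin (n (H + 1)) × Fin T) ℝ :=
    Matrix.of fun p a => grad φ β θ X a.1 a.2 p / √(T : ℝ)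
  have hT : √(T : ℝ) * √(T : ℝ) = T := Real.mul_self_sqrt (Nat.cast_nonneg T)
  have h1 : fim φ β θ X = J * J.transpose := by
    ext p p'
    simp only [fim, Matrix.mul_apply, Matrix.transpose_apply, J, Matrix.of_apply, Fintype.sum_prod_type,
      div_mul_div_comm, hT, Finset.sum_div]
  have h2 : revFim φ β θ X = J.transpose * J := by
    ext x y
    simp only [revFim, Matrix.mul_apply, Matrix.transpose_apply, J, Matrix.of_apply,
      div_mul_div_comm, hT, Finset.sum_div]
  rw [lamMax, h1, h2]
  exact sSup_spectrum_mul_transpose J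

end Network

/-! ### Double centering of square arrays -/

section Centering

variable {T : ℕ}

/-- Double centering of a square array. -/
noncomputable def center (E : Fin T → Fin T → ℝ) (s t : Fin T) : ℝ :=
  E s t - (∑ r, E r t) / T - (∑ r, E s r) / T + (∑ r, ∑ r', E r r') / (T : ℝ) ^ 2

/-- Subtracting the mean is an orthogonal projection: the sum of squares drops by exactly (∑ f)²/T.
-/
theorem sum_sub_mean_sq_le (f : Fin T → ℝ) :
    ∑ s, (f s - (∑ r, f r) / T) ^ 2 ≤ ∑ s, f s ^ 2 := by
  rcases Nat.eq_zero_or_pos T with rfl | hT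
  · simp
  have hT' : (T : ℝ) ≠ 0 := by positivity
  have : ∑ s, (f s - (∑ r, f r) / T) ^ 2 = ∑ s, f s ^ 2 - (∑ r, f r) ^ 2 / T := by
    simp only [sub_sq, Finset.sum_add_distrib, Finset.sum_sub_distrib, ← Finset.sum_mul,
      ← Finset.mul_sum, Finset.sum_const, Finset.card_univ, Fintype.card_fin, nsmul_eq_mul]
    field_simp
    ring
  rw [this]
  have : 0 ≤ (∑ r, f r) ^ 2 / (T : ℝ) := by positivity
  linarith

theorem sum_center_sq_le (E : Fin T → Fin T → ℝ) :
    ∑ s, ∑ t, center E s t ^ 2 ≤ ∑ s, ∑ t, E s t ^ 2 := by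
  -- Double centering is a composition of two projections: first the mean over the first index is
  -- removed, then the mean over the second.
  let E' : Fin T → Fin T → ℝ := fun s t => E s t - (∑ r, E r t) / T
  have h : ∀ s t, center E s t = E' s t - (∑ r, E' s r) / T := by
    intro s t
    simp only [center, E', Finset.sum_sub_distrib, sub_div, ← Finset.sum_div]
    rw [Finset.sum_comm (f := fun r r' => E r r')]
    ring
  calc ∑ s, ∑ t, center E s t ^ 2 ≤ ∑ s, ∑ t, E' s t ^ 2 :=
        Finset.sum_le_sum fun s _ => by
          simp only [h]; exact sum_sub_mean_sq_le (E' s)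
    _ = ∑ t, ∑ s, E' s t ^ 2 := Finset.sum_comm
    _ ≤ ∑ t, ∑ s, E s t ^ 2 := Finset.sum_le_sum fun t _ => sum_sub_mean_sq_le fun s => E s t
    _ = _ := Finset.sum_comm

/-- Used to remove the 11ᵀ/T part of the leading term from its inner product with the remainder. -/
theorem sum_center (E : Fin T → Fin T → ℝ) : ∑ s, ∑ t, center E s t = 0 := by
  rcases Nat.eq_zero_or_pos T with rfl | hT
  · simp
  have hT' : (T : ℝ) ≠ 0 := by positivity
  simp only [center, Finset.sum_add_distrib, Finset.sum_sub_distrib, Finset.sum_const,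
    Finset.card_univ, Fintype.card_fin, nsmul_eq_mul, ← Finset.sum_div, ← Finset.mul_sum]
  rw [Finset.sum_comm (f := fun s t => E t s)]
  field_simp
  ring

theorem sum_center_diag (E : Fin T → Fin T → ℝ) :
    ∑ t, center E t t = ∑ t, E t t - (∑ s, ∑ t, E s t) / T := by
  rcases Nat.eq_zero_or_pos T with rfl | hT
  · simp
  have hT' : (T : ℝ) ≠ 0 := by positivity
  simp only [center, Finset.sum_add_distrib, Finset.sum_sub_distrib, Finset.sum_const,
    Finset.card_univ, Fintype.card_fin, nsmul_eq_mul, ← Finset.sum_div]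
  rw [Finset.sum_comm (f := fun s t => E t s)]
  field_simp
  ring

theorem center_add (E E' : Fin T → Fin T → ℝ) (s t : Fin T) :
    center (fun s t => E s t + E' s t) s t = center E s t + center E' s t := by
  simp only [center, Finset.sum_add_distrib]
  ring

/-- The array is y·11ᵀ + (x - y)·I, and centering annihilates 11ᵀ, whose eigenvalue T·y would
otherwise dominate the spectrum. This is how mean subtraction in the last layer acts. -/
theorem center_ite (x y : ℝ) (s t : Fin T) :
    center (fun s t => if s = t then x else y) s t
      = (x - y) * ((if s = t then 1 else 0) - 1 / T) := by
  have hT' : (T : ℝ) ≠ 0 := by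
    have := s.pos
    positivity
  have h : ∀ s t : Fin T, (if s = t then x else y) = y + (x - y) * (if s = t then 1 else 0) := by
    intro s t; split_ifs <;> ring
  simp only [center, h, Finset.sum_add_distrib, ← Finset.mul_sum, Finset.sum_ite_eq,
    Finset.sum_ite_eq', Finset.mem_univ, if_true, Finset.sum_const,
    Finset.card_univ, Fintype.card_fin, nsmul_eq_mul]
  field_simp
  ring

/-- A bilinear expression in centered families is the double centering of the uncentered one. -/
theorem sum_centered_mul {P : Type*} [Fintype P] (g g' : Fin T → P → ℝ) (s t : Fin T) :
    ∑ p, (g s p - (∑ r, g r p) / T) * (g' t p - (∑ r, g' r p) / T)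
      = center (fun s t => ∑ p, g s p * g' t p) s t := by
  have h1 : ∑ r, ∑ p, g r p * g' t p = ∑ p, (∑ r, g r p) * g' t p := by
    rw [Finset.sum_comm]; simp only [Finset.sum_mul]
  have h2 : ∑ r, ∑ p, g s p * g' r p = ∑ p, g s p * ∑ r, g' r p := by
    rw [Finset.sum_comm]; simp only [Finset.mul_sum]
  have h3 : ∑ r, ∑ r', ∑ p, g r p * g' r' p = ∑ p, (∑ r, g r p) * ∑ r', g' r' p := by
    simp only [Finset.sum_mul_sum]
    rw [Finset.sum_comm' (t' := Finset.univ) (s' := fun _ => Finset.univ) (by simp)]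
    conv_rhs => rw [Finset.sum_comm]
    rw [Finset.sum_comm]
    refine Finset.sum_congr rfl fun r _ => ?_
    rw [Finset.sum_comm]
  simp only [center]
  rw [h1, h2, h3]
  simp only [Finset.sum_div, ← Finset.sum_sub_distrib, ← Finset.sum_add_distrib]
  simp only [← Finset.sum_div]
  refine Finset.sum_congr rfl fun p _ => ?_
  ring

end Centering

end WideNet

noncomputable section
namespace WideNet

/-! ### The chain rule and the Gram matrix of the gradients -/

section Gradient

variable {n : ℕ → ℕ} {H T : ℕ} (φ : ℕ → ℝ → ℝ) (β : ℕ → ℝ) (θ : Param n H → ℝ)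
  (x : Fin (n 0) → ℝ)

/-- A weight is a linear functional of the parameter vector, so its partial derivative is its value
at a basis vector. The forward derivatives below are therefore stated for a direction `η`,
specialised to `Pi.single p 1`. -/
theorem hasDerivAt_weight_update (p : Param n H) (l : ℕ) (i : Fin (n (l + 1))) (j : Fin (n l)) :
    HasDerivAt (fun z => weight (Function.update θ p z) l i j)
      (weight (Pi.single p 1 : Param n H → ℝ) l i j) (θ p) := by
  unfold weight
  split_ifs with h
  · exact (hasDerivAt_pi.1 (hasDerivAt_update θ p (θ p))) _
  · exact hasDerivAt_const _ _

theorem hasDerivAt_bias_update (p : Param n H) (l : ℕ) (i : Fin (n (l + 1))) :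
    HasDerivAt (fun z => bias (Function.update θ p z) l i)
      (bias (Pi.single p 1 : Param n H → ℝ) l i) (θ p) := by
  unfold bias
  split_ifs with h
  · exact (hasDerivAt_pi.1 (hasDerivAt_update θ p (θ p))) _
  · exact hasDerivAt_const _ _

/-- Contribution of a perturbation `η` of the parameters of layer `l + 1` to the derivative of the
pre-activations of that layer. -/
def perturb (η : Param n H → ℝ) (l : ℕ) (i : Fin (n (l + 1))) : ℝ :=
  ∑ j, weight η l i j * act φ θ x l j + bias η l i

/-- Directional derivative of the activities by forward differentiation. -/
def actDer (η : Param n H → ℝ) : (l : ℕ) → Fin (n l) → ℝ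
  | 0 => 0
  | l + 1 => fun i => deriv (φ (l + 1)) (preact φ θ x l i) *
      (perturb φ θ x η l i + ∑ j, weight θ l i j * actDer η l j)

/-- Directional derivative of the pre-activations by forward differentiation. -/
def preDer (η : Param n H → ℝ) (l : ℕ) (i : Fin (n (l + 1))) : ℝ :=
  perturb φ θ x η l i + ∑ j, weight θ l i j * actDer φ θ x η l j

theorem hasDerivAt_preact_of_act (p : Param n H) (l : ℕ)
    (h : ∀ j, HasDerivAt (fun z => act φ (Function.update θ p z) x l j)
      (actDer φ θ x (Pi.single p 1) l j) (θ p)) (i : Fin (n (l + 1))) :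
    HasDerivAt (fun z => preact φ (Function.update θ p z) x l i)
      (preDer φ θ x (Pi.single p 1) l i) (θ p) := by
  unfold preact preDer perturb
  have := (HasDerivAt.fun_sum fun (j : Fin (n l)) (_ : j ∈ Finset.univ) =>
    (hasDerivAt_weight_update θ p l i j).mul (h j)).add (hasDerivAt_bias_update θ p l i)
  refine this.congr_deriv ?_
  simp only [Function.update_eq_self, Finset.sum_add_distrib]
  ring

theorem hasDerivAt_act (p : Param n H) (l : ℕ)
    (hd : ∀ m < l, ∀ i, DifferentiableAt ℝ (φ (m + 1)) (preact φ θ x m i)) (j : Fin (n l)) :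
    HasDerivAt (fun z => act φ (Function.update θ p z) x l j)
      (actDer φ θ x (Pi.single p 1) l j) (θ p) := by
  induction l with
  | zero => exact hasDerivAt_const _ _
  | succ l ih =>
    have h1 := hasDerivAt_preact_of_act φ θ x p l (ih fun m hm => hd m (by omega)) j
    have h2 := (hd l (Nat.lt_succ_self l) j).hasDerivAt
    have h3 : preact φ θ x l j = preact φ (Function.update θ p (θ p)) x l j := by
      rw [Function.update_eq_self]
    rw [h3] at h2
    have := h2.comp (θ p) h1
    refine this.congr_deriv ?_
    rw [← h3]
    rfl

theorem hasDerivAt_preact (p : Param n H) (l : ℕ)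
    (hd : ∀ m < l, ∀ i, DifferentiableAt ℝ (φ (m + 1)) (preact φ θ x m i))
    (i : Fin (n (l + 1))) :
    HasDerivAt (fun z => preact φ (Function.update θ p z) x l i)
      (preDer φ θ x (Pi.single p 1) l i) (θ p) :=
  hasDerivAt_preact_of_act φ θ x p l (fun j => hasDerivAt_act φ θ x p l hd j) i

theorem back_of_lt (k : Fin (n (H + 1))) {l : ℕ} (hl : l < H) (i : Fin (n (l + 1))) :
    back φ θ x k l i = deriv (φ (l + 1)) (preact φ θ x l i) *
      ∑ j, back φ θ x k (l + 1) j * weight θ (l + 1) j i := by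
  unfold back
  obtain ⟨d, hd⟩ : ∃ d, H - l = d + 1 := ⟨H - l - 1, by omega⟩
  have hd' : H - (l + 1) = d := by omega
  rw [hd, hd']
  rfl

theorem back_top (k : Fin (n (H + 1))) (i : Fin (n (H + 1))) :
    back φ θ x k H i = if i = k then 1 else 0 := by
  unfold back
  rw [Nat.sub_self]
  simp [backAux, Fin.ext_iff]

/-- Forward and backward differentiation are adjoint: the pairing of the backward signal with the
forward derivative changes from one layer to the next only by the perturbation of the new layer's
own parameters. At the readout layer the left side is the derivative of the `k`-th output. -/
theorem sum_back_mul_preDer (η : Param n H → ℝ) (k : Fin (n (H + 1))) (l : ℕ) (hl : l ≤ H) :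
    ∑ i, back φ θ x k l i * preDer φ θ x η l i
      = ∑ m ∈ Finset.range (l + 1), ∑ i, back φ θ x k m i * perturb φ θ x η m i := by
  induction l with
  | zero => simp [preDer, actDer]
  | succ l ih =>
    rw [Finset.sum_range_succ, ← ih (by omega)]
    have h1 : ∀ i, back φ θ x k l i * preDer φ θ x η l i
        = ∑ j, back φ θ x k (l + 1) j * (weight θ (l + 1) j i * actDer φ θ x η (l + 1) i) := by
      intro i
      rw [back_of_lt φ θ x k (by omega : l < H) i, Finset.mul_sum, Finset.sum_mul]
      refine Finset.sum_congr rfl fun j _ => ?_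
      simp only [actDer, preDer]
      ring
    have h2 : ∑ i, back φ θ x k l i * preDer φ θ x η l i
        = ∑ j, back φ θ x k (l + 1) j * ∑ i, weight θ (l + 1) j i * actDer φ θ x η (l + 1) i := by
      simp only [h1, Finset.mul_sum]
      exact Finset.sum_comm
    rw [h2, ← Finset.sum_add_distrib]
    refine Finset.sum_congr rfl fun j _ => ?_
    simp only [preDer]
    ring

/-- The gradient of the `k`-th output as given by the chain rule. -/
def outGrad (k : Fin (n (H + 1))) : Param n H → ℝ
  | Sum.inl w => back φ θ x k w.1 w.2.1 * act φ θ x w.1 w.2.2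
  | Sum.inr w => back φ θ x k w.1 w.2

theorem hasDerivAt_output (p : Param n H) (k : Fin (n (H + 1)))
    (hd : ∀ m < H, ∀ i, DifferentiableAt ℝ (φ (m + 1)) (preact φ θ x m i)) :
    HasDerivAt (fun z => output φ (Function.update θ p z) x k) (outGrad φ θ x k p) (θ p) := by
  refine (hasDerivAt_preact φ θ x p H hd k).congr_deriv ?_
  have h1 := sum_back_mul_preDer φ θ x (Pi.single p 1) k H le_rfl
  simp only [back_top, ite_mul, one_mul, zero_mul, Finset.sum_ite_eq', Finset.mem_univ,
    if_true] at h1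
  rw [h1, Finset.sum_range]
  -- Writing the component as a pairing with a basis vector turns both sides into sums over layers
  -- that match term by term.
  have h2 : outGrad φ θ x k p = ∑ q, outGrad φ θ x k q * (Pi.single p 1 : Param n H → ℝ) q := by
    simp [Pi.single_apply]
  rw [h2, Fintype.sum_sum_type, Fintype.sum_sigma, Fintype.sum_sigma, ← Finset.sum_add_distrib]
  refine Finset.sum_congr rfl fun m _ => ?_
  rw [Fintype.sum_prod_type, ← Finset.sum_add_distrib]
  refine Finset.sum_congr rfl fun i _ => ?_
  simp only [perturb, weight, bias, m.2, dif_pos, outGrad, mul_add, Finset.mul_sum]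
  congr 1
  refine Finset.sum_congr rfl fun j _ => ?_
  ring

theorem grad_eq (X : Fin T → Fin (n 0) → ℝ)
    (hd : ∀ t, ∀ m < H, ∀ i, DifferentiableAt ℝ (φ (m + 1)) (preact φ θ (X t) m i))
    (k : Fin (n (H + 1))) (t : Fin T) (p : Param n H) :
    grad φ β θ X k t p
      = outGrad φ θ (X t) k p - (∑ s, outGrad φ θ (X s) k p) / T := by
  unfold grad normOutput
  refine HasDerivAt.deriv ?_
  refine HasDerivAt.add_const _ ?_
  exact (hasDerivAt_output φ θ (X t) p k (hd t)).sub
    ((HasDerivAt.fun_sum fun s _ => hasDerivAt_output φ θ (X s) p k (hd s)).div_const _)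

/-- Overlap of the backward signals of two readout units on two inputs. -/
def crossOverlap (x y : Fin (n 0) → ℝ) (k k' : Fin (n (H + 1))) (l : ℕ) : ℝ :=
  ∑ i, back φ θ x k l i * back φ θ y k' l i

/-- Inner product of the activities of layer `l` on two inputs. -/
def actDot (x y : Fin (n 0) → ℝ) (l : ℕ) : ℝ :=
  ∑ j, act φ θ x l j * act φ θ y l j

/-- Within a layer the weight gradient is the outer product of backward signal and activity, so its
inner products factorise; the added 1 is the contribution of the biases. -/
theorem sum_outGrad_mul (x y : Fin (n 0) → ℝ) (k k' : Fin (n (H + 1))) :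
    ∑ p, outGrad φ θ x k p * outGrad φ θ y k' p
      = ∑ l ∈ Finset.range (H + 1),
          crossOverlap φ θ x y k k' l * (actDot φ θ x y l + 1) := by
  rw [Fintype.sum_sum_type, Fintype.sum_sigma, Fintype.sum_sigma, ← Finset.sum_add_distrib,
    Finset.sum_range]
  refine Finset.sum_congr rfl fun l _ => ?_
  rw [Fintype.sum_prod_type, mul_add, mul_one]
  congr 1
  rw [crossOverlap, actDot, Finset.sum_mul_sum]
  refine Finset.sum_congr rfl fun i _ => Finset.sum_congr rfl fun j _ => ?_
  simp only [outGrad]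
  ring

/-- Mean subtraction centers the gradients over the samples, hence their Gram matrix in both
indices; the constant shifts `β` have zero derivative. -/
theorem revFim_eq_center (X : Fin T → Fin (n 0) → ℝ)
    (hd : ∀ t, ∀ m < H, ∀ i, DifferentiableAt ℝ (φ (m + 1)) (preact φ θ (X t) m i))
    (k k' : Fin (n (H + 1))) (s t : Fin T) :
    revFim φ β θ X (k, s) (k', t)
      = center (fun s t => ∑ l ∈ Finset.range (H + 1),
          crossOverlap φ θ (X s) (X t) k k' l * (actDot φ θ (X s) (X t) l + 1)) s t / T := by
  simp only [revFim, grad_eq φ β θ X hd, ← sum_outGrad_mul]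
  rw [sum_centered_mul (fun s p => outGrad φ θ (X s) k p) fun s p => outGrad φ θ (X s) k' p]

end Gradient

/-! ### Conditioning on layers by resampling coordinates -/

section Resample

variable {ι : Type*} {α : ι → Type*}

/-- Replace the coordinates in `S` of `θ` by those of `θ'`. -/
def resample (S : Set ι) [DecidablePred (· ∈ S)] (θ θ' : ∀ i, α i) (i : ι) : α i :=
  if i ∈ S then θ' i else θ i

theorem measurable_resample [∀ i, MeasurableSpace (α i)] (S : Set ι) [DecidablePred (· ∈ S)] :
    Measurable fun z : (∀ i, α i) × (∀ i, α i) => resample S z.1 z.2 := by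
  refine measurable_pi_lambda _ fun i => ?_
  unfold resample
  split_ifs <;> fun_prop

/-- Under a product measure, replacing a block of coordinates by an independent copy does not change
the law. This stands in for conditional expectations: the lower layers are frozen and one integrates
over the fresh copy of one layer. -/
theorem measurePreserving_resample [Fintype ι] [∀ i, MeasurableSpace (α i)]
    (μ : ∀ i, Measure (α i)) [∀ i, IsProbabilityMeasure (μ i)]
    (S : Set ι) [DecidablePred (· ∈ S)] :
    MeasurePreserving (fun z : (∀ i, α i) × (∀ i, α i) => resample S z.1 z.2)
      ((Measure.pi μ).prod (Measure.pi μ)) (Measure.pi μ) := by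
  refine ⟨measurable_resample S, ?_⟩
  symm
  refine Measure.pi_eq fun s hs => ?_
  rw [Measure.map_apply (measurable_resample S) (MeasurableSet.univ_pi hs)]
  have h : (fun z : (∀ i, α i) × (∀ i, α i) => resample S z.1 z.2) ⁻¹' (Set.univ.pi s)
      = (Set.univ.pi fun i => if i ∈ S then Set.univ else s i) ×ˢ
        (Set.univ.pi fun i => if i ∈ S then s i else Set.univ) := by
    ext z
    simp only [Set.mem_preimage, Set.mem_univ_pi, Set.mem_prod, resample, ← forall_and]
    refine forall_congr' fun i => ?_
    split_ifs <;> simp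
  rw [h, Measure.prod_prod, Measure.pi_pi, Measure.pi_pi, ← Finset.prod_mul_distrib]
  refine Finset.prod_congr rfl fun i _ => ?_
  split_ifs <;> simp

theorem lintegral_resample [Fintype ι] [∀ i, MeasurableSpace (α i)]
    (μ : ∀ i, Measure (α i)) [∀ i, IsProbabilityMeasure (μ i)]
    (S : Set ι) [DecidablePred (· ∈ S)] {f : (∀ i, α i) → ENNReal} (hf : Measurable f) :
    ∫⁻ θ, f θ ∂(Measure.pi μ)
      = ∫⁻ θ, ∫⁻ θ', f (resample S θ θ') ∂(Measure.pi μ) ∂(Measure.pi μ) := by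
  rw [← (measurePreserving_resample μ S).lintegral_comp hf]
  exact lintegral_prod _ (hf.comp (measurable_resample S)).aemeasurable

end Resample

/-! ### Gaussian laws of linear forms and of pairs -/

section Gaussian

variable {Ω : Type*} [MeasurableSpace Ω] {P : Measure Ω} [IsProbabilityMeasure P]

theorem map_sum_gaussian {ι : Type*} [Fintype ι] {X : ι → Ω → ℝ} (v : ι → NNReal)
    (hX : ∀ i, Measurable (X i)) (hind : iIndepFun X P)
    (hlaw : ∀ i, P.map (X i) = gaussianReal 0 (v i)) (c : ι → ℝ) :
    P.map (fun ω => ∑ i, c i * X i ω)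
      = gaussianReal 0 (∑ i, c i ^ 2 * (v i : ℝ)).toNNReal := by
  have h0 : 0 ≤ ∑ i, c i ^ 2 * (v i : ℝ) :=
    Finset.sum_nonneg fun i _ => mul_nonneg (sq_nonneg _) (v i).2
  have hm : ∀ i, Measurable fun ω => c i * X i ω := fun i => (hX i).const_mul _
  have hi : iIndepFun (fun i ω => c i * X i ω) P :=
    hind.comp (fun i x => c i * x) fun i => measurable_const_mul _
  have : IsProbabilityMeasure (P.map (fun ω => ∑ i, c i * X i ω)) :=
    Measure.isProbabilityMeasure_map (Finset.measurable_sum _ fun i _ => hm i).aemeasurable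
  refine Measure.ext_of_charFun ?_
  rw [hi.charFun_map_fun_sum_eq_prod fun i => (hm i).aemeasurable]
  ext t
  have hl : ∀ i, P.map (fun ω => c i * X i ω)
      = gaussianReal 0 (NNReal.mk (c i ^ 2) (sq_nonneg _) * v i) := by
    intro i
    have := (Measure.map_map (μ := P) (measurable_const_mul (c i)) (hX i)).symm
    simp only [Function.comp_def] at this
    rw [this, hlaw i, gaussianReal_map_const_mul]
    simp
  simp only [hl, Finset.prod_apply, charFun_gaussianReal]
  rw [← Complex.exp_sum]
  congr 1
  rw [Real.coe_toNNReal _ h0]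
  push_cast
  simp [Finset.sum_mul, Finset.sum_div, Finset.sum_neg_distrib]

/-- Cramér–Wold device for pairs of real random variables. -/
theorem map_prodMk_eq_of_linear {Ω' : Type*} [MeasurableSpace Ω'] {P' : Measure Ω'}
    [IsProbabilityMeasure P'] {X Y : Ω → ℝ} {X' Y' : Ω' → ℝ}
    (hX : Measurable X) (hY : Measurable Y) (hX' : Measurable X') (hY' : Measurable Y')
    (h : ∀ a b : ℝ, P.map (fun ω => a * X ω + b * Y ω) = P'.map (fun ω => a * X' ω + b * Y' ω)) :
    P.map (fun ω => (X ω, Y ω)) = P'.map (fun ω => (X' ω, Y' ω)) := by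
  have hXY := hX.prodMk hY
  have hXY' := hX'.prodMk hY'
  have := Measure.isProbabilityMeasure_map (μ := P) hXY.aemeasurable
  have := Measure.isProbabilityMeasure_map (μ := P') hXY'.aemeasurable
  refine Measure.ext_of_charFunDual ?_
  ext L
  obtain ⟨a, b, hL⟩ : ∃ a b : ℝ, ∀ x y : ℝ, L (x, y) = a * x + b * y := by
    refine ⟨L (1, 0), L (0, 1), fun x y => ?_⟩
    have : (x, y) = x • ((1 : ℝ), (0 : ℝ)) + y • ((0 : ℝ), (1 : ℝ)) := by simp
    rw [this, map_add, map_smul, map_smul, smul_eq_mul, smul_eq_mul, mul_comm x, mul_comm y]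
  rw [charFunDual_apply, charFunDual_apply, integral_map hXY.aemeasurable (by fun_prop),
    integral_map hXY'.aemeasurable (by fun_prop)]
  simp only [hL]
  have := congrArg (fun ν : Measure ℝ => ∫ x, Complex.exp (x * Complex.I) ∂ν)
    (h a b)
  rwa [integral_map (by fun_prop) (by fun_prop), integral_map (by fun_prop) (by fun_prop)] at this

/-- The standard Gaussian measure on the plane. -/
abbrev gaussPlane : Measure (ℝ × ℝ) := (gaussianReal 0 1).prod (gaussianReal 0 1)

theorem map_linear_gaussPlane (a b : ℝ) :
    gaussPlane.map (fun z => a * z.1 + b * z.2) = gaussianReal 0 (a ^ 2 + b ^ 2).toNNReal := by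
  have hi : iIndepFun (fun (i : Fin 2) (z : ℝ × ℝ) => if i = 0 then z.1 else z.2) gaussPlane := by
    rw [iIndepFun_iff_map_fun_eq_pi_map (fun i => by split_ifs <;> fun_prop)]
    symm
    have hfst : gaussPlane.map (fun z => z.1) = gaussianReal 0 1 := by
      simp
    have hsnd : gaussPlane.map (fun z => z.2) = gaussianReal 0 1 := by
      simp
    refine Measure.pi_eq fun s hs => ?_
    rw [Measure.map_apply (measurable_pi_lambda _ fun i => by split_ifs <;> fun_prop)
      (MeasurableSet.univ_pi hs)]
    have : (fun (z : ℝ × ℝ) (i : Fin 2) => if i = 0 then z.1 else z.2) ⁻¹' Set.univ.pi s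
        = s 0 ×ˢ s 1 := by
      ext z; simp [Fin.forall_fin_two]
    rw [this, Measure.prod_prod, Fin.prod_univ_two]
    simp [hfst, hsnd]
  have := map_sum_gaussian (P := gaussPlane) (fun _ => 1)
    (fun i => by split_ifs <;> fun_prop) hi (fun i => by
      split_ifs
      · simp
      · simp)
    ![a, b]
  simpa [Fin.sum_univ_two] using this

/-- The numbers `c₁, c₂, c₃` form a lower triangular factor of the covariance matrix. A pair is
determined by the laws of its linear combinations, so degenerate covariances are included. -/
theorem map_pair_gaussian {X Y : Ω → ℝ} (hX : Measurable X) (hY : Measurable Y) {A B C : ℝ}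
    (h : ∀ a b : ℝ, P.map (fun ω => a * X ω + b * Y ω)
      = gaussianReal 0 (a ^ 2 * A + 2 * a * b * B + b ^ 2 * C).toNNReal)
    {c₁ c₂ c₃ : ℝ} (hA : c₁ ^ 2 = A) (hB : c₁ * c₂ = B) (hC : c₂ ^ 2 + c₃ ^ 2 = C) :
    P.map (fun ω => (X ω, Y ω)) = gaussPlane.map (fun z => (c₁ * z.1, c₂ * z.1 + c₃ * z.2)) := by
  refine map_prodMk_eq_of_linear hX hY (by fun_prop) (by fun_prop) fun a b => ?_
  have : (fun z : ℝ × ℝ => a * (c₁ * z.1) + b * (c₂ * z.1 + c₃ * z.2))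
      = fun z => (a * c₁ + b * c₂) * z.1 + (b * c₃) * z.2 := by
    ext z; ring
  rw [h, this, map_linear_gaussPlane]
  congr 2
  rw [← hA, ← hB, ← hC]
  ring

end Gaussian

/-! ### Moments of sums of independent variables -/

section Independence

variable {Ω : Type*} [MeasurableSpace Ω] {P : Measure Ω} [IsProbabilityMeasure P]

theorem iIndepFun_rows {ι κ : Type*} [Fintype ι] [Fintype κ] {X : ι × κ → Ω → ℝ}
    (hX : ∀ p, Measurable (X p)) (h : iIndepFun X P) :
    iIndepFun (fun i ω j => X (i, j) ω) P := by
  have hrow : ∀ i, Measurable fun ω j => X (i, j) ω := fun i =>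
    measurable_pi_lambda _ fun j => hX _
  have hp : ∀ p, IsProbabilityMeasure (P.map (X p)) := fun p =>
    Measure.isProbabilityMeasure_map (hX p).aemeasurable
  rw [iIndepFun_iff_map_fun_eq_infinitePi_map hrow]
  have h1 : ∀ i, P.map (fun ω j => X (i, j) ω)
      = Measure.infinitePi fun j => P.map (X (i, j)) := by
    intro i
    have hi : iIndepFun (fun j => X (i, j)) P :=
      h.precomp (g := fun j => (i, j)) fun j j' hj => by simpa using hj
    exact (iIndepFun_iff_map_fun_eq_infinitePi_map fun j => hX _).1 hi
  simp only [h1]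
  rw [← Measure.infinitePi_map_curry (fun i j => P.map (X (i, j)))]
  have h2 := (iIndepFun_iff_map_fun_eq_infinitePi_map hX).1 h
  rw [show (fun p : ι × κ => P.map (X (p.1, p.2))) = fun p => P.map (X p) from rfl, ← h2,
    Measure.map_map (by fun_prop) (measurable_pi_lambda _ hX)]
  rfl

theorem MemLp.integrable_pow_of_le {f : Ω → ℝ} {k j : ℕ} (hf : MemLp f k P) (hj : j ≤ k) :
    Integrable (fun ω => f ω ^ j) P := by
  have : MemLp f j P := hf.mono_exponent (by exact_mod_cast hj)
  refine (integrable_norm_iff (hf.1.pow j)).1 ?_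
  simpa [norm_pow] using this.integrable_norm_pow'

theorem integral_sq_sq_le {f : Ω → ℝ} (hf : MemLp f 4 P) :
    (∫ ω, f ω ^ 2 ∂P) ^ 2 ≤ ∫ ω, f ω ^ 4 ∂P := by
  have h2 := MemLp.integrable_pow_of_le (k := 4) (j := 2) hf (by norm_num)
  have h4 := MemLp.integrable_pow_of_le (k := 4) (j := 4) hf le_rfl
  set m := ∫ ω, f ω ^ 2 ∂P
  have h : 0 ≤ ∫ ω, (f ω ^ 4 - 2 * m * f ω ^ 2 + m ^ 2) ∂P :=
    integral_nonneg fun ω => by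
      have : f ω ^ 4 - 2 * m * f ω ^ 2 + m ^ 2 = (f ω ^ 2 - m) ^ 2 := by ring
      simp only [Pi.zero_apply, this]; positivity
  have h3 : Integrable (fun ω => f ω ^ 4 - 2 * m * f ω ^ 2) P := h4.sub (h2.const_mul _)
  rw [integral_add h3 (integrable_const _),
    integral_sub h4 (h2.const_mul _), integral_const_mul] at h
  simp only [integral_const, probReal_univ, smul_eq_mul, one_mul] at h
  change 0 ≤ _ - 2 * m * m + m ^ 2 at h
  nlinarith

/-- Induction on the index set. Terms with a first power vanish by independence and centering, and
the mixed term 6·E S²·E Y² is split by E S² = ∑ E Yⱼ², the arithmetic-geometric inequality and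
`integral_sq_sq_le`. The first two claims are carried along because the inductive step uses them. -/
theorem fourth_moment_sum_le {ι : Type*} {Y : ι → Ω → ℝ} (hm : ∀ i, Measurable (Y i))
    (hind : iIndepFun Y P) (hL : ∀ i, MemLp (Y i) 4 P) (h0 : ∀ i, ∫ ω, Y i ω ∂P = 0)
    (s : Finset ι) :
    ∫ ω, (∑ i ∈ s, Y i ω) ∂P = 0 ∧
    ∫ ω, (∑ i ∈ s, Y i ω) ^ 2 ∂P = ∑ i ∈ s, ∫ ω, Y i ω ^ 2 ∂P ∧
    ∫ ω, (∑ i ∈ s, Y i ω) ^ 4 ∂P ≤ 3 * s.card * ∑ i ∈ s, ∫ ω, Y i ω ^ 4 ∂P := by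
  classical
  induction s using Finset.induction_on with
  | empty => simp
  | insert i s hi ih =>
    obtain ⟨ih1, ih2, ih4⟩ := ih
    set S : Ω → ℝ := fun ω => ∑ j ∈ s, Y j ω with hS
    have hSL : MemLp S 4 P := by
      have := memLp_finsetSum s (p := 4) (μ := P) (f := Y) fun j _ => hL j
      exact this
    have hSm : Measurable S := Finset.measurable_sum _ fun j _ => hm j
    have hSY : IndepFun S (Y i) P := by
      have := hind.indepFun_finsetSum_of_notMem hm hi
      convert this using 1
      ext ω; simp [hS]
    have hSp : ∀ k ≤ 4, Integrable (fun ω => S ω ^ k) P := fun k hk =>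
      MemLp.integrable_pow_of_le (k := 4) hSL hk
    have hYp : ∀ k ≤ 4, Integrable (fun ω => Y i ω ^ k) P := fun k hk =>
      MemLp.integrable_pow_of_le (k := 4) (hL i) hk
    have hind' : ∀ k l : ℕ, IndepFun (fun ω => S ω ^ k) (fun ω => Y i ω ^ l) P := fun k l =>
      hSY.comp (measurable_id.pow_const k) (measurable_id.pow_const l)
    have hint : ∀ k ≤ 4, ∀ l ≤ 4, Integrable (fun ω => S ω ^ k * Y i ω ^ l) P :=
      fun k hk l hl => (hind' k l).integrable_mul (hSp k hk) (hYp l hl)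
    have hmul : ∀ k l, ∫ ω, S ω ^ k * Y i ω ^ l ∂P
        = (∫ ω, S ω ^ k ∂P) * ∫ ω, Y i ω ^ l ∂P := fun k l =>
      (hind' k l).integral_fun_mul_eq_mul_integral (by fun_prop) (by fun_prop)
    have hY1 : ∫ ω, Y i ω ^ 1 ∂P = 0 := by simpa using h0 i
    have hS1 : ∫ ω, S ω ^ 1 ∂P = 0 := by simpa using ih1
    simp only [Finset.sum_insert hi]
    refine ⟨?_, ?_, ?_⟩
    · rw [integral_add (by simpa using hYp 1 (by norm_num)) (by simpa using hSp 1 (by norm_num)),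
        h0 i, ih1, add_zero]
    · have : ∀ ω, (Y i ω + ∑ j ∈ s, Y j ω) ^ 2
          = Y i ω ^ 2 + S ω ^ 2 + 2 * (S ω ^ 1 * Y i ω ^ 1) := by intro ω; simp only [hS]; ring
      simp only [this]
      have i1 : Integrable (fun ω => Y i ω ^ 2 + S ω ^ 2) P :=
        (hYp 2 (by norm_num)).add (hSp 2 (by norm_num))
      rw [integral_add i1
        ((hint 1 (by norm_num) 1 (by norm_num)).const_mul _),
        integral_add (hYp 2 (by norm_num)) (hSp 2 (by norm_num)), integral_const_mul, hmul, hY1,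
        mul_zero, mul_zero, add_zero]
      rw [← ih2]
    · have : ∀ ω, (Y i ω + ∑ j ∈ s, Y j ω) ^ 4
          = Y i ω ^ 4 + S ω ^ 4 + 6 * (S ω ^ 2 * Y i ω ^ 2) + 4 * (S ω ^ 3 * Y i ω ^ 1)
            + 4 * (S ω ^ 1 * Y i ω ^ 3) := by intro ω; simp only [hS]; ring
      simp only [this]
      have i1 : Integrable (fun ω => Y i ω ^ 4 + S ω ^ 4) P := (hYp 4 le_rfl).add (hSp 4 le_rfl)
      have i2 := (hint 2 (by norm_num) 2 (by norm_num)).const_mul 6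
      have i3 := (hint 3 (by norm_num) 1 (by norm_num)).const_mul 4
      have i4 := (hint 1 (by norm_num) 3 (by norm_num)).const_mul 4
      have i12 : Integrable (fun ω => Y i ω ^ 4 + S ω ^ 4 + 6 * (S ω ^ 2 * Y i ω ^ 2)) P :=
        i1.add i2
      have i123 : Integrable (fun ω => Y i ω ^ 4 + S ω ^ 4 + 6 * (S ω ^ 2 * Y i ω ^ 2)
          + 4 * (S ω ^ 3 * Y i ω ^ 1)) P := i12.add i3
      rw [integral_add i123 i4, integral_add i12 i3, integral_add i1 i2,
        integral_add (hYp 4 le_rfl) (hSp 4 le_rfl), integral_const_mul, integral_const_mul,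
        integral_const_mul, hmul, hmul, hmul, hY1, hS1, Finset.card_insert_of_notMem hi]
      have key : (∫ ω, S ω ^ 2 ∂P) * ∫ ω, Y i ω ^ 2 ∂P
          ≤ (∑ j ∈ s, ∫ ω, Y j ω ^ 4 ∂P + s.card * ∫ ω, Y i ω ^ 4 ∂P) / 2 := by
        rw [show ∫ ω, S ω ^ 2 ∂P = ∑ j ∈ s, ∫ ω, Y j ω ^ 2 ∂P from ih2, Finset.sum_mul]
        have : ∀ j ∈ s, (∫ ω, Y j ω ^ 2 ∂P) * ∫ ω, Y i ω ^ 2 ∂P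
            ≤ ((∫ ω, Y j ω ^ 4 ∂P) + ∫ ω, Y i ω ^ 4 ∂P) / 2 := by
          intro j _
          have a1 := integral_sq_sq_le (hL j)
          have a2 := integral_sq_sq_le (hL i)
          nlinarith [sq_nonneg ((∫ ω, Y j ω ^ 2 ∂P) - ∫ ω, Y i ω ^ 2 ∂P)]
        refine (Finset.sum_le_sum this).trans (le_of_eq ?_)
        rw [← Finset.sum_div, Finset.sum_add_distrib, Finset.sum_const, nsmul_eq_mul]
      have hc : (0 : ℝ) ≤ s.card := Nat.cast_nonneg _
      have hn : 0 ≤ ∫ ω, Y i ω ^ 4 ∂P := integral_nonneg fun ω => by positivity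
      have ih4' : ∫ ω, S ω ^ 4 ∂P ≤ 3 * s.card * ∑ j ∈ s, ∫ ω, Y j ω ^ 4 ∂P := ih4
      push_cast
      nlinarith

end Independence

/-! ### Lipschitz functions of linear growth -/

section LinearGrowth

/-- `f` is Lipschitz and of linear growth, with the common constant `D`. -/
structure LipGrowth (D : ℝ) (f : ℝ → ℝ) : Prop where
  one_le : 1 ≤ D
  lip : ∀ x y, |f x - f y| ≤ D * |x - y|
  growth : ∀ x, |f x| ≤ D * (1 + |x|)

theorem LipschitzWith.exists_lipGrowth {f : ℝ → ℝ} {B : NNReal} (hf : LipschitzWith B f) :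
    ∃ D, LipGrowth D f := by
  have hB : (0 : ℝ) ≤ B := B.2
  refine ⟨|f 0| + B + 1, by linarith [abs_nonneg (f 0)], fun x y => ?_, fun x => ?_⟩
  · have h := hf.dist_le_mul x y
    rw [Real.dist_eq, Real.dist_eq] at h
    refine h.trans (mul_le_mul_of_nonneg_right ?_ (abs_nonneg _))
    linarith [abs_nonneg (f 0)]
  · have h := hf.dist_le_mul x 0
    rw [Real.dist_eq, Real.dist_eq, sub_zero] at h
    have h2 : |f x| ≤ |f 0| + B * |x| := by
      have := abs_add_le (f x - f 0) (f 0)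
      rw [sub_add_cancel] at this
      linarith
    nlinarith [abs_nonneg (f 0), abs_nonneg x, mul_nonneg (abs_nonneg (f 0)) (abs_nonneg x)]

theorem LipGrowth.continuous {D : ℝ} {f : ℝ → ℝ} (hf : LipGrowth D f) : Continuous f := by
  have hD : 0 ≤ D := zero_le_one.trans hf.one_le
  refine (LipschitzWith.of_dist_le_mul (K := ⟨D, hD⟩) fun x y => ?_).continuous
  rw [Real.dist_eq, Real.dist_eq]
  exact hf.lip x y

end LinearGrowth

/-! ### Domination of Gaussian integrals by a linear weight -/

section Moments

theorem memLp_fst_gaussPlane (p : NNReal) : MemLp (fun z : ℝ × ℝ => z.1) p gaussPlane :=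
  (memLp_id_gaussianReal p).comp_measurePreserving measurePreserving_fst

theorem memLp_snd_gaussPlane (p : NNReal) : MemLp (fun z : ℝ × ℝ => z.2) p gaussPlane :=
  (memLp_id_gaussianReal p).comp_measurePreserving measurePreserving_snd

/-- A linear weight dominating linear functionals on the plane. -/
def wt (z : ℝ × ℝ) : ℝ := 1 + |z.1| + |z.2|

theorem one_le_wt (z : ℝ × ℝ) : 1 ≤ wt z := by
  unfold wt; linarith [abs_nonneg z.1, abs_nonneg z.2]

theorem memLp_wt (k : ℕ) : MemLp wt k gaussPlane := by
  have h : MemLp wt (k : NNReal) gaussPlane :=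
    ((memLp_const (1 : ℝ)).add (memLp_fst_gaussPlane k).abs).add (memLp_snd_gaussPlane k).abs
  simpa using h

theorem integrable_wt_pow (k : ℕ) : Integrable (fun z => wt z ^ k) gaussPlane :=
  MemLp.integrable_pow_of_le (k := k) (memLp_wt k) le_rfl

theorem abs_lin_le_wt (a b R : ℝ) (ha : |a| ≤ R) (hb : |b| ≤ R) (z : ℝ × ℝ) :
    1 + |a * z.1 + b * z.2| ≤ (1 + R) * wt z := by
  have h := abs_add_le (a * z.1) (b * z.2)
  rw [abs_mul, abs_mul] at h
  have := mul_le_mul_of_nonneg_right ha (abs_nonneg z.1)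
  have := mul_le_mul_of_nonneg_right hb (abs_nonneg z.2)
  have hR := (abs_nonneg a).trans ha
  unfold wt
  nlinarith [abs_nonneg z.1, abs_nonneg z.2]

theorem LipGrowth.abs_comp_lin_le {D : ℝ} {f : ℝ → ℝ} (hf : LipGrowth D f) {a b R : ℝ}
    (ha : |a| ≤ R) (hb : |b| ≤ R) (z : ℝ × ℝ) :
    |f (a * z.1 + b * z.2)| ≤ D * (1 + R) * wt z := by
  refine (hf.growth _).trans ?_
  rw [mul_assoc]
  exact mul_le_mul_of_nonneg_left (abs_lin_le_wt a b R ha hb z) (zero_le_one.trans hf.one_le)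

theorem LipGrowth.integrable_mul_lin {D : ℝ} {f : ℝ → ℝ} (hf : LipGrowth D f) (c₁ c₂ c₃ : ℝ) :
    Integrable (fun z : ℝ × ℝ => f (c₁ * z.1) * f (c₂ * z.1 + c₃ * z.2)) gaussPlane := by
  have hc := hf.continuous
  set R := max |c₁| (max |c₂| |c₃|)
  have h0 : |(0 : ℝ)| ≤ R := by rw [abs_zero]; exact (abs_nonneg c₁).trans (le_max_left _ _)
  refine Integrable.mono' ((integrable_wt_pow 2).const_mul ((D * (1 + R)) ^ 2))
    (by fun_prop) (ae_of_all _ fun z => ?_)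
  rw [Real.norm_eq_abs, abs_mul]
  have h1 := hf.abs_comp_lin_le (le_max_left |c₁| (max |c₂| |c₃|)) h0 z
  rw [zero_mul, add_zero] at h1
  have h2 := hf.abs_comp_lin_le (R := R) ((le_max_left |c₂| |c₃|).trans (le_max_right _ _))
    ((le_max_right |c₂| |c₃|).trans (le_max_right _ _)) z
  calc _ ≤ (D * (1 + R) * wt z) * (D * (1 + R) * wt z) :=
        mul_le_mul h1 h2 (abs_nonneg _) ((abs_nonneg _).trans h1)
    _ = _ := by ring

/-- The integrand is Lipschitz in the coefficients by the product rule, with a constant dominated by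
`wt z ^ 2`. The factors left unchanged in the splitting are those with `e₁` and with `c₂, c₃`, so
`e₂, e₃` need no bound. -/
theorem LipGrowth.abs_integral_mul_lin_sub_le {D : ℝ} {f : ℝ → ℝ} (hf : LipGrowth D f)
    {c₁ c₂ c₃ e₁ e₂ e₃ R : ℝ} (hc₁ : |c₁| ≤ R) (hc₂ : |c₂| ≤ R) (hc₃ : |c₃| ≤ R)
    (he₁ : |e₁| ≤ R) :
    |∫ z : ℝ × ℝ, f (c₁ * z.1) * f (c₂ * z.1 + c₃ * z.2) ∂gaussPlane
      - ∫ z : ℝ × ℝ, f (e₁ * z.1) * f (e₂ * z.1 + e₃ * z.2) ∂gaussPlane|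
      ≤ D ^ 2 * (1 + R) * (∫ z, wt z ^ 2 ∂gaussPlane)
        * (|c₁ - e₁| + |c₂ - e₂| + |c₃ - e₃|) := by
  have hD : 0 ≤ D := zero_le_one.trans hf.one_le
  have hR : 0 ≤ R := (abs_nonneg _).trans hc₁
  have h0 : |(0 : ℝ)| ≤ R := by rwa [abs_zero]
  rw [← integral_sub (hf.integrable_mul_lin _ _ _) (hf.integrable_mul_lin _ _ _)]
  set δ := |c₁ - e₁| + |c₂ - e₂| + |c₃ - e₃|
  have hbd : ∀ z : ℝ × ℝ, ‖f (c₁ * z.1) * f (c₂ * z.1 + c₃ * z.2)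
      - f (e₁ * z.1) * f (e₂ * z.1 + e₃ * z.2)‖ ≤ D ^ 2 * (1 + R) * δ * wt z ^ 2 := by
    intro z
    have hw := one_le_wt z
    have h1 := hf.abs_comp_lin_le hc₂ hc₃ z
    have h2 := hf.abs_comp_lin_le he₁ h0 z
    rw [zero_mul, add_zero] at h2
    have h3 : |f (c₁ * z.1) - f (e₁ * z.1)| ≤ D * (|c₁ - e₁| * wt z) := by
      refine (hf.lip _ _).trans (mul_le_mul_of_nonneg_left ?_ hD)
      rw [← sub_mul, abs_mul]
      refine mul_le_mul_of_nonneg_left ?_ (abs_nonneg _)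
      unfold wt; linarith [abs_nonneg z.2]
    have h4 : |f (c₂ * z.1 + c₃ * z.2) - f (e₂ * z.1 + e₃ * z.2)|
        ≤ D * ((|c₂ - e₂| + |c₃ - e₃|) * wt z) := by
      refine (hf.lip _ _).trans (mul_le_mul_of_nonneg_left ?_ hD)
      have : c₂ * z.1 + c₃ * z.2 - (e₂ * z.1 + e₃ * z.2)
          = (c₂ - e₂) * z.1 + (c₃ - e₃) * z.2 := by ring
      rw [this]
      refine (abs_add_le _ _).trans ?_
      rw [abs_mul, abs_mul]
      unfold wt
      nlinarith [abs_nonneg z.1, abs_nonneg z.2, abs_nonneg (c₂ - e₂), abs_nonneg (c₃ - e₃),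
        mul_nonneg (abs_nonneg (c₂ - e₂)) (abs_nonneg z.2),
        mul_nonneg (abs_nonneg (c₃ - e₃)) (abs_nonneg z.1)]
    have hsplit : f (c₁ * z.1) * f (c₂ * z.1 + c₃ * z.2)
        - f (e₁ * z.1) * f (e₂ * z.1 + e₃ * z.2)
        = (f (c₁ * z.1) - f (e₁ * z.1)) * f (c₂ * z.1 + c₃ * z.2)
          + f (e₁ * z.1) * (f (c₂ * z.1 + c₃ * z.2) - f (e₂ * z.1 + e₃ * z.2)) := by ring
    rw [Real.norm_eq_abs, hsplit]
    refine (abs_add_le _ _).trans ?_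
    rw [abs_mul, abs_mul]
    calc _ ≤ D * (|c₁ - e₁| * wt z) * (D * (1 + R) * wt z)
          + D * (1 + R) * wt z * (D * ((|c₂ - e₂| + |c₃ - e₃|) * wt z)) :=
        add_le_add (mul_le_mul h3 h1 (abs_nonneg _) ((abs_nonneg _).trans h3))
          (mul_le_mul h2 h4 (abs_nonneg _) ((abs_nonneg _).trans h2))
      _ = _ := by simp only [δ]; ring
  have := norm_integral_le_of_norm_le ((integrable_wt_pow 2).const_mul (D ^ 2 * (1 + R) * δ))
    (ae_of_all _ hbd)
  rw [integral_const_mul, Real.norm_eq_abs] at this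
  refine this.trans (le_of_eq (by ring))

end Moments

/-! ### Stability of Gaussian correlation integrals in the covariance -/

section GaussianPairs

variable {Ω : Type*} [MeasurableSpace Ω] {P : Measure Ω} [IsProbabilityMeasure P]

omit [IsProbabilityMeasure P] in
theorem map_eq_map_sqrt {X : Ω → ℝ} {A : ℝ} (hA : 0 ≤ A)
    (hlaw : P.map X = gaussianReal 0 A.toNNReal) :
    P.map X = gaussPlane.map (fun z => √A * z.1) := by
  rw [hlaw]
  have := map_linear_gaussPlane (√A) 0
  simp only [zero_mul, add_zero, ne_eq, OfNat.ofNat_ne_zero, not_false_eq_true, zero_pow,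
    Real.sq_sqrt hA] at this
  exact this.symm

omit [IsProbabilityMeasure P] in
theorem integral_comp_gaussian {X : Ω → ℝ} (hX : Measurable X) {A : ℝ} (hA : 0 ≤ A)
    (hlaw : P.map X = gaussianReal 0 A.toNNReal) {f : ℝ → ℝ} (hf : Continuous f) :
    ∫ ω, f (X ω) ∂P = ∫ z : ℝ × ℝ, f (√A * z.1) ∂gaussPlane := by
  rw [← integral_map (f := f) hX.aemeasurable hf.aestronglyMeasurable, map_eq_map_sqrt hA hlaw,
    integral_map (by fun_prop) hf.aestronglyMeasurable]

theorem LipGrowth.memLp_comp_sqrt {D : ℝ} {f : ℝ → ℝ} (hf : LipGrowth D f) (A : ℝ) (k : ℕ) :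
    MemLp (fun z : ℝ × ℝ => f (√A * z.1)) k gaussPlane := by
  have hc := hf.continuous
  refine ((memLp_wt k).const_mul (D * (1 + √A))).mono' (by fun_prop) (ae_of_all _ fun z => ?_)
  have h1 := hf.abs_comp_lin_le (a := √A) (b := 0) (R := √A)
    (by rw [abs_of_nonneg (Real.sqrt_nonneg _)]) (by simp) z
  rwa [zero_mul, add_zero] at h1

omit [IsProbabilityMeasure P] in
theorem LipGrowth.memLp_gaussian {D : ℝ} {f : ℝ → ℝ} (hf : LipGrowth D f) {X : Ω → ℝ}
    (hX : Measurable X) {A : ℝ} (hA : 0 ≤ A) (hlaw : P.map X = gaussianReal 0 A.toNNReal)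
    (k : ℕ) : MemLp (fun ω => f (X ω)) k P := by
  have hc := hf.continuous
  have h : MemLp f k (P.map X) := by
    rw [map_eq_map_sqrt hA hlaw]
    exact (memLp_map_measure_iff hc.aestronglyMeasurable (by fun_prop)).2
      (hf.memLp_comp_sqrt A k)
  exact (memLp_map_measure_iff hc.aestronglyMeasurable hX.aemeasurable).1 h

omit [IsProbabilityMeasure P] in
-- Eighth moments are needed because products of two activities are averaged in L⁴.
theorem LipGrowth.pow_eight_moment {D : ℝ} {f : ℝ → ℝ} (hf : LipGrowth D f) {X : Ω → ℝ}
    (hX : Measurable X) {A : ℝ} (hA : 0 ≤ A) (hlaw : P.map X = gaussianReal 0 A.toNNReal) :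
    ∫ ω, f (X ω) ^ 8 ∂P ≤ 128 * D ^ 8 * (∫ z, wt z ^ 8 ∂gaussPlane) * (1 + A ^ 4) := by
  have hc := hf.continuous
  have hD : 0 ≤ D := zero_le_one.trans hf.one_le
  have hb : ∀ z : ℝ × ℝ, f (√A * z.1) ^ 8 ≤ 128 * D ^ 8 * (1 + A ^ 4) * wt z ^ 8 := by
    intro z
    have h1 := hf.abs_comp_lin_le (a := √A) (b := 0) (R := √A)
      (by rw [abs_of_nonneg (Real.sqrt_nonneg _)]) (by simp) z
    rw [zero_mul, add_zero] at h1
    have h2 : f (√A * z.1) ^ 8 ≤ (D * (1 + √A) * wt z) ^ 8 := by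
      have := pow_le_pow_left₀ (abs_nonneg _) h1 8
      rwa [Even.pow_abs (by decide)] at this
    -- 128 = 2⁷ from convexity of the eighth power.
    have h3 : (1 + √A) ^ 8 ≤ 128 * (1 + A ^ 4) := by
      have h := add_pow_le zero_le_one (Real.sqrt_nonneg A) 8
      have h4 : √A ^ 8 = A ^ 4 := by
        rw [show √A ^ 8 = (√A ^ 2) ^ 4 by ring, Real.sq_sqrt hA]
      rw [h4] at h
      norm_num at h
      exact h
    calc _ ≤ _ := h2
      _ = D ^ 8 * wt z ^ 8 * (1 + √A) ^ 8 := by ring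
      _ ≤ D ^ 8 * wt z ^ 8 * (128 * (1 + A ^ 4)) :=
        mul_le_mul_of_nonneg_left h3 (mul_nonneg (pow_nonneg hD _)
          (pow_nonneg (zero_le_one.trans (one_le_wt z)) _))
      _ = _ := by ring
  rw [integral_comp_gaussian hX hA hlaw (f := fun x => f x ^ 8) (by fun_prop)]
  have hi : Integrable (fun z : ℝ × ℝ => f (√A * z.1) ^ 8) gaussPlane :=
    MemLp.integrable_pow_of_le (P := gaussPlane) (k := 8) (hf.memLp_comp_sqrt A 8) le_rfl
  refine (integral_mono hi ((integrable_wt_pow 8).const_mul _) hb).trans (le_of_eq ?_)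
  rw [integral_const_mul]
  ring

/-- `(X, Y)` is a centered Gaussian pair with variances `A`, `C` and covariance `B`. -/
structure GaussPair (P : Measure Ω) (X Y : Ω → ℝ) (A B C : ℝ) : Prop where
  measX : Measurable X
  measY : Measurable Y
  nonnegA : 0 ≤ A
  nonnegC : 0 ≤ C
  lin : ∀ a b : ℝ, P.map (fun ω => a * X ω + b * Y ω)
    = gaussianReal 0 (a ^ 2 * A + 2 * a * b * B + b ^ 2 * C).toNNReal

variable {X Y : Ω → ℝ} {A B C : ℝ}

omit [IsProbabilityMeasure P] in
theorem GaussPair.lawX (h : GaussPair P X Y A B C) : P.map X = gaussianReal 0 A.toNNReal := by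
  simpa using h.lin 1 0

omit [IsProbabilityMeasure P] in
theorem GaussPair.lawY (h : GaussPair P X Y A B C) : P.map Y = gaussianReal 0 C.toNNReal := by
  simpa using h.lin 0 1

theorem GaussPair.integral_mul_eq (h : GaussPair P X Y A B C) {f : ℝ → ℝ} (hf : Continuous f)
    {c₁ c₂ c₃ : ℝ} (hA : c₁ ^ 2 = A) (hB : c₁ * c₂ = B) (hC : c₂ ^ 2 + c₃ ^ 2 = C) :
    ∫ ω, f (X ω) * f (Y ω) ∂P
      = ∫ z : ℝ × ℝ, f (c₁ * z.1) * f (c₂ * z.1 + c₃ * z.2) ∂gaussPlane := by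
  have hl := map_pair_gaussian h.measX h.measY h.lin hA hB hC
  have hg : Continuous fun p : ℝ × ℝ => f p.1 * f p.2 := by fun_prop
  have := integral_map (μ := P) (h.measX.prodMk h.measY).aemeasurable
    (f := fun p : ℝ × ℝ => f p.1 * f p.2) hg.aestronglyMeasurable
  rw [← this, hl, integral_map (by fun_prop) hg.aestronglyMeasurable]

theorem integral_mul_pow_four_le {U V : Ω → ℝ} (hU : MemLp U 8 P) (hV : MemLp V 8 P) :
    MemLp (fun ω => U ω * V ω) 4 P ∧
    ∫ ω, (U ω * V ω) ^ 4 ∂P ≤ ((∫ ω, U ω ^ 8 ∂P) + ∫ ω, V ω ^ 8 ∂P) / 2 := by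
  have hUV : MemLp (fun ω => U ω * V ω) 4 P := by
    have : ENNReal.HolderTriple 8 8 4 := ⟨by
      rw [← two_mul, show (8 : ENNReal) = 2 * 4 by norm_num,
        ENNReal.mul_inv (by norm_num) (by norm_num), ← mul_assoc,
        ENNReal.mul_inv_cancel (by norm_num) (by norm_num), one_mul]⟩
    exact hV.mul hU
  refine ⟨hUV, ?_⟩
  have h1 := MemLp.integrable_pow_of_le (k := 8) (j := 8) hU le_rfl
  have h2 := MemLp.integrable_pow_of_le (k := 8) (j := 8) hV le_rfl
  rw [← integral_add h1 h2, ← integral_div]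
  refine integral_mono (MemLp.integrable_pow_of_le (k := 4) hUV le_rfl) ((h1.add h2).div_const 2)
    fun ω => ?_
  change (U ω * V ω) ^ 4 ≤ (U ω ^ 8 + V ω ^ 8) / 2
  nlinarith [sq_nonneg (U ω ^ 4 - V ω ^ 4)]

theorem LipGrowth.gaussPair_fourth_moment {D : ℝ} {f : ℝ → ℝ} (hf : LipGrowth D f)
    (h : GaussPair P X Y A B C) :
    MemLp (fun ω => f (X ω) * f (Y ω)) 4 P ∧
    ∫ ω, (f (X ω) * f (Y ω)) ^ 4 ∂P
      ≤ 128 * D ^ 8 * (∫ z, wt z ^ 8 ∂gaussPlane) * (1 + A ^ 4 + C ^ 4) := by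
  have h1 := integral_mul_pow_four_le (hf.memLp_gaussian h.measX h.nonnegA h.lawX 8)
    (hf.memLp_gaussian h.measY h.nonnegC h.lawY 8)
  refine ⟨h1.1, h1.2.trans ?_⟩
  have h2 := hf.pow_eight_moment h.measX h.nonnegA h.lawX
  have h3 := hf.pow_eight_moment h.measY h.nonnegC h.lawY
  have hK : 0 ≤ 128 * D ^ 8 * (∫ z, wt z ^ 8 ∂gaussPlane) := by
    have : 0 ≤ ∫ z, wt z ^ 8 ∂gaussPlane := integral_nonneg fun z => by positivity
    have : 0 ≤ D := zero_le_one.trans hf.one_le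
    positivity
  have : 0 ≤ A ^ 4 + C ^ 4 := by positivity
  nlinarith

/-- A crude bound, linear in the variances, that serves when the covariance is far from its limit.
-/
theorem LipGrowth.gaussPair_abs_integral_le {D : ℝ} {f : ℝ → ℝ} (hf : LipGrowth D f)
    (h : GaussPair P X Y A B C) :
    |∫ ω, f (X ω) * f (Y ω) ∂P|
      ≤ 2 * D ^ 2 * (∫ z, wt z ^ 2 ∂gaussPlane) * (1 + A + C) := by
  have hc := hf.continuous
  have key : ∀ {Z : Ω → ℝ} {V : ℝ}, Measurable Z → 0 ≤ V → P.map Z = gaussianReal 0 V.toNNReal →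
      Integrable (fun ω => f (Z ω) ^ 2) P ∧
      ∫ ω, f (Z ω) ^ 2 ∂P ≤ 2 * D ^ 2 * (∫ z, wt z ^ 2 ∂gaussPlane) * (1 + V) := by
    intro Z V hZ hV hl
    refine ⟨MemLp.integrable_pow_of_le (k := 2) (hf.memLp_gaussian hZ hV hl 2) le_rfl, ?_⟩
    rw [integral_comp_gaussian hZ hV hl (f := fun x => f x ^ 2) (by fun_prop)]
    have hi : Integrable (fun z : ℝ × ℝ => f (√V * z.1) ^ 2) gaussPlane :=
      MemLp.integrable_pow_of_le (k := 2) (hf.memLp_comp_sqrt V 2) le_rfl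
    have hb : ∀ z : ℝ × ℝ, f (√V * z.1) ^ 2 ≤ (2 * D ^ 2 * (1 + V)) * wt z ^ 2 := by
      intro z
      have h1 := hf.abs_comp_lin_le (a := √V) (b := 0) (R := √V)
        (by rw [abs_of_nonneg (Real.sqrt_nonneg _)]) (by simp) z
      rw [zero_mul, add_zero] at h1
      have h2 : f (√V * z.1) ^ 2 ≤ (D * (1 + √V) * wt z) ^ 2 := by
        have := pow_le_pow_left₀ (abs_nonneg _) h1 2
        rwa [sq_abs] at this
      have h3 : (1 + √V) ^ 2 ≤ 2 * (1 + V) := by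
        nlinarith [Real.sq_sqrt hV, sq_nonneg (1 - √V)]
      calc _ ≤ _ := h2
        _ = D ^ 2 * wt z ^ 2 * (1 + √V) ^ 2 := by ring
        _ ≤ D ^ 2 * wt z ^ 2 * (2 * (1 + V)) := mul_le_mul_of_nonneg_left h3 (by positivity)
        _ = _ := by ring
    refine (integral_mono hi ((integrable_wt_pow 2).const_mul _) hb).trans (le_of_eq ?_)
    rw [integral_const_mul]
    ring
  obtain ⟨i1, b1⟩ := key h.measX h.nonnegA h.lawX
  obtain ⟨i2, b2⟩ := key h.measY h.nonnegC h.lawY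
  have h3 : |∫ ω, f (X ω) * f (Y ω) ∂P| ≤ ∫ ω, (f (X ω) ^ 2 + f (Y ω) ^ 2) / 2 ∂P := by
    rw [← Real.norm_eq_abs]
    refine norm_integral_le_of_norm_le ((i1.add i2).div_const 2) (ae_of_all _ fun ω => ?_)
    rw [Real.norm_eq_abs, abs_le]
    constructor
    · nlinarith [sq_nonneg (f (X ω) + f (Y ω))]
    · nlinarith [sq_nonneg (f (X ω) - f (Y ω))]
  rw [integral_div, integral_add i1 i2] at h3
  have hW : 0 ≤ D ^ 2 * ∫ z, wt z ^ 2 ∂gaussPlane :=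
    mul_nonneg (sq_nonneg _) (integral_nonneg fun z => by positivity)
  nlinarith [h.nonnegA, h.nonnegC, mul_nonneg hW h.nonnegA, mul_nonneg hW h.nonnegC]

theorem gauss2_eq (f : ℝ → ℝ) {a : ℝ} (b : ℝ) :
    gauss2 f a b = ∫ z : ℝ × ℝ, f (√a * z.1)
      * f ((√a * (b / a)) * z.1 + (√a * √(1 - (b / a) ^ 2)) * z.2) ∂gaussPlane := by
  unfold gauss2
  congr 1
  ext z
  rw [mul_add, mul_assoc, mul_assoc]

/-- Cholesky coefficients of a covariance matrix of size two are locally Lipschitz. -/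
theorem exists_cholesky_lipschitz {a b : ℝ} (hb : |b| < a) :
    ∃ r > 0, ∃ K : ℝ, 0 ≤ K ∧ ∀ A B C : ℝ, |A - a| + |B - b| + |C - a| < r →
      ∃ c₁ c₂ c₃ : ℝ, c₁ ^ 2 = A ∧ c₁ * c₂ = B ∧ c₂ ^ 2 + c₃ ^ 2 = C ∧
        |c₁ - √a| ≤ K * (|A - a| + |B - b| + |C - a|) ∧
        |c₂ - √a * (b / a)| ≤ K * (|A - a| + |B - b| + |C - a|) ∧
        |c₃ - √a * √(1 - (b / a) ^ 2)| ≤ K * (|A - a| + |B - b| + |C - a|) := by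
  have ha : 0 < a := (abs_nonneg b).trans_lt hb
  have hab : 0 < a - b ^ 2 / a := by
    rw [sub_pos, div_lt_iff₀ ha, ← sq, ← sq_abs b]
    exact pow_lt_pow_left₀ hb (abs_nonneg b) two_ne_zero
  -- The explicit Cholesky factor √A, B/√A, √(C - B²/A). It is continuously differentiable at (a, b,
  -- a) because `|b| < a` keeps both radicands positive, hence it is Lipschitz nearby.
  let F : ℝ × ℝ × ℝ → ℝ × ℝ × ℝ := fun p =>
    (√p.1, p.2.1 / √p.1, √(p.2.2 - p.2.1 ^ 2 / p.1))
  have hsa : √a ≠ 0 := (Real.sqrt_pos.2 ha).ne'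
  have hF : ContDiffAt ℝ 1 F (a, b, a) := by
    have h1 : ContDiffAt ℝ 1 (fun p : ℝ × ℝ × ℝ => p.1) (a, b, a) := contDiffAt_fst
    have h2 : ContDiffAt ℝ 1 (fun p : ℝ × ℝ × ℝ => p.2.1) (a, b, a) := by fun_prop
    have h3 : ContDiffAt ℝ 1 (fun p : ℝ × ℝ × ℝ => p.2.2) (a, b, a) := by fun_prop
    have hs := h1.sqrt (by exact ha.ne')
    refine hs.prodMk ((h2.div hs (by exact hsa)).prodMk ?_)
    exact (h3.sub ((h2.pow 2).div h1 (by exact ha.ne'))).sqrt (by exact hab.ne')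
  obtain ⟨K, t, ht, hKt⟩ := hF.exists_lipschitzOnWith
  have hopen : ∀ᶠ p in 𝓝 (a, b, a), p ∈ t ∧ 0 < p.1 ∧ 0 < p.2.2 - p.2.1 ^ 2 / p.1 := by
    refine (eventually_mem_set.2 ht).and (Eventually.and ?_ ?_)
    · exact continuousAt_fst.eventually (lt_mem_nhds ha)
    · have : ContinuousAt (fun p : ℝ × ℝ × ℝ => p.2.2 - p.2.1 ^ 2 / p.1) (a, b, a) := by
        have : (a, b, a).1 ≠ 0 := ha.ne'
        fun_prop (disch := assumption)
      exact this.eventually (lt_mem_nhds hab)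
  obtain ⟨r, hr, hball⟩ := Metric.eventually_nhds_iff.1 hopen
  refine ⟨r, hr, K, K.2, fun A B C hd => ?_⟩
  set d := |A - a| + |B - b| + |C - a| with hddef
  have hdist : dist (A, B, C) (a, b, a) ≤ d := by
    rw [Prod.dist_eq, Prod.dist_eq, Real.dist_eq, Real.dist_eq, Real.dist_eq]
    refine max_le ?_ (max_le ?_ ?_) <;>
      linarith [abs_nonneg (A - a), abs_nonneg (B - b), abs_nonneg (C - a)]
  obtain ⟨hmem, hA, hC⟩ := hball (hdist.trans_lt hd)
  have hL := (hKt.dist_le_mul _ hmem _ (mem_of_mem_nhds ht)).trans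
    (mul_le_mul_of_nonneg_left hdist K.2)
  rw [Prod.dist_eq, Prod.dist_eq, max_le_iff, max_le_iff, Real.dist_eq, Real.dist_eq,
    Real.dist_eq] at hL
  have hsA : √A ≠ 0 := (Real.sqrt_pos.2 hA).ne'
  have hsq : √A ^ 2 = A := Real.sq_sqrt hA.le
  refine ⟨√A, B / √A, √(C - B ^ 2 / A), hsq, by field_simp, ?_, hL.1, ?_, ?_⟩
  · rw [div_pow, hsq, Real.sq_sqrt hC.le]; ring
  · have : √a * (b / a) = b / √a := by
      rw [eq_div_iff hsa]
      have := Real.mul_self_sqrt ha.le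
      field_simp
      linear_combination b * this
    rw [this]; exact hL.2.1
  · have : √a * √(1 - (b / a) ^ 2) = √(a - b ^ 2 / a) := by
      rw [← Real.sqrt_mul ha.le]; congr 1; field_simp
    rw [this]; exact hL.2.2

/-- Stability of Gaussian correlation integrals under perturbations of the covariance. -/
theorem LipGrowth.exists_gauss2_stability {D : ℝ} {f : ℝ → ℝ} (hf : LipGrowth D f) {a b : ℝ}
    (hb : |b| < a) :
    ∃ L : ℝ, 0 ≤ L ∧ ∀ {Ω : Type} [MeasurableSpace Ω] {P : Measure Ω} [IsProbabilityMeasure P]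
      {X Y : Ω → ℝ} {A B C : ℝ}, GaussPair P X Y A B C →
      |∫ ω, f (X ω) * f (Y ω) ∂P - gauss2 f a b| ≤ L * (|A - a| + |B - b| + |C - a|) := by
  have ha : 0 < a := (abs_nonneg b).trans_lt hb
  obtain ⟨r, hr, K, hK, hchol⟩ := exists_cholesky_lipschitz hb
  set W := ∫ z, wt z ^ 2 ∂gaussPlane
  have hW : 0 ≤ W := integral_nonneg fun z => by positivity
  set R := max (max |√a| (max |√a * (b / a)| |√a * √(1 - (b / a) ^ 2)|) + K * r) 0
  set G := |gauss2 f a b|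
  -- The estimate must hold for every covariance, as it is applied to a random one. The first
  -- summand serves deviations `d < r`, where each of three Cholesky coefficients is `K`-Lipschitz;
  -- the second serves `d ≥ r`, where the crude growth bound is multiplied by d/r ≥ 1.
  refine ⟨D ^ 2 * (1 + R) * W * (3 * K) + (2 * D ^ 2 * W * ((1 + 2 * a) / r + 1) + G / r), ?_, ?_⟩
  · have : 0 ≤ R := le_max_right _ _
    have : 0 ≤ G := abs_nonneg _
    positivity
  intro Ω _ P _ X Y A B C h
  have hRn : 0 ≤ R := le_max_right _ _
  have hGn : 0 ≤ G := abs_nonneg _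
  set d := |A - a| + |B - b| + |C - a| with hd
  have hd0 : 0 ≤ d := by positivity
  rw [add_mul]
  rcases lt_or_ge d r with hlt | hge
  · obtain ⟨c₁, c₂, c₃, hA, hB, hC, h1, h2, h3⟩ := hchol A B C hlt
    have hKr : K * d ≤ K * r := mul_le_mul_of_nonneg_left hlt.le hK
    have hRb : ∀ {c e : ℝ}, |c - e| ≤ K * d →
        |e| ≤ max |√a| (max |√a * (b / a)| |√a * √(1 - (b / a) ^ 2)|) → |c| ≤ R := by
      intro c e hce he
      have := abs_add_le (c - e) e
      rw [sub_add_cancel] at this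
      exact le_max_of_le_left (by linarith)
    rw [h.integral_mul_eq hf.continuous hA hB hC, gauss2_eq]
    have hmain := hf.abs_integral_mul_lin_sub_le (c₁ := c₁) (c₂ := c₂) (c₃ := c₃) (e₁ := √a)
      (e₂ := √a * (b / a)) (e₃ := √a * √(1 - (b / a) ^ 2)) (R := R)
      (hRb h1 (le_max_left _ _)) (hRb h2 ((le_max_left _ _).trans (le_max_right _ _)))
      (hRb h3 ((le_max_right _ _).trans (le_max_right _ _)))
      (le_max_of_le_left (by
        have := le_max_left |√a| (max |√a * (b / a)| |√a * √(1 - (b / a) ^ 2)|)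
        have : 0 ≤ K * r := by positivity
        linarith))
    refine hmain.trans ?_
    have hsum : |c₁ - √a| + |c₂ - √a * (b / a)| + |c₃ - √a * √(1 - (b / a) ^ 2)|
        ≤ 3 * K * d := by linarith
    have hpos : 0 ≤ (2 * D ^ 2 * W * ((1 + 2 * a) / r + 1) + G / r) * d := by positivity
    have := mul_le_mul_of_nonneg_left hsum (by positivity : 0 ≤ D ^ 2 * (1 + R) * W)
    linarith
  · have h1 := hf.gaussPair_abs_integral_le h
    have h2 := abs_sub (∫ ω, f (X ω) * f (Y ω) ∂P) (gauss2 f a b)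
    have h3 : 1 ≤ d / r := (one_le_div hr).2 hge
    have h4 : 1 + A + C ≤ ((1 + 2 * a) / r + 1) * d := by
      have e : ((1 + 2 * a) / r + 1) * d = (1 + 2 * a) * (d / r) + d := by ring
      rw [e]
      have := le_abs_self (A - a)
      have := le_abs_self (C - a)
      have := abs_nonneg (B - b)
      nlinarith
    have h5 : G ≤ G / r * d := by
      have : G / r * d = G * (d / r) := by ring
      rw [this]; nlinarith
    have hpos : 0 ≤ D ^ 2 * (1 + R) * W * (3 * K) * d := by positivity
    have := mul_le_mul_of_nonneg_left h4 (by positivity : 0 ≤ 2 * D ^ 2 * W)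
    nlinarith

omit [IsProbabilityMeasure P] in
theorem GaussPair.diag {X : Ω → ℝ} {A : ℝ} (hX : Measurable X) (hA : 0 ≤ A)
    (hl : P.map X = gaussianReal 0 A.toNNReal) : GaussPair P X X A A A := by
  refine ⟨hX, hX, hA, hA, fun a b => ?_⟩
  have h1 : (fun ω => a * X ω + b * X ω) = (fun x => (a + b) * x) ∘ X := by
    ext ω; simp only [Function.comp_apply]; ring
  rw [h1, ← Measure.map_map (by fun_prop) hX, hl, gaussianReal_map_const_mul, mul_zero]
  congr 1
  apply NNReal.eq
  rw [Real.coe_toNNReal _ (by nlinarith [mul_nonneg (sq_nonneg (a + b)) hA]), NNReal.coe_mul,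
    Real.coe_toNNReal _ hA]
  simp only [NNReal.coe_mk]
  ring

theorem gauss1_eq {g : ℝ → ℝ} (hg : Measurable g) : gauss1 g = ∫ z : ℝ × ℝ, g z.1 ∂gaussPlane := by
  have := integral_map (μ := gaussPlane) (measurable_fst (α := ℝ) (β := ℝ)).aemeasurable
    (f := g) hg.aestronglyMeasurable
  rw [← this, gauss1]
  congr 1
  simp

/-- Stability of Gaussian second moments under perturbations of the variance. -/
theorem LipGrowth.exists_gauss1_stability {D : ℝ} {f : ℝ → ℝ} (hf : LipGrowth D f) {a : ℝ}
    (ha : 0 < a) :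
    ∃ L : ℝ, 0 ≤ L ∧ ∀ {Ω : Type} [MeasurableSpace Ω] {P : Measure Ω} [IsProbabilityMeasure P]
      {X : Ω → ℝ} {A : ℝ}, Measurable X → 0 ≤ A → P.map X = gaussianReal 0 A.toNNReal →
      |∫ ω, f (X ω) * f (X ω) ∂P - gauss1 fun u => f (√a * u) ^ 2| ≤ L * |A - a| := by
  have hc := hf.continuous
  set W := ∫ z, wt z ^ 2 ∂gaussPlane
  have hW : 0 ≤ W := integral_nonneg fun z => by positivity
  set R := √(2 * a)
  have hR : 0 ≤ R := Real.sqrt_nonneg _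
  have hsa : 0 < √a := Real.sqrt_pos.2 ha
  have hG : (gauss1 fun u => f (√a * u) ^ 2)
      = ∫ z : ℝ × ℝ, f (√a * z.1) * f (√a * z.1 + 0 * z.2) ∂gaussPlane := by
    rw [gauss1_eq (by fun_prop)]
    simp only [zero_mul, add_zero, sq]
  set G := |gauss1 fun u => f (√a * u) ^ 2|
  have hGn : 0 ≤ G := abs_nonneg _
  refine ⟨D ^ 2 * (1 + R) * W * (2 / √a) + (2 * D ^ 2 * W * ((1 + 2 * a) / a + 2) + G / a),
    by positivity, ?_⟩
  intro Ω _ P _ X A hX hA hl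
  have hp := GaussPair.diag hX hA hl
  rw [add_mul]
  -- The pair is degenerate here, so the Cholesky factor is not known to be Lipschitz; only √A has
  -- to be compared with √a, by |√A - √a| ≤ |A - a|/√a. The splitting into near and far is as
  -- before.
  rcases lt_or_ge |A - a| a with hlt | hge
  · rw [hG, hp.integral_mul_eq hc (c₁ := √A) (c₂ := √A) (c₃ := 0) (Real.sq_sqrt hA)
      (Real.mul_self_sqrt hA) (by rw [Real.sq_sqrt hA]; ring)]
    have h2a : A ≤ 2 * a := by linarith [(abs_lt.1 hlt).2]
    have h1 : |√A| ≤ R := by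
      rw [abs_of_nonneg (Real.sqrt_nonneg _)]; exact Real.sqrt_le_sqrt h2a
    have h2 : |√a| ≤ R := by
      rw [abs_of_nonneg (Real.sqrt_nonneg _)]; exact Real.sqrt_le_sqrt (by linarith)
    refine (hf.abs_integral_mul_lin_sub_le h1 h1 (by simpa using hR) h2).trans ?_
    have h3 : |√A - √a| ≤ |A - a| / √a := by
      rw [le_div_iff₀ hsa]
      have : A - a = (√A - √a) * (√A + √a) := by
        have e1 := Real.mul_self_sqrt hA
        have e2 := Real.mul_self_sqrt ha.le
        linear_combination -e1 + e2
      rw [this, abs_mul, abs_of_nonneg (by positivity : 0 ≤ √A + √a)]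
      exact mul_le_mul_of_nonneg_left (by linarith [Real.sqrt_nonneg A]) (abs_nonneg _)
    have h4 : |√A - √a| + |√A - √a| + |(0 : ℝ) - 0| ≤ 2 / √a * |A - a| := by
      rw [sub_self, abs_zero, div_mul_eq_mul_div]
      calc _ = 2 * |√A - √a| := by ring
        _ ≤ 2 * (|A - a| / √a) := by linarith
        _ = _ := by ring
    have hpos : 0 ≤ (2 * D ^ 2 * W * ((1 + 2 * a) / a + 2) + G / a) * |A - a| := by positivity
    have := mul_le_mul_of_nonneg_left h4 (by positivity : 0 ≤ D ^ 2 * (1 + R) * W)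
    linarith
  · have h1 := hf.gaussPair_abs_integral_le hp
    have h2 := abs_sub (∫ ω, f (X ω) * f (X ω) ∂P) (gauss1 fun u => f (√a * u) ^ 2)
    have h3 : 1 ≤ |A - a| / a := (one_le_div ha).2 hge
    have h4 : 1 + A + A ≤ ((1 + 2 * a) / a + 2) * |A - a| := by
      have e : ((1 + 2 * a) / a + 2) * |A - a| = (1 + 2 * a) * (|A - a| / a) + 2 * |A - a| := by
        ring
      rw [e]
      have := le_abs_self (A - a)
      nlinarith
    have h5 : G ≤ G / a * |A - a| := by
      have : G / a * |A - a| = G * (|A - a| / a) := by ring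
      rw [this]; nlinarith
    have hpos : 0 ≤ D ^ 2 * (1 + R) * W * (2 / √a) * |A - a| := by positivity
    have := mul_le_mul_of_nonneg_left h4 (by positivity : 0 ≤ 2 * D ^ 2 * W)
    nlinarith

end GaussianPairs

/-! ### Fourth moments of empirical means -/

section Concentration

variable {Ω : Type*} [MeasurableSpace Ω] {P : Measure Ω} [IsProbabilityMeasure P]

/-- Fourth moment of the deviation of an empirical mean of independent variables. -/
theorem fourth_moment_mean_le {n : ℕ} (hn : 0 < n) {Z : Fin n → Ω → ℝ}
    (hm : ∀ i, Measurable (Z i)) (hind : iIndepFun Z P) (hL : ∀ i, MemLp (Z i) 4 P)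
    {q e m₄ : ℝ} (hmean : ∀ i, |∫ ω, Z i ω ∂P - q| ≤ e) (hm4 : ∀ i, ∫ ω, Z i ω ^ 4 ∂P ≤ m₄) :
    Integrable (fun ω => ((∑ i, Z i ω) / n - q) ^ 4) P ∧
    ∫ ω, ((∑ i, Z i ω) / n - q) ^ 4 ∂P ≤ 384 * m₄ / n ^ 2 + 8 * e ^ 4 := by
  have hn' : (0 : ℝ) < n := by exact_mod_cast hn
  let Y : Fin n → Ω → ℝ := fun i ω => Z i ω - ∫ ω', Z i ω' ∂P
  have hYm : ∀ i, Measurable (Y i) := fun i => (hm i).sub_const _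
  have hYL : ∀ i, MemLp (Y i) 4 P := fun i => (hL i).sub (memLp_const _)
  have hYi : iIndepFun Y P := hind.comp (fun i x => x - ∫ ω', Z i ω' ∂P) fun i => by fun_prop
  have hZ1 : ∀ i, Integrable (Z i) P := fun i => (hL i).integrable (by norm_num)
  have hY0 : ∀ i, ∫ ω, Y i ω ∂P = 0 := fun i => by
    simp only [Y]
    rw [integral_sub (hZ1 i) (integrable_const _)]
    simp
  have hZ4 : ∀ i, Integrable (fun ω => Z i ω ^ 4) P := fun i =>
    MemLp.integrable_pow_of_le (k := 4) (hL i) le_rfl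
  have hpow : ∀ x y : ℝ, (x - y) ^ 4 ≤ 8 * (x ^ 4 + y ^ 4) := fun x y => by
    have := Even.add_pow_le (a := x) (b := -y) (n := 4) (by decide)
    norm_num at this
    rw [sub_eq_add_neg]
    have e : (-y) ^ 4 = y ^ 4 := by ring
    linarith
  -- 16 = 8·2: convexity gives the factor 8, and the fourth power of the mean is at most the fourth
  -- moment. The final constant is 384 = 8·3·16.
  have hY4 : ∀ i, ∫ ω, Y i ω ^ 4 ∂P ≤ 16 * m₄ := by
    intro i
    set c := ∫ ω', Z i ω' ∂P
    have hc : c ^ 4 ≤ ∫ ω, Z i ω ^ 4 ∂P := by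
      have h1 := integral_sq_sq_le (hL i)
      have h2 : c ^ 2 ≤ ∫ ω, Z i ω ^ 2 ∂P := by
        have := variance_nonneg (Z i) P
        rw [variance_eq_sub ((hL i).mono_exponent (by norm_num))] at this
        simpa using this
      calc c ^ 4 = (c ^ 2) ^ 2 := by ring
        _ ≤ _ := pow_le_pow_left₀ (sq_nonneg _) h2 2
        _ ≤ _ := h1
    have h3 : ∫ ω, Y i ω ^ 4 ∂P ≤ ∫ ω, 8 * (Z i ω ^ 4 + c ^ 4) ∂P :=
      integral_mono (MemLp.integrable_pow_of_le (k := 4) (hYL i) le_rfl)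
        (((hZ4 i).add (integrable_const _)).const_mul 8) fun ω => hpow _ _
    rw [integral_const_mul, integral_add (hZ4 i) (integrable_const _)] at h3
    simp only [integral_const, probReal_univ, smul_eq_mul, one_mul] at h3
    linarith [hm4 i]
  obtain ⟨-, -, hS⟩ := fourth_moment_sum_le hYm hYi hYL hY0 Finset.univ
  -- The bias; the rest of the deviation is the centered fluctuation.
  set r := (∑ i, ∫ ω', Z i ω' ∂P) / n - q
  have hr : r ^ 4 ≤ e ^ 4 := by
    have : |r| ≤ e := by
      have h1 : r = (∑ i, (∫ ω', Z i ω' ∂P - q)) / n := by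
        simp only [r, Finset.sum_sub_distrib, Finset.sum_const, Finset.card_univ,
          Fintype.card_fin, nsmul_eq_mul]
        field_simp
      rw [h1, abs_div, abs_of_pos hn', div_le_iff₀ hn']
      refine (Finset.abs_sum_le_sum_abs _ _).trans ((Finset.sum_le_sum fun i _ => hmean i).trans ?_)
      simp [mul_comm]
    have h2 := pow_le_pow_left₀ (abs_nonneg _) this 4
    rwa [Even.pow_abs (by decide)] at h2
  have hdec : ∀ ω, (∑ i, Z i ω) / n - q = (∑ i, Y i ω) / n - (-r) := by
    intro ω
    simp only [Y, r, Finset.sum_sub_distrib, sub_div]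
    ring
  have hSL : MemLp (fun ω => ∑ i, Y i ω) 4 P := memLp_finsetSum _ fun i _ => hYL i
  have hS4 : Integrable (fun ω => (∑ i, Y i ω) ^ 4) P :=
    MemLp.integrable_pow_of_le (k := 4) hSL le_rfl
  have hint : Integrable (fun ω => ((∑ i, Z i ω) / n - q) ^ 4) P := by
    have hZS : MemLp (fun ω => (∑ i, Z i ω) / n - q) 4 P := by
      have h1 : MemLp (fun ω => ∑ i, Z i ω) 4 P := memLp_finsetSum _ fun i _ => hL i
      simp only [div_eq_mul_inv]
      exact (h1.mul_const _).sub (memLp_const _)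
    exact MemLp.integrable_pow_of_le (k := 4) hZS le_rfl
  refine ⟨hint, ?_⟩
  have hle : ∀ ω, ((∑ i, Z i ω) / n - q) ^ 4
      ≤ 8 * ((∑ i, Y i ω) ^ 4 / n ^ 4 + r ^ 4) := by
    intro ω
    rw [hdec]
    refine (hpow _ _).trans (le_of_eq ?_)
    rw [div_pow]
    ring
  refine (integral_mono hint (((hS4.div_const _).add (integrable_const _)).const_mul 8) hle).trans ?_
  have hS' : ∫ ω, (∑ i, Y i ω) ^ 4 ∂P ≤ 48 * m₄ * n ^ 2 := by
    refine hS.trans ?_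
    have h1 : ∑ i, ∫ ω, Y i ω ^ 4 ∂P ≤ n * (16 * m₄) := by
      refine (Finset.sum_le_sum fun i _ => hY4 i).trans ?_
      simp
    rw [Finset.card_univ, Fintype.card_fin]
    have := mul_le_mul_of_nonneg_left h1 (by positivity : (0 : ℝ) ≤ 3 * n)
    linarith
  change ∫ ω, 8 * ((∑ i, Y i ω) ^ 4 / n ^ 4 + r ^ 4) ∂P ≤ _
  rw [integral_const_mul, integral_add (hS4.div_const _) (integrable_const _), integral_div]
  simp only [integral_const, probReal_univ, smul_eq_mul, one_mul]
  have h5 : (∫ ω, (∑ i, Y i ω) ^ 4 ∂P) / n ^ 4 ≤ 48 * m₄ / n ^ 2 := by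
    rw [div_le_div_iff₀ (by positivity) (by positivity)]
    have := mul_le_mul_of_nonneg_right hS' (by positivity : (0 : ℝ) ≤ n ^ 2)
    linarith
  have h6 : 384 * m₄ / n ^ 2 = 8 * (48 * m₄ / (n : ℝ) ^ 2) := by ring
  rw [h6]
  linarith

end Concentration

/-! ### Cauchy–Schwarz for Gaussian correlations -/

section CauchySchwarz

variable {f : ℝ → ℝ} {D a b : ℝ}

theorem integrable_sq_comp_lin (hfm : Measurable f) (hD : 0 ≤ D)
    (hg : ∀ x, |f x| ≤ D * (1 + |x|)) (c d : ℝ) :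
    Integrable (fun z : ℝ × ℝ => f (c * z.1 + d * z.2) ^ 2) gaussPlane := by
  set R := max |c| |d|
  have hR : 0 ≤ R := (abs_nonneg c).trans (le_max_left _ _)
  refine Integrable.mono' ((integrable_wt_pow 2).const_mul ((D * (1 + R)) ^ 2))
    ((hfm.comp (by fun_prop)).pow_const 2).aestronglyMeasurable (ae_of_all _ fun z => ?_)
  rw [Real.norm_eq_abs, abs_pow, ← mul_pow]
  refine pow_le_pow_left₀ (abs_nonneg _) ((hg _).trans ?_) 2
  rw [mul_assoc]
  exact mul_le_mul_of_nonneg_left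
    (abs_lin_le_wt c d R (le_max_left _ _) (le_max_right _ _) z) hD

theorem integral_sq_comp_lin (hfm : Measurable f) {c d : ℝ} (ha : 0 ≤ a)
    (hcd : c ^ 2 + d ^ 2 = a) :
    ∫ z : ℝ × ℝ, f (c * z.1 + d * z.2) ^ 2 ∂gaussPlane = gauss1 fun u => f (√a * u) ^ 2 := by
  have h1 := map_linear_gaussPlane c d
  have h2 := map_linear_gaussPlane (√a) 0
  rw [hcd] at h1
  rw [Real.sq_sqrt ha] at h2
  have hm : Measurable fun x => f x ^ 2 := hfm.pow_const 2
  have e1 := integral_map (μ := gaussPlane) (φ := fun z : ℝ × ℝ => c * z.1 + d * z.2)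
    (by fun_prop) (f := fun x => f x ^ 2) hm.aestronglyMeasurable
  have e2 := integral_map (μ := gaussPlane) (φ := fun z : ℝ × ℝ => √a * z.1 + 0 * z.2)
    (by fun_prop) (f := fun x => f x ^ 2) hm.aestronglyMeasurable
  rw [h1] at e1
  rw [h2] at e2
  simp only [ne_eq, OfNat.ofNat_ne_zero, not_false_eq_true, zero_pow, add_zero, zero_mul] at e2
  rw [← e1, e2, gauss1_eq (g := fun u => f (√a * u) ^ 2)
    ((hfm.comp (measurable_const_mul _)).pow_const 2)]

theorem corr_coeff_sq (ha : 0 < a) (hb : |b| ≤ a) :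
    (√a * (b / a)) ^ 2 + (√a * √(1 - (b / a) ^ 2)) ^ 2 = a := by
  have h1 : (b / a) ^ 2 ≤ 1 := by
    rw [sq_le_one_iff_abs_le_one, abs_div, abs_of_pos ha]
    exact (div_le_one ha).2 hb
  rw [mul_pow, mul_pow, Real.sq_sqrt ha.le, Real.sq_sqrt (by linarith)]
  ring

/-- Polarization for the Gaussian correlation integral. -/
theorem integral_add_mul_sq (hfm : Measurable f) (hD : 0 ≤ D)
    (hg : ∀ x, |f x| ≤ D * (1 + |x|)) (ha : 0 < a) (hb : |b| ≤ a) (ε : ℝ) (hε : ε ^ 2 = 1) :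
    ∫ z : ℝ × ℝ, (f (√a * z.1 + 0 * z.2) + ε * f ((√a * (b / a)) * z.1
        + (√a * √(1 - (b / a) ^ 2)) * z.2)) ^ 2 ∂gaussPlane
      = 2 * (gauss1 fun u => f (√a * u) ^ 2) + 2 * ε * gauss2 f a b := by
  set c := √a * (b / a)
  set d := √a * √(1 - (b / a) ^ 2)
  have i1 := integrable_sq_comp_lin hfm hD hg (√a) 0
  have i2 := integrable_sq_comp_lin hfm hD hg c d
  have e1 := integral_sq_comp_lin (f := f) hfm ha.le (c := √a) (d := 0) (by
    rw [Real.sq_sqrt ha.le]; ring)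
  have e2 := integral_sq_comp_lin (f := f) hfm ha.le (corr_coeff_sq ha hb)
  have i3 : Integrable (fun z : ℝ × ℝ => f (√a * z.1 + 0 * z.2) * f (c * z.1 + d * z.2))
      gaussPlane := by
    refine Integrable.mono' (i1.add i2) ((hfm.comp (by fun_prop)).mul
      (hfm.comp (by fun_prop))).aestronglyMeasurable (ae_of_all _ fun z => ?_)
    rw [Real.norm_eq_abs, abs_le]
    change -(f _ ^ 2 + f _ ^ 2) ≤ _ ∧ _ ≤ f _ ^ 2 + f _ ^ 2
    constructor
    · nlinarith [sq_nonneg (f (√a * z.1 + 0 * z.2) + f (c * z.1 + d * z.2)),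
        sq_nonneg (f (√a * z.1 + 0 * z.2)), sq_nonneg (f (c * z.1 + d * z.2))]
    · nlinarith [sq_nonneg (f (√a * z.1 + 0 * z.2) - f (c * z.1 + d * z.2)),
        sq_nonneg (f (√a * z.1 + 0 * z.2)), sq_nonneg (f (c * z.1 + d * z.2))]
  have e3 : gauss2 f a b = ∫ z : ℝ × ℝ, f (√a * z.1 + 0 * z.2) * f (c * z.1 + d * z.2)
      ∂gaussPlane := by
    rw [gauss2_eq]; simp only [zero_mul, add_zero]; rfl
  have hexp : ∀ z : ℝ × ℝ, (f (√a * z.1 + 0 * z.2) + ε * f (c * z.1 + d * z.2)) ^ 2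
      = f (√a * z.1 + 0 * z.2) ^ 2 + f (c * z.1 + d * z.2) ^ 2
        + 2 * ε * (f (√a * z.1 + 0 * z.2) * f (c * z.1 + d * z.2)) := by
    intro z
    linear_combination f (c * z.1 + d * z.2) ^ 2 * hε
  simp only [hexp]
  have i12 : Integrable (fun z : ℝ × ℝ => f (√a * z.1 + 0 * z.2) ^ 2
      + f (c * z.1 + d * z.2) ^ 2) gaussPlane := i1.add i2
  rw [integral_add i12 (i3.const_mul _), integral_add i1 i2, integral_const_mul, e1, e2, ← e3]
  ring

/-- Both E(f(X) + f(Y))² and E(f(X) - f(Y))² are nonnegative. No continuity is required, since the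
bound is applied to derivatives of activation functions. -/
theorem abs_gauss2_le (hfm : Measurable f) (hD : 0 ≤ D)
    (hg : ∀ x, |f x| ≤ D * (1 + |x|)) (ha : 0 < a) (hb : |b| ≤ a) :
    |gauss2 f a b| ≤ gauss1 fun u => f (√a * u) ^ 2 := by
  have h1 := integral_add_mul_sq hfm hD hg ha hb 1 (by norm_num)
  have h2 := integral_add_mul_sq hfm hD hg ha hb (-1) (by norm_num)
  have p1 := integral_nonneg (μ := gaussPlane) (f := fun z : ℝ × ℝ => (f (√a * z.1 + 0 * z.2)
    + 1 * f ((√a * (b / a)) * z.1 + (√a * √(1 - (b / a) ^ 2)) * z.2)) ^ 2)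
    fun z => sq_nonneg _
  have p2 := integral_nonneg (μ := gaussPlane) (f := fun z : ℝ × ℝ => (f (√a * z.1 + 0 * z.2)
    + (-1) * f ((√a * (b / a)) * z.1 + (√a * √(1 - (b / a) ^ 2)) * z.2)) ^ 2)
    fun z => sq_nonneg _
  rw [h1] at p1
  rw [h2] at p2
  rw [abs_le]
  constructor <;> linarith

instance : (gaussianReal 0 1).IsOpenPosMeasure :=
  (gaussianReal_absolutelyContinuous' 0 one_ne_zero).isOpenPosMeasure

theorem integral_sq_pos_of_continuous {g : ℝ × ℝ → ℝ} (hg : Continuous g)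
    (hi : Integrable (fun z => g z ^ 2) gaussPlane) {z₀ : ℝ × ℝ} (h0 : g z₀ ≠ 0) :
    0 < ∫ z, g z ^ 2 ∂gaussPlane := by
  rw [integral_pos_iff_support_of_nonneg (fun z => sq_nonneg _) hi]
  refine IsOpen.measure_pos _ (hg.pow 2).isOpen_support ⟨z₀, ?_⟩
  simpa using h0

/-- Equality would force f(X) ± f(Y) to vanish almost surely. As `|b| < a`, the pair (X, Y) is a
linear bijection of the plane applied to a Gaussian of full support, so by continuity f(x) ± f(y)
would vanish for all x and y, and `f` would be constant. -/
theorem LipGrowth.abs_gauss2_lt (hf : LipGrowth D f) (ha : 0 < a) (hb : |b| < a)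
    (hne : ∃ x y, f x ≠ f y) :
    |gauss2 f a b| < gauss1 fun u => f (√a * u) ^ 2 := by
  have hc := hf.continuous
  have hD : 0 ≤ D := zero_le_one.trans hf.one_le
  set c := √a * (b / a) with hcdef
  set d := √a * √(1 - (b / a) ^ 2) with hddef
  have hsa : √a ≠ 0 := (Real.sqrt_pos.2 ha).ne'
  have hd : d ≠ 0 := by
    refine mul_ne_zero hsa (Real.sqrt_pos.2 ?_).ne'
    have : |b / a| < 1 := by rw [abs_div, abs_of_pos ha]; exact (div_lt_one ha).2 hb
    have := (sq_lt_one_iff_abs_lt_one _).2 this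
    linarith
  have key : ∀ ε : ℝ, ε ^ 2 = 1 → 0 < 2 * (gauss1 fun u => f (√a * u) ^ 2)
      + 2 * ε * gauss2 f a b := by
    intro ε hε
    rw [← integral_add_mul_sq hc.measurable hD hf.growth ha hb.le ε hε]
    have hsurj : ∀ x y : ℝ, ∃ z : ℝ × ℝ, √a * z.1 + 0 * z.2 = x ∧ c * z.1 + d * z.2 = y := by
      intro x y
      refine ⟨(x / √a, (y - c * (x / √a)) / d), ?_, ?_⟩
      · field_simp; ring
      · field_simp; ring
    obtain ⟨x, y, hxy⟩ : ∃ x y, f x + ε * f y ≠ 0 := by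
      by_contra! hcon
      obtain ⟨x, y, hxy⟩ := hne
      apply hxy
      linarith [hcon x x, hcon y x]
    obtain ⟨z, hz1, hz2⟩ := hsurj x y
    refine integral_sq_pos_of_continuous (g := fun z => f (√a * z.1 + 0 * z.2)
      + ε * f (c * z.1 + d * z.2)) (by fun_prop) ?_ (z₀ := z) (by simpa only [hz1, hz2] using hxy)
    have i1 := integrable_sq_comp_lin hc.measurable hD hf.growth (√a) 0
    have i2 := integrable_sq_comp_lin hc.measurable hD hf.growth c d
    refine Integrable.mono' ((i1.add i2).const_mul 2) (by fun_prop) (ae_of_all _ fun z => ?_)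
    rw [Real.norm_of_nonneg (sq_nonneg _)]
    change _ ≤ 2 * (f _ ^ 2 + f _ ^ 2)
    nlinarith [sq_nonneg (f (√a * z.1 + 0 * z.2) - ε * f (c * z.1 + d * z.2)),
      sq_nonneg (f (c * z.1 + d * z.2))]
  rw [abs_lt]
  constructor
  · linarith [key 1 (by norm_num)]
  · linarith [key (-1) (by norm_num)]

end CauchySchwarz

/-! ### Inequalities between the limiting order parameters -/

namespace Model

/-- Standing assumptions on the model. -/
structure Regular (m : Model) : Prop where
  a_pos : ∀ l ≤ m.H, 0 < m.a l
  σw_pos : 0 < m.σw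
  ρ_pos : 0 < m.ρ
  H_pos : 1 ≤ m.H
  C_pos : 1 ≤ m.C
  lip : ∀ l, 1 ≤ l → l ≤ m.H → ∃ D, LipGrowth D (m.φ l)
  nonconst : ∀ l, 1 ≤ l → l ≤ m.H → ∃ x y, m.φ l x ≠ m.φ l y

variable {m : Model}

theorem Regular.abs_preST_lt (hm : m.Regular) {l : ℕ} (h : |m.fwdST l| < m.fwdT l) :
    |m.preST l| < m.preT l := by
  unfold preST preT
  have h1 := abs_add_le (m.σw ^ 2 * m.fwdST l) (m.σb ^ 2)
  rw [abs_mul, abs_of_nonneg (sq_nonneg m.σb), abs_of_nonneg (sq_nonneg m.σw)] at h1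
  have := mul_lt_mul_of_pos_left h (pow_pos hm.σw_pos 2)
  linarith

/-- Strictness propagates from the inputs (0 < 1) through non-constant activations. It yields
positive limiting norms and nondegenerate limiting covariances, as the stability estimates require.
-/
theorem Regular.abs_fwdST_lt (hm : m.Regular) (l : ℕ) (hl : l ≤ m.H) :
    |m.fwdST l| < m.fwdT l := by
  induction l with
  | zero => simp [fwdST, fwdT]
  | succ l ih =>
    have h1 := hm.abs_preST_lt (ih (by omega))
    obtain ⟨D, hD⟩ := hm.lip (l + 1) (by omega) hl
    exact hD.abs_gauss2_lt ((abs_nonneg _).trans_lt h1) h1 (hm.nonconst (l + 1) (by omega) hl)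

theorem Regular.fwdT_pos (hm : m.Regular) {l : ℕ} (hl : l ≤ m.H) : 0 < m.fwdT l :=
  (abs_nonneg _).trans_lt (hm.abs_fwdST_lt l hl)

theorem Regular.preST_lt (hm : m.Regular) {l : ℕ} (hl : l ≤ m.H) : |m.preST l| < m.preT l :=
  hm.abs_preST_lt (hm.abs_fwdST_lt l hl)

theorem Regular.preT_pos (hm : m.Regular) {l : ℕ} (hl : l ≤ m.H) : 0 < m.preT l :=
  (abs_nonneg _).trans_lt (hm.preST_lt hl)

theorem LipGrowth_deriv_le {D : ℝ} {f : ℝ → ℝ} (hf : LipGrowth D f) (x : ℝ) :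
    |deriv f x| ≤ D := by
  have hD : 0 ≤ D := zero_le_one.trans hf.one_le
  have h : LipschitzWith ⟨D, hD⟩ f := LipschitzWith.of_dist_le_mul fun x y => by
    rw [Real.dist_eq, Real.dist_eq]
    exact hf.lip x y
  exact norm_deriv_le_of_lipschitz h

/-- Cauchy–Schwarz for the derivative at each layer, multiplied down from the readout. -/
theorem Regular.abs_bwdSTAux_le (hm : m.Regular) (d l : ℕ) (hl : l + d ≤ m.H) :
    |m.bwdSTAux d l| ≤ m.bwdTAux d l := by
  induction d generalizing l with
  | zero => simp [bwdSTAux, bwdTAux]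
  | succ d ih =>
    have h1 := ih (l + 1) (by omega)
    obtain ⟨D, hD⟩ := hm.lip (l + 1) (by omega) (by omega)
    have hD0 : 0 ≤ D := zero_le_one.trans hD.one_le
    have h2 := abs_gauss2_le (measurable_deriv (m.φ (l + 1))) hD0 (fun x =>
      (LipGrowth_deriv_le hD x).trans (by nlinarith [abs_nonneg x]))
      (hm.preT_pos (by omega : l ≤ m.H)) (hm.preST_lt (by omega : l ≤ m.H)).le
    simp only [bwdSTAux, bwdTAux, abs_mul, abs_of_nonneg (sq_nonneg m.σw)]
    exact mul_le_mul (mul_le_mul_of_nonneg_left h1 (sq_nonneg _)) h2 (abs_nonneg _)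
      (mul_nonneg (sq_nonneg _) ((abs_nonneg _).trans h1))

theorem Regular.abs_bwdST_le (hm : m.Regular) {l : ℕ} (hl : l ≤ m.H) :
    |m.bwdST l| ≤ m.bwdT l :=
  hm.abs_bwdSTAux_le _ _ (by omega)

theorem Regular.alpha_pos (hm : m.Regular) : 0 < m.alpha := by
  refine Finset.sum_pos (fun l hl => ?_) ⟨0, Finset.mem_range.2 hm.H_pos⟩
  rw [Finset.mem_range] at hl
  exact mul_pos (hm.a_pos _ (by omega)) (hm.a_pos _ (by omega))

theorem Regular.kappa2_le (hm : m.Regular) : m.kappa2 ≤ m.kappa1 := by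
  refine Finset.sum_le_sum fun l hl => ?_
  rw [Finset.mem_range] at hl
  rw [mul_assoc, mul_assoc]
  refine mul_le_mul_of_nonneg_left ?_ (div_nonneg (hm.a_pos l (by omega)).le hm.alpha_pos.le)
  have h1 := hm.abs_bwdST_le (l := l) (by omega)
  have h2 := (hm.abs_fwdST_lt l (by omega)).le
  refine (le_abs_self _).trans ?_
  rw [abs_mul]
  exact mul_le_mul h1 h2 (abs_nonneg _) ((abs_nonneg _).trans h1)

end Model

/-! ### Concentration of overlaps given the lower layers -/

section PairConcentration

variable {Ω : Type*} [MeasurableSpace Ω] {P : Measure Ω} [IsProbabilityMeasure P]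

/-- Here `d` bounds the deviation of the empirical covariance from its limit. The fluctuation
contributes n⁻² times a moment that grows like d⁴, absorbed through n⁻² ≤ 1, and the bias
contributes (L·d)⁴. -/
theorem LipGrowth.pair_concentration {D : ℝ} {f : ℝ → ℝ} (hf : LipGrowth D f) {n : ℕ} (hn : 0 < n)
    {X Y : Fin n → Ω → ℝ} {A B C : ℝ} (hp : ∀ i, GaussPair P (X i) (Y i) A B C)
    (hind : iIndepFun (fun i ω => (X i ω, Y i ω)) P) {a q L d : ℝ} (ha : 0 ≤ a)
    (hd : 0 ≤ d) (hA : A ≤ a + d) (hC : C ≤ a + d)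
    (hq : ∀ i, |∫ ω, f (X i ω) * f (Y i ω) ∂P - q| ≤ L * d) :
    Integrable (fun ω => ((∑ i, f (X i ω) * f (Y i ω)) / n - q) ^ 4) P ∧
    ∫ ω, ((∑ i, f (X i ω) * f (Y i ω)) / n - q) ^ 4 ∂P
      ≤ (384 * (128 * D ^ 8 * ∫ z, wt z ^ 8 ∂gaussPlane) * (17 + 16 * a ^ 4) + 8 * L ^ 4)
        * (d ^ 4 + 1 / n ^ 2) := by
  have hc := hf.continuous
  have hm : ∀ i, Measurable fun ω => f (X i ω) * f (Y i ω) := fun i =>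
    (hc.measurable.comp (hp i).measX).mul (hc.measurable.comp (hp i).measY)
  have hi : iIndepFun (fun i ω => f (X i ω) * f (Y i ω)) P :=
    hind.comp (fun _ p => f p.1 * f p.2) fun _ => by
      have : Continuous fun p : ℝ × ℝ => f p.1 * f p.2 := by fun_prop
      exact this.measurable
  have h4 := fun i => hf.gaussPair_fourth_moment (hp i)
  obtain ⟨h1, h2⟩ := fourth_moment_mean_le hn hm hi (fun i => (h4 i).1) hq (fun i => (h4 i).2)
  refine ⟨h1, h2.trans ?_⟩
  set K₀ := 128 * D ^ 8 * ∫ z, wt z ^ 8 ∂gaussPlane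
  have hD : 0 ≤ D := zero_le_one.trans hf.one_le
  have hK : 0 ≤ K₀ := by
    have : 0 ≤ ∫ z, wt z ^ 8 ∂gaussPlane := integral_nonneg fun z => by positivity
    positivity
  have hpow : ∀ V : ℝ, 0 ≤ V → V ≤ a + d → V ^ 4 ≤ 8 * (a ^ 4 + d ^ 4) := by
    intro V h0 hV
    have e1 := pow_le_pow_left₀ h0 hV 4
    have e2 := add_pow_le ha hd 4
    norm_num at e2
    linarith
  have hn1 : (1 : ℝ) ≤ n := by exact_mod_cast hn
  set r := 1 / (n : ℝ) ^ 2 with hr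
  have hr0 : 0 ≤ r := by positivity
  have hr1 : r ≤ 1 := by
    rw [hr, div_le_one (by positivity)]
    exact one_le_pow₀ hn1
  have hAC : 1 + A ^ 4 + C ^ 4 ≤ 1 + 16 * a ^ 4 + 16 * d ^ 4 := by
    have : ∀ i : Fin n, A ^ 4 ≤ 8 * (a ^ 4 + d ^ 4) ∧ C ^ 4 ≤ 8 * (a ^ 4 + d ^ 4) := fun i =>
      ⟨hpow A (hp i).nonnegA hA, hpow C (hp i).nonnegC hC⟩
    have := this ⟨0, hn⟩
    linarith
  have hd4 : 0 ≤ d ^ 4 := by positivity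
  have hL4 : 0 ≤ L ^ 4 := by positivity
  have ha4 : 0 ≤ a ^ 4 := by positivity
  calc 384 * (K₀ * (1 + A ^ 4 + C ^ 4)) / n ^ 2 + 8 * (L * d) ^ 4
      = 384 * K₀ * (1 + A ^ 4 + C ^ 4) * r + 8 * L ^ 4 * d ^ 4 := by rw [hr]; ring
    _ ≤ 384 * K₀ * (1 + 16 * a ^ 4 + 16 * d ^ 4) * r + 8 * L ^ 4 * d ^ 4 := by
        gcongr
    _ ≤ _ := by
        have e1 : d ^ 4 * r ≤ d ^ 4 := mul_le_of_le_one_right hd4 hr1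
        have e2 := mul_le_mul_of_nonneg_left e1 hK
        have e3 := mul_nonneg hL4 hr0
        have e4 := mul_nonneg hK hr0
        have e5 := mul_nonneg (mul_nonneg hK ha4) hd4
        have e6 := mul_nonneg hK hd4
        nlinarith

end PairConcentration

/-! ### Pre-activations as Gaussian pairs given the activities below -/

section Layers

variable {n : ℕ → ℕ} {H : ℕ}

/-- The layer of a parameter. -/
def layerOf : Param n H → ℕ
  | Sum.inl w => w.1
  | Sum.inr w => w.1

/-- The parameters of layer `l`. -/
def layerSet (n : ℕ → ℕ) (H l : ℕ) : Set (Param n H) := {p | layerOf p = l}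

instance (l : ℕ) : DecidablePred (· ∈ layerSet n H l) := fun p =>
  inferInstanceAs (Decidable (layerOf p = l))

/-- Affine image of a vector of activities. -/
def linPre (θ : Param n H → ℝ) (l : ℕ) (h : Fin (n l) → ℝ) (i : Fin (n (l + 1))) : ℝ :=
  ∑ j, weight θ l i j * h j + bias θ l i

theorem weight_resample (θ θ' : Param n H → ℝ) (l m : ℕ) (i : Fin (n (m + 1))) (j : Fin (n m)) :
    weight (resample (layerSet n H l) θ θ') m i j = if m = l then weight θ' m i j
      else weight θ m i j := by
  unfold weight resample
  by_cases h : m < H + 1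
  · simp only [dif_pos h]
    by_cases hm : m = l
    · rw [if_pos hm]; exact if_pos hm
    · rw [if_neg hm]; exact if_neg hm
  · simp only [dif_neg h, ite_self]

theorem bias_resample (θ θ' : Param n H → ℝ) (l m : ℕ) (i : Fin (n (m + 1))) :
    bias (resample (layerSet n H l) θ θ') m i = if m = l then bias θ' m i else bias θ m i := by
  unfold bias resample
  by_cases h : m < H + 1
  · simp only [dif_pos h]
    by_cases hm : m = l
    · rw [if_pos hm]; exact if_pos hm
    · rw [if_neg hm]; exact if_neg hm
  · simp only [dif_neg h, ite_self]

theorem act_resample (φ : ℕ → ℝ → ℝ) (θ θ' : Param n H → ℝ) (x : Fin (n 0) → ℝ) (l m : ℕ)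
    (hm : m ≤ l) :
    act φ (resample (layerSet n H l) θ θ') x m = act φ θ x m := by
  induction m with
  | zero => rfl
  | succ m ih =>
    ext i
    have hne : m ≠ l := by omega
    simp only [act, weight_resample, bias_resample, if_neg hne, ih (by omega)]

theorem preact_resample_of_lt (φ : ℕ → ℝ → ℝ) (θ θ' : Param n H → ℝ) (x : Fin (n 0) → ℝ)
    (l m : ℕ) (hm : m < l) (i : Fin (n (m + 1))) :
    preact φ (resample (layerSet n H l) θ θ') x m i = preact φ θ x m i := by
  have hne : m ≠ l := by omega
  simp only [preact, weight_resample, bias_resample, if_neg hne, act_resample φ θ θ' x l m hm.le]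

theorem preact_resample (φ : ℕ → ℝ → ℝ) (θ θ' : Param n H → ℝ) (x : Fin (n 0) → ℝ) (l : ℕ)
    (i : Fin (n (l + 1))) :
    preact φ (resample (layerSet n H l) θ θ') x l i = linPre θ' l (act φ θ x l) i := by
  simp only [preact, linPre, weight_resample, bias_resample, if_pos, act_resample φ θ θ' x l l le_rfl]

/-- The parameters entering unit `i` of layer `l + 1`, indexed by the units of layer `l` and by
`none` for the bias. -/
def rowParam {l : ℕ} (hl : l < H + 1) (q : Fin (n (l + 1)) × Option (Fin (n l))) : Param n H :=
  match q with
  | (i, none) => Sum.inr ⟨⟨l, hl⟩, i⟩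
  | (i, some j) => Sum.inl ⟨⟨l, hl⟩, i, j⟩

theorem rowParam_injective {l : ℕ} (hl : l < H + 1) :
    Function.Injective (rowParam (n := n) hl) := by
  rintro ⟨i, _ | j⟩ ⟨i', _ | j'⟩ h <;> simp_all [rowParam]

theorem linPre_eq_sum {l : ℕ} (hl : l < H + 1) (θ : Param n H → ℝ) (h : Fin (n l) → ℝ)
    (i : Fin (n (l + 1))) :
    linPre θ l h i = ∑ o : Option (Fin (n l)), o.elim 1 h * θ (rowParam hl (i, o)) := by
  rw [Fintype.sum_option]
  simp only [linPre, weight, bias, dif_pos hl, Option.elim, rowParam]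
  rw [one_mul, add_comm]
  simp only [mul_comm]

/-- Law of the parameters. -/
abbrev paramLaw (n : ℕ → ℕ) (H : ℕ) (σw σb : ℝ) : Measure (Param n H → ℝ) :=
  Measure.pi fun p => gaussianReal 0 (paramVar (n := n) (H := H) σw σb p).toNNReal

/-- Law of the samples. -/
abbrev inputLaw (n : ℕ → ℕ) (T : ℕ) : Measure (Fin T → Fin (n 0) → ℝ) :=
  Measure.pi fun _ => Measure.pi fun _ => gaussianReal 0 1

variable (σw σb : ℝ)

theorem measurable_linPre (l : ℕ) (h : Fin (n l) → ℝ) (i : Fin (n (l + 1))) :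
    Measurable fun θ : Param n H → ℝ => linPre θ l h i := by
  unfold linPre weight bias
  by_cases hl : l < H + 1
  · simp only [dif_pos hl]; fun_prop
  · simp only [dif_neg hl]; fun_prop

theorem iIndepFun_param : iIndepFun (fun (p : Param n H) (θ : Param n H → ℝ) => θ p)
    (paramLaw n H σw σb) :=
  iIndepFun_pi (X := fun _ x => x) fun _ => aemeasurable_id

theorem map_param (p : Param n H) : (paramLaw n H σw σb).map (fun θ => θ p)
    = gaussianReal 0 (paramVar (n := n) (H := H) σw σb p).toNNReal :=
  (measurePreserving_eval _ p).map_eq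

/-- Different units read disjoint rows of independent parameters. -/
theorem iIndepFun_linPre {l : ℕ} (hl : l ≤ H) (h h' : Fin (n l) → ℝ) :
    iIndepFun (fun i (θ : Param n H → ℝ) => (linPre θ l h i, linPre θ l h' i))
      (paramLaw n H σw σb) := by
  have hl' : l < H + 1 := by omega
  have h1 := iIndepFun_rows (fun p => measurable_pi_apply _)
    ((iIndepFun_param (n := n) (H := H) σw σb).precomp (rowParam_injective hl'))
  have := h1.comp (fun _ r => (∑ o : Option (Fin (n l)), o.elim 1 h * r o,
    ∑ o : Option (Fin (n l)), o.elim 1 h' * r o)) fun _ => by fun_prop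
  convert this using 3 with i θ
  exact Prod.ext (linPre_eq_sum hl' _ _ _) (linPre_eq_sum hl' _ _ _)

/-- For frozen activities a pre-activation is a linear form in the parameters of one row. With
weight variance σw²/(fan-in) the covariances are empirical overlaps, the finite-width form of the
recursion for the order parameters. -/
theorem gaussPair_linPre {l : ℕ} (hl : l ≤ H) (h h' : Fin (n l) → ℝ) (i : Fin (n (l + 1))) :
    GaussPair (paramLaw n H σw σb) (fun θ => linPre θ l h i) (fun θ => linPre θ l h' i)
      (σw ^ 2 * ((∑ j, h j * h j) / n l) + σb ^ 2) (σw ^ 2 * ((∑ j, h j * h' j) / n l) + σb ^ 2)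
      (σw ^ 2 * ((∑ j, h' j * h' j) / n l) + σb ^ 2) := by
  have hl' : l < H + 1 := by omega
  have hsq : ∀ g : Fin (n l) → ℝ, 0 ≤ σw ^ 2 * ((∑ j, g j * g j) / n l) + σb ^ 2 := fun g => by
    have : 0 ≤ ∑ j, g j * g j := Finset.sum_nonneg fun j _ => mul_self_nonneg _
    positivity
  refine ⟨measurable_linPre l h i, measurable_linPre l h' i, hsq h, hsq h', fun a b => ?_⟩
  have h2 : ∀ θ : Param n H → ℝ, a * linPre θ l h i + b * linPre θ l h' i
      = ∑ o : Option (Fin (n l)), (a * o.elim 1 h + b * o.elim 1 h') * θ (rowParam hl' (i, o)) := by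
    intro θ
    rw [linPre_eq_sum hl', linPre_eq_sum hl', Finset.mul_sum, Finset.mul_sum,
      ← Finset.sum_add_distrib]
    exact Finset.sum_congr rfl fun o _ => by ring
  simp only [h2]
  have hinj : Function.Injective fun o : Option (Fin (n l)) => rowParam (n := n) hl' (i, o) :=
    fun o o' ho => by simpa using rowParam_injective hl' ho
  rw [map_sum_gaussian (fun o => (paramVar (n := n) (H := H) σw σb
      (rowParam hl' (i, o))).toNNReal) (fun o => measurable_pi_apply _)
    ((iIndepFun_param (n := n) (H := H) σw σb).precomp hinj) (fun o => map_param σw σb _)]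
  congr 2
  rw [Fintype.sum_option]
  simp only [rowParam, paramVar, Option.elim]
  rw [Real.coe_toNNReal _ (sq_nonneg _), Real.coe_toNNReal _ (by positivity)]
  have e : ∀ j, (a * h j + b * h' j) ^ 2 * (σw ^ 2 / n l)
      = a ^ 2 * (σw ^ 2 / n l) * (h j * h j) + 2 * a * b * (σw ^ 2 / n l) * (h j * h' j)
        + b ^ 2 * (σw ^ 2 / n l) * (h' j * h' j) := fun j => by ring
  simp only [e, Finset.sum_add_distrib, ← Finset.mul_sum]
  ring

end Layers

/-! ### The joint law and measurability -/

section Law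

variable {n : ℕ → ℕ} {H T : ℕ} (σw σb : ℝ)

instance : IsProbabilityMeasure (law n H T σw σb) := by unfold law; infer_instance

theorem lintegral_law {f : (Param n H → ℝ) × (Fin T → Fin (n 0) → ℝ) → ENNReal}
    (hf : Measurable f) :
    ∫⁻ ω, f ω ∂(law n H T σw σb)
      = ∫⁻ X, ∫⁻ θ, f (θ, X) ∂(paramLaw n H σw σb) ∂(inputLaw n T) := by
  unfold law
  exact lintegral_prod_symm' _ hf

theorem measurable_resample_law (S : Set (Param n H)) [DecidablePred (· ∈ S)] :
    Measurable fun z : ((Param n H → ℝ) × (Fin T → Fin (n 0) → ℝ)) × (Param n H → ℝ) =>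
      (resample S z.1.1 z.2, z.1.2) :=
  ((measurable_resample S).comp (measurable_fst.fst.prodMk measurable_snd)).prodMk measurable_fst.snd

theorem lintegral_law_resample (S : Set (Param n H)) [DecidablePred (· ∈ S)]
    {f : (Param n H → ℝ) × (Fin T → Fin (n 0) → ℝ) → ENNReal} (hf : Measurable f) :
    ∫⁻ ω, f ω ∂(law n H T σw σb)
      = ∫⁻ ω, ∫⁻ θ', f (resample S ω.1 θ', ω.2) ∂(paramLaw n H σw σb) ∂(law n H T σw σb) := by
  have hm : Measurable fun ω : (Param n H → ℝ) × (Fin T → Fin (n 0) → ℝ) =>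
      ∫⁻ θ', f (resample S ω.1 θ', ω.2) ∂(paramLaw n H σw σb) :=
    (hf.comp (measurable_resample_law (T := T) S)).lintegral_prod_right'
  rw [lintegral_law σw σb hf, lintegral_law σw σb hm]
  refine lintegral_congr fun X => ?_
  exact lintegral_resample _ S (f := fun θ => f (θ, X)) (hf.comp (by fun_prop))

theorem measurable_weight (l : ℕ) (i : Fin (n (l + 1))) (j : Fin (n l)) :
    Measurable fun θ : Param n H → ℝ => weight θ l i j := by
  unfold weight; split_ifs <;> fun_prop

theorem measurable_bias (l : ℕ) (i : Fin (n (l + 1))) :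
    Measurable fun θ : Param n H → ℝ => bias θ l i := by
  unfold bias; split_ifs <;> fun_prop

theorem measurable_preact_of_act {φ : ℕ → ℝ → ℝ} (t : Fin T) {l : ℕ}
    (h : ∀ j, Measurable fun ω : (Param n H → ℝ) × (Fin T → Fin (n 0) → ℝ) =>
      act φ ω.1 (ω.2 t) l j) (i : Fin (n (l + 1))) :
    Measurable fun ω : (Param n H → ℝ) × (Fin T → Fin (n 0) → ℝ) =>
      preact φ ω.1 (ω.2 t) l i := by
  unfold preact
  exact (Finset.measurable_sum _ fun j _ =>
    ((measurable_weight l i j).comp measurable_fst).mul (h j)).add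
      ((measurable_bias l i).comp measurable_fst)

theorem measurable_act {φ : ℕ → ℝ → ℝ} (t : Fin T) (l : ℕ)
    (hφ : ∀ m, 1 ≤ m → m ≤ l → Measurable (φ m)) (j : Fin (n l)) :
    Measurable fun ω : (Param n H → ℝ) × (Fin T → Fin (n 0) → ℝ) => act φ ω.1 (ω.2 t) l j := by
  induction l with
  | zero => simp only [act]; fun_prop
  | succ l ih =>
    exact (hφ (l + 1) (by omega) le_rfl).comp
      (measurable_preact_of_act t (ih fun m h1 h2 => hφ m h1 (by omega)) j)

theorem measurable_preact {φ : ℕ → ℝ → ℝ} (t : Fin T) (l : ℕ)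
    (hφ : ∀ m, 1 ≤ m → m ≤ l → Measurable (φ m)) (i : Fin (n (l + 1))) :
    Measurable fun ω : (Param n H → ℝ) × (Fin T → Fin (n 0) → ℝ) => preact φ ω.1 (ω.2 t) l i :=
  measurable_preact_of_act t (measurable_act t l hφ) i

theorem measurable_actDot {φ : ℕ → ℝ → ℝ} (s t : Fin T) (l : ℕ)
    (hφ : ∀ m, 1 ≤ m → m ≤ l → Measurable (φ m)) :
    Measurable fun ω : (Param n H → ℝ) × (Fin T → Fin (n 0) → ℝ) =>
      actDot φ ω.1 (ω.2 s) (ω.2 t) l :=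
  Finset.measurable_sum _ fun j _ => (measurable_act s l hφ j).mul (measurable_act t l hφ j)

theorem measurable_back {φ : ℕ → ℝ → ℝ} (t : Fin T) (k : Fin (n (H + 1))) (l : ℕ) (hl : l ≤ H)
    (hφ : ∀ m, 1 ≤ m → m ≤ H → Measurable (φ m)) (i : Fin (n (l + 1))) :
    Measurable fun ω : (Param n H → ℝ) × (Fin T → Fin (n 0) → ℝ) =>
      back φ ω.1 (ω.2 t) k l i := by
  obtain ⟨d, hd⟩ : ∃ d, l + d = H := ⟨H - l, by omega⟩
  induction d generalizing l with
  | zero =>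
    obtain rfl : l = H := by omega
    simp only [back_top]
    split_ifs <;> fun_prop
  | succ d ih =>
    have hl : l < H := by omega
    simp only [back_of_lt φ _ _ k hl]
    exact ((measurable_deriv _).comp (measurable_preact t l
      (fun m h1 h2 => hφ m h1 (by omega)) i)).mul
      (Finset.measurable_sum _ fun j _ => (ih (l + 1) hl j (by omega)).mul
        ((measurable_weight (l + 1) j i).comp measurable_fst))

theorem measurable_crossOverlap {φ : ℕ → ℝ → ℝ} (s t : Fin T) (k k' : Fin (n (H + 1))) (l : ℕ)
    (hl : l ≤ H) (hφ : ∀ m, 1 ≤ m → m ≤ H → Measurable (φ m)) :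
    Measurable fun ω : (Param n H → ℝ) × (Fin T → Fin (n 0) → ℝ) =>
      crossOverlap φ ω.1 (ω.2 s) (ω.2 t) k k' l :=
  Finset.measurable_sum _ fun i _ =>
    (measurable_back s k l hl hφ i).mul (measurable_back t k' l hl hφ i)

end Law

/-! ### The input layer -/

section Input

variable {n : ℕ → ℕ} {T : ℕ}

theorem iIndepFun_input : iIndepFun (fun (p : Fin T × Fin (n 0)) (X : Fin T → Fin (n 0) → ℝ) =>
    X p.1 p.2) (inputLaw n T) := by
  have := iIndepFun_uncurry_infinitePi' (ι := Fin T) (κ := Fin (n 0)) (X := fun _ _ x => x)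
    (fun _ _ => gaussianReal 0 1) fun _ _ => measurable_id
  simpa only [Measure.infinitePi_eq_pi] using this

theorem map_input (t : Fin T) (j : Fin (n 0)) :
    (inputLaw n T).map (fun X => X t j) = gaussianReal 0 1 :=
  ((measurePreserving_eval (fun _ : Fin (n 0) => gaussianReal 0 1) j).comp
    (measurePreserving_eval (fun _ : Fin T => Measure.pi fun _ : Fin (n 0) =>
      gaussianReal 0 1) t)).map_eq

/-- Base case of the forward induction: products of standard Gaussian coordinates have mean exactly
1 or 0, so only the fluctuation remains. -/
theorem input_fourth_moment (hn : 0 < n 0) (s t : Fin T) :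
    Integrable (fun X : Fin T → Fin (n 0) → ℝ =>
      ((∑ j, X s j * X t j) / n 0 - if s = t then 1 else 0) ^ 4) (inputLaw n T) ∧
    ∫ X, ((∑ j, X s j * X t j) / n 0 - if s = t then 1 else 0) ^ 4 ∂(inputLaw n T)
      ≤ 384 * (∫ u, u ^ 8 ∂(gaussianReal 0 1)) / n 0 ^ 2 := by
  have hme : ∀ (t : Fin T) (j : Fin (n 0)), Measurable fun X : Fin T → Fin (n 0) → ℝ => X t j :=
    fun t j => by fun_prop
  have hL : ∀ (t : Fin T) (j : Fin (n 0)) (k : ℕ), MemLp (fun X => X t j) k (inputLaw n T) := by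
    intro t j k
    have h : MemLp id (k : NNReal) ((inputLaw n T).map fun X => X t j) := by
      rw [map_input]; exact memLp_id_gaussianReal _
    simpa using (memLp_map_measure_iff aestronglyMeasurable_id (hme t j).aemeasurable).1 h
  have h8 : ∀ (t : Fin T) (j : Fin (n 0)), ∫ X, X t j ^ 8 ∂(inputLaw n T)
      = ∫ u, u ^ 8 ∂(gaussianReal 0 1) := by
    intro t j
    rw [← map_input t j, integral_map (hme t j).aemeasurable (by fun_prop)]
  have hmul := fun j => integral_mul_pow_four_le (hL s j 8) (hL t j 8)
  have hrow : iIndepFun (fun j (X : Fin T → Fin (n 0) → ℝ) => X s j * X t j) (inputLaw n T) := by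
    have h1 := iIndepFun_rows (P := inputLaw n T) (X := fun (p : Fin (n 0) × Fin T) X => X p.2 p.1)
      (fun p => by fun_prop)
      (iIndepFun_input.precomp (g := fun p : Fin (n 0) × Fin T => (p.2, p.1))
        (Prod.swap_injective))
    exact h1.comp (fun _ r => r s * r t) fun _ => by fun_prop
  have hmean : ∀ j, |∫ X, X s j * X t j ∂(inputLaw n T) - if s = t then 1 else 0| ≤ 0 := by
    intro j
    have h0 : ∀ t : Fin T, ∫ X, X t j ∂(inputLaw n T) = 0 := by
      intro t
      have := integral_map (μ := inputLaw n T) (φ := fun X => X t j) (hme t j).aemeasurable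
        (f := fun x : ℝ => x) (by fun_prop)
      rw [← this, map_input, integral_id_gaussianReal]
    rw [abs_nonpos_iff, sub_eq_zero]
    split_ifs with hst
    · subst hst
      have h1 := integral_map (μ := inputLaw n T) (φ := fun X => X s j) (hme s j).aemeasurable
        (f := fun x : ℝ => x * x) (by fun_prop)
      rw [← h1, map_input]
      have h2 := variance_fun_id_gaussianReal (μ := 0) (v := 1)
      rw [variance_eq_integral (by fun_prop)] at h2
      simpa [integral_id_gaussianReal, sq] using h2
    · have hne : ((s, j) : Fin T × Fin (n 0)) ≠ (t, j) := by simpa using hst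
      have := (iIndepFun_input (n := n) (T := T)).indepFun hne
      rw [this.integral_fun_mul_eq_mul_integral (hme s j).aestronglyMeasurable
        (hme t j).aestronglyMeasurable, h0, zero_mul]
  have := fourth_moment_mean_le hn (fun j => by fun_prop) hrow (fun j => (hmul j).1) hmean
    (fun j => (hmul j).2.trans (le_of_eq (by rw [h8, h8, add_self_div_two])))
  simpa using this

end Input

theorem add_add_pow_four_le (x y z : ℝ) :
    (x + y + z) ^ 4 ≤ 27 * (x ^ 4 + y ^ 4 + z ^ 4) := by
  have h1 : (x + y + z) ^ 2 ≤ 3 * (x ^ 2 + y ^ 2 + z ^ 2) := by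
    nlinarith [sq_nonneg (x - y), sq_nonneg (x - z), sq_nonneg (y - z)]
  have h2 : (x ^ 2 + y ^ 2 + z ^ 2) ^ 2 ≤ 3 * (x ^ 4 + y ^ 4 + z ^ 4) := by
    nlinarith [sq_nonneg (x ^ 2 - y ^ 2), sq_nonneg (x ^ 2 - z ^ 2), sq_nonneg (y ^ 2 - z ^ 2)]
  calc (x + y + z) ^ 4 = ((x + y + z) ^ 2) ^ 2 := by ring
    _ ≤ (3 * (x ^ 2 + y ^ 2 + z ^ 2)) ^ 2 := pow_le_pow_left₀ (sq_nonneg _) h1 2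
    _ = 9 * (x ^ 2 + y ^ 2 + z ^ 2) ^ 2 := by ring
    _ ≤ _ := by linarith

/-! ### Convergence of the forward order parameters -/

namespace Model

variable {m : Model}

instance (M : ℕ) : IsProbabilityMeasure (m.P M) := by unfold P; infer_instance

theorem width_of_le {M l : ℕ} (hl : l ≤ m.H) : m.width M l = ⌊m.a l * M⌋₊ := if_pos hl

theorem width_top (M : ℕ) : m.width M (m.H + 1) = m.C := if_neg (by omega)

theorem Regular.eventually_width (hm : m.Regular) :
    ∀ᶠ M : ℕ in atTop, ∀ l ≤ m.H, 0 < m.width M l ∧ m.a l * M / 2 ≤ m.width M l := by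
  refine (eventually_all_finite (Set.finite_le_nat m.H)).2 fun l hl => ?_
  have ha := hm.a_pos l hl
  filter_upwards [eventually_ge_atTop ⌈2 / m.a l⌉₊] with M hM
  have h1 : 2 ≤ m.a l * M := by
    have := (Nat.le_ceil _).trans (Nat.cast_le.2 hM : ((⌈2 / m.a l⌉₊ : ℕ) : ℝ) ≤ M)
    rw [div_le_iff₀ ha] at this
    linarith
  have h2 := Nat.lt_floor_add_one (m.a l * M)
  rw [width_of_le hl]
  constructor
  · exact Nat.floor_pos.2 (by linarith)
  · linarith

theorem width_le {M l : ℕ} (hm : m.Regular) (hl : l ≤ m.H) : (m.width M l : ℝ) ≤ m.a l * M := by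
  rw [width_of_le hl]
  exact Nat.floor_le (mul_nonneg (hm.a_pos l hl).le (Nat.cast_nonneg _))

theorem le_width_add_one (m : Model) {M l : ℕ} (hl : l ≤ m.H) : m.a l * M ≤ m.width M l + 1 := by
  rw [width_of_le hl]
  exact (Nat.lt_floor_add_one _).le

/-- Deviation of the forward order parameter of layer `l` from its limit. -/
def fwdDev (m : Model) (M l : ℕ) (s t : Fin (m.samples M)) (ω : m.Sample M) : ℝ :=
  actDot m.φ ω.1 (ω.2 s) (ω.2 t) l / m.width M l - if s = t then m.fwdT l else m.fwdST l

theorem Regular.measurable_φ (hm : m.Regular) (l : ℕ) (h1 : 1 ≤ l) (h2 : l ≤ m.H) :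
    Measurable (m.φ l) := by
  obtain ⟨D, hD⟩ := hm.lip l h1 h2
  exact hD.continuous.measurable

theorem Regular.measurable_fwdDev (hm : m.Regular) (M l : ℕ) (hl : l ≤ m.H)
    (s t : Fin (m.samples M)) : Measurable (m.fwdDev M l s t) :=
  ((measurable_actDot s t l fun k h1 h2 => hm.measurable_φ k h1 (h2.trans hl)).div_const _).sub_const
    _

theorem lintegral_P_input {M : ℕ} {f : (Fin (m.samples M) → Fin (m.width M 0) → ℝ) → ENNReal}
    (hf : Measurable f) :
    ∫⁻ ω, f ω.2 ∂(m.P M) = ∫⁻ X, f X ∂(inputLaw (m.width M) (m.samples M)) := by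
  unfold P
  refine (lintegral_law _ _ (hf.comp measurable_snd)).trans ?_
  simp

theorem fwdDev_resample (M l : ℕ) (s t : Fin (m.samples M))
    (ω : m.Sample M) (θ' : Param (m.width M) m.H → ℝ) :
    m.fwdDev M (l + 1) s t (resample (layerSet (m.width M) m.H l) ω.1 θ', ω.2)
      = (∑ i, m.φ (l + 1) (linPre θ' l (act m.φ ω.1 (ω.2 s) l) i)
          * m.φ (l + 1) (linPre θ' l (act m.φ ω.1 (ω.2 t) l) i)) / m.width M (l + 1)
        - if s = t then m.fwdT (l + 1) else m.fwdST (l + 1) := by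
  have h : ∀ (x : Fin (m.width M 0) → ℝ) i,
      act m.φ (resample (layerSet (m.width M) m.H l) ω.1 θ') x (l + 1) i
        = m.φ (l + 1) (linPre θ' l (act m.φ ω.1 x l) i) := fun x i => by
    rw [← preact_resample]; rfl
  simp only [fwdDev, actDot, h]

/-- One step of the forward induction, conditionally on the previous layers. -/
theorem Regular.exists_forward_step (hm : m.Regular) {l : ℕ} (hl : l + 1 ≤ m.H) :
    ∃ K : ℝ, 0 ≤ K ∧ ∀ M, 0 < m.width M (l + 1) → ∀ (s t : Fin (m.samples M)) (ω : m.Sample M),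
      ∫⁻ θ', ENNReal.ofReal (m.fwdDev M (l + 1) s t
          (resample (layerSet (m.width M) m.H l) ω.1 θ', ω.2) ^ 4)
          ∂(paramLaw (m.width M) m.H m.σw m.σb)
        ≤ ENNReal.ofReal (K * (m.fwdDev M l s s ω ^ 4 + m.fwdDev M l s t ω ^ 4
            + m.fwdDev M l t t ω ^ 4 + 1 / (m.width M (l + 1) : ℝ) ^ 2)) := by
  obtain ⟨D, hD⟩ := hm.lip (l + 1) (by omega) hl
  have hl' : l ≤ m.H := by omega
  obtain ⟨L₁, hL₁, hst1⟩ := hD.exists_gauss1_stability (hm.preT_pos hl')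
  obtain ⟨L₂, hL₂, hst2⟩ := hD.exists_gauss2_stability (hm.preST_lt hl')
  set L := L₁ + L₂
  set K₁ := 384 * (128 * D ^ 8 * ∫ z, wt z ^ 8 ∂gaussPlane) * (17 + 16 * m.preT l ^ 4) + 8 * L ^ 4
  have hD0 : 0 ≤ D := zero_le_one.trans hD.one_le
  have hW : 0 ≤ ∫ z, wt z ^ 8 ∂gaussPlane := integral_nonneg fun z => by positivity
  have hK₁ : 0 ≤ K₁ := by
    have := hm.preT_pos hl'
    positivity
  refine ⟨K₁ * (27 * m.σw ^ 8 + 1), by positivity, fun M hM s t ω => ?_⟩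
  simp only [fwdDev_resample]
  set x := m.fwdDev M l s s ω with hx
  set y := m.fwdDev M l s t ω with hy
  set z := m.fwdDev M l t t ω with hz
  -- Total deviation of the three empirical covariance entries of the pre-activations, linear in the
  -- deviations one layer below.
  set d := m.σw ^ 2 * (|x| + |y| + |z|) with hd
  have hd0 : 0 ≤ d := by positivity
  have hpair := fun i => gaussPair_linPre (n := m.width M) (H := m.H) m.σw m.σb hl'
    (act m.φ ω.1 (ω.2 s) l) (act m.φ ω.1 (ω.2 t) l) i
  have hind := iIndepFun_linPre (n := m.width M) (H := m.H) m.σw m.σb hl'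
    (act m.φ ω.1 (ω.2 s) l) (act m.φ ω.1 (ω.2 t) l)
  have hAx : m.σw ^ 2 * ((∑ j, act m.φ ω.1 (ω.2 s) l j * act m.φ ω.1 (ω.2 s) l j) / m.width M l)
      + m.σb ^ 2 - m.preT l = m.σw ^ 2 * x := by
    simp only [hx, fwdDev, actDot, preT, if_true]; ring
  have hCz : m.σw ^ 2 * ((∑ j, act m.φ ω.1 (ω.2 t) l j * act m.φ ω.1 (ω.2 t) l j) / m.width M l)
      + m.σb ^ 2 - m.preT l = m.σw ^ 2 * z := by
    simp only [hz, fwdDev, actDot, preT, if_true]; ring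
  have hσ : 0 ≤ m.σw ^ 2 := sq_nonneg _
  have hq : ∀ i, |∫ θ', m.φ (l + 1) (linPre θ' l (act m.φ ω.1 (ω.2 s) l) i)
          * m.φ (l + 1) (linPre θ' l (act m.φ ω.1 (ω.2 t) l) i)
          ∂(paramLaw (m.width M) m.H m.σw m.σb)
        - if s = t then m.fwdT (l + 1) else m.fwdST (l + 1)| ≤ L * d := by
    intro i
    -- For equal samples the pair is degenerate, and the one-dimensional stability estimate replaces
    -- the two-dimensional one.
    by_cases hst : s = t
    · rw [if_pos hst]
      subst hst
      refine (hst1 (hpair i).measX (hpair i).nonnegA (hpair i).lawX).trans ?_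
      rw [hAx, abs_mul, abs_of_nonneg hσ, hd]
      have : m.σw ^ 2 * |x| ≤ m.σw ^ 2 * (|x| + |y| + |z|) :=
        mul_le_mul_of_nonneg_left (by linarith [abs_nonneg y, abs_nonneg z]) hσ
      exact mul_le_mul (by linarith) this (by positivity) (by positivity)
    · rw [if_neg hst]
      have hBy : m.σw ^ 2 * ((∑ j, act m.φ ω.1 (ω.2 s) l j * act m.φ ω.1 (ω.2 t) l j)
          / m.width M l) + m.σb ^ 2 - m.preST l = m.σw ^ 2 * y := by
        simp only [hy, fwdDev, actDot, preST, if_neg hst]; ring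
      refine (hst2 (hpair i)).trans ?_
      rw [hAx, hBy, hCz, abs_mul, abs_mul, abs_mul, abs_of_nonneg hσ, ← mul_add, ← mul_add]
      exact mul_le_mul_of_nonneg_right (by linarith) hd0
  have hAle : m.σw ^ 2 * ((∑ j, act m.φ ω.1 (ω.2 s) l j * act m.φ ω.1 (ω.2 s) l j)
      / m.width M l) + m.σb ^ 2 ≤ m.preT l + d := by
    have : m.σw ^ 2 * x ≤ d := mul_le_mul_of_nonneg_left
      (by linarith [le_abs_self x, abs_nonneg y, abs_nonneg z]) hσ
    linarith
  have hCle : m.σw ^ 2 * ((∑ j, act m.φ ω.1 (ω.2 t) l j * act m.φ ω.1 (ω.2 t) l j)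
      / m.width M l) + m.σb ^ 2 ≤ m.preT l + d := by
    have : m.σw ^ 2 * z ≤ d := mul_le_mul_of_nonneg_left
      (by linarith [le_abs_self z, abs_nonneg y, abs_nonneg x]) hσ
    linarith
  obtain ⟨hint, hle⟩ := hD.pair_concentration hM hpair hind (hm.preT_pos hl').le hd0 hAle hCle hq
  rw [← ofReal_integral_eq_lintegral_ofReal hint (ae_of_all _ fun _ => by positivity)]
  refine ENNReal.ofReal_le_ofReal (hle.trans ?_)
  rw [mul_assoc K₁]
  refine mul_le_mul_of_nonneg_left ?_ hK₁
  have hd4 : d ^ 4 ≤ 27 * m.σw ^ 8 * (x ^ 4 + y ^ 4 + z ^ 4) := by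
    have h27 := add_add_pow_four_le |x| |y| |z|
    rw [Even.pow_abs (by decide), Even.pow_abs (by decide), Even.pow_abs (by decide)] at h27
    calc d ^ 4 = m.σw ^ 8 * (|x| + |y| + |z|) ^ 4 := by rw [hd]; ring
      _ ≤ m.σw ^ 8 * (27 * (x ^ 4 + y ^ 4 + z ^ 4)) :=
        mul_le_mul_of_nonneg_left h27 (by positivity)
      _ = _ := by ring
  have hr : 0 ≤ 1 / (m.width M (l + 1) : ℝ) ^ 2 := by positivity
  have h4 : 0 ≤ x ^ 4 + y ^ 4 + z ^ 4 := by positivity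
  have h5 : 0 ≤ 27 * m.σw ^ 8 := by positivity
  nlinarith [mul_nonneg h5 hr]

/-- The forward order parameters converge at rate `M ^ (-1/2)` in `L⁴`. -/
theorem Regular.exists_forward_rate (hm : m.Regular) (l : ℕ) (hl : l ≤ m.H) :
    ∃ K : ℝ, 0 ≤ K ∧ ∀ᶠ M : ℕ in atTop, ∀ s t : Fin (m.samples M),
      ∫⁻ ω, ENNReal.ofReal (m.fwdDev M l s t ω ^ 4) ∂(m.P M)
        ≤ ENNReal.ofReal (K / (M : ℝ) ^ 2) := by
  have hwid : ∀ {l M : ℕ}, l ≤ m.H → 0 < M → m.a l * M / 2 ≤ m.width M l →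
      1 / (m.width M l : ℝ) ^ 2 ≤ 4 / m.a l ^ 2 / (M : ℝ) ^ 2 := by
    intro l M hl hM hw
    have ha := hm.a_pos l hl
    have hM' : (0 : ℝ) < M := by exact_mod_cast hM
    have h1 : 0 < m.a l * M / 2 := by positivity
    calc 1 / (m.width M l : ℝ) ^ 2 ≤ 1 / (m.a l * M / 2) ^ 2 :=
          one_div_le_one_div_of_le (by positivity) (pow_le_pow_left₀ h1.le hw 2)
      _ = _ := by field_simp; norm_num
  induction l with
  | zero =>
    set m₈ := ∫ u, u ^ 8 ∂(gaussianReal 0 1)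
    have hm8 : 0 ≤ m₈ := integral_nonneg fun u => by positivity
    have ha := hm.a_pos 0 hl
    refine ⟨384 * m₈ * (4 / m.a 0 ^ 2), by positivity, ?_⟩
    filter_upwards [hm.eventually_width, eventually_gt_atTop 0] with M hM hM0 s t
    obtain ⟨hint, hle⟩ := input_fourth_moment (hM 0 hl).1 s t
    have hf : ∀ ω : m.Sample M, m.fwdDev M 0 s t ω
        = (∑ j, ω.2 s j * ω.2 t j) / m.width M 0 - if s = t then 1 else 0 := fun ω => rfl
    simp only [hf]
    rw [lintegral_P_input (f := fun X => ENNReal.ofReal (((∑ j, X s j * X t j) / m.width M 0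
      - if s = t then 1 else 0) ^ 4)) (by fun_prop),
      ← ofReal_integral_eq_lintegral_ofReal hint (ae_of_all _ fun _ => by positivity)]
    refine ENNReal.ofReal_le_ofReal (hle.trans ?_)
    have := mul_le_mul_of_nonneg_left (hwid hl hM0 (hM 0 hl).2) (by positivity : 0 ≤ 384 * m₈)
    calc _ = 384 * m₈ * (1 / (m.width M 0 : ℝ) ^ 2) := by ring
      _ ≤ _ := this
      _ = _ := by ring
  | succ l ih =>
    obtain ⟨K, hK, hrate⟩ := ih (by omega)
    obtain ⟨K', hK', hstep⟩ := hm.exists_forward_step hl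
    have ha := hm.a_pos (l + 1) hl
    refine ⟨K' * (3 * K + 4 / m.a (l + 1) ^ 2), by positivity, ?_⟩
    filter_upwards [hm.eventually_width, eventually_gt_atTop 0, hrate] with M hM hM0 hrM s t
    have hmeas := fun s t => (hm.measurable_fwdDev M l (by omega) s t)
    have hmo := fun s t => ((hmeas s t).pow_const 4).ennreal_ofReal
    have hsplit : ∀ ω : m.Sample M, ENNReal.ofReal (K' * (m.fwdDev M l s s ω ^ 4
          + m.fwdDev M l s t ω ^ 4 + m.fwdDev M l t t ω ^ 4 + 1 / (m.width M (l + 1) : ℝ) ^ 2))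
        = ENNReal.ofReal K' * (ENNReal.ofReal (m.fwdDev M l s s ω ^ 4)
          + ENNReal.ofReal (m.fwdDev M l s t ω ^ 4) + ENNReal.ofReal (m.fwdDev M l t t ω ^ 4)
          + ENNReal.ofReal (1 / (m.width M (l + 1) : ℝ) ^ 2)) := by
      intro ω
      rw [ENNReal.ofReal_mul hK', ENNReal.ofReal_add (by positivity) (by positivity),
        ENNReal.ofReal_add (by positivity) (by positivity),
        ENNReal.ofReal_add (by positivity) (by positivity)]
    -- Parameter layer `l` feeds the units of layer `l + 1`; resampling it leaves the deviations at
    -- layer `l` untouched, so the one-step estimate can be integrated.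
    have h1 := lintegral_law_resample (n := m.width M) (H := m.H) (T := m.samples M) m.σw m.σb
      (layerSet (m.width M) m.H l) ((hm.measurable_fwdDev M (l + 1) hl s t).pow_const 4).ennreal_ofReal
    calc _ = _ := h1
      _ ≤ _ := lintegral_mono fun ω => hstep M (hM (l + 1) hl).1 s t ω
      _ = ENNReal.ofReal K' * (∫⁻ ω, ENNReal.ofReal (m.fwdDev M l s s ω ^ 4) ∂(m.P M)
          + ∫⁻ ω, ENNReal.ofReal (m.fwdDev M l s t ω ^ 4) ∂(m.P M)
          + ∫⁻ ω, ENNReal.ofReal (m.fwdDev M l t t ω ^ 4) ∂(m.P M)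
          + ENNReal.ofReal (1 / (m.width M (l + 1) : ℝ) ^ 2)) := by
        simp only [hsplit]
        change ∫⁻ ω, _ ∂(m.P M) = _
        rw [lintegral_const_mul _ (by fun_prop), lintegral_add_right _ measurable_const,
          lintegral_add_right _ (hmo t t), lintegral_add_right _ (hmo s t)]
        simp
      _ ≤ ENNReal.ofReal K' * (ENNReal.ofReal (K / (M : ℝ) ^ 2) + ENNReal.ofReal (K / (M : ℝ) ^ 2)
          + ENNReal.ofReal (K / (M : ℝ) ^ 2)
          + ENNReal.ofReal (4 / m.a (l + 1) ^ 2 / (M : ℝ) ^ 2)) := by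
        refine mul_le_mul_right (add_le_add (add_le_add (add_le_add (hrM s s) (hrM s t)) (hrM t t))
          (ENNReal.ofReal_le_ofReal (hwid hl hM0 (hM (l + 1) hl).2))) _
      _ = _ := by
        rw [← ENNReal.ofReal_add (by positivity) (by positivity),
          ← ENNReal.ofReal_add (by positivity) (by positivity),
          ← ENNReal.ofReal_add (by positivity) (by positivity), ← ENNReal.ofReal_mul hK']
        congr 1
        ring

end Model

/-! ### Bilinear forms in independent Gaussian vectors -/

section Bilinear

variable {N : ℕ} (v : NNReal)

/-- Product of `N` centered Gaussian measures of variance `v`. -/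
abbrev gaussVec (N : ℕ) (v : NNReal) : Measure (Fin N → ℝ) :=
  Measure.pi fun _ => gaussianReal 0 v

theorem lintegral_lin_sq (c : Fin N → ℝ) :
    ∫⁻ w, ENNReal.ofReal ((∑ j, w j * c j) ^ 2) ∂(gaussVec N v)
      = ENNReal.ofReal (v * ∑ j, c j ^ 2) := by
  have hlaw := map_sum_gaussian (P := gaussVec N v) (X := fun j w => w j) (fun _ => v)
    (fun j => measurable_pi_apply j)
    (iIndepFun_pi (X := fun _ x => x) fun _ => aemeasurable_id)
    (fun j => (measurePreserving_eval _ j).map_eq) c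
  have h1 := lintegral_map (μ := gaussVec N v) (f := fun x : ℝ => ENNReal.ofReal (x ^ 2))
    (g := fun w => ∑ j, c j * w j) (by fun_prop) (by fun_prop)
  have h2 : ∀ w : Fin N → ℝ, ∑ j, w j * c j = ∑ j, c j * w j := fun w =>
    Finset.sum_congr rfl fun j _ => mul_comm _ _
  simp only [h2]
  rw [← h1, hlaw]
  have h0 : 0 ≤ ∑ j, c j ^ 2 * (v : ℝ) :=
    Finset.sum_nonneg fun j _ => mul_nonneg (sq_nonneg _) v.coe_nonneg
  have hv := variance_fun_id_gaussianReal (μ := 0) (v := (∑ j, c j ^ 2 * (v : ℝ)).toNNReal)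
  rw [variance_eq_integral (by fun_prop)] at hv
  simp only [integral_id_gaussianReal, sub_zero, Real.coe_toNNReal _ h0] at hv
  have hid : MemLp (fun x : ℝ => x) ((2 : ℕ) : ENNReal)
      (gaussianReal 0 (∑ j, c j ^ 2 * (v : ℝ)).toNNReal) := by
    have := memLp_id_gaussianReal (μ := 0) (v := (∑ j, c j ^ 2 * (v : ℝ)).toNNReal) 2
    exact_mod_cast this
  have hi : Integrable (fun x : ℝ => x ^ 2)
      (gaussianReal 0 (∑ j, c j ^ 2 * (v : ℝ)).toNNReal) :=
    MemLp.integrable_pow_of_le (k := 2) hid le_rfl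
  rw [← ofReal_integral_eq_lintegral_ofReal hi (ae_of_all _ fun x => sq_nonneg x), hv,
    ← Finset.sum_mul, mul_comm]

theorem lintegral_bilin_sq (B : Fin N → Fin N → ℝ) :
    ∫⁻ p : (Fin N → ℝ) × (Fin N → ℝ), ENNReal.ofReal ((∑ j, ∑ j', p.1 j * p.2 j' * B j j') ^ 2)
        ∂((gaussVec N v).prod (gaussVec N v))
      = ENNReal.ofReal ((v : ℝ) ^ 2 * ∑ j, ∑ j', B j j' ^ 2) := by
  rw [lintegral_prod _ (by fun_prop)]
  have h1 : ∀ w w' : Fin N → ℝ, ∑ j, ∑ j', w j * w' j' * B j j'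
      = ∑ j', w' j' * ∑ j, w j * B j j' := by
    intro w w'
    rw [Finset.sum_comm]
    refine Finset.sum_congr rfl fun j' _ => ?_
    rw [Finset.mul_sum]
    exact Finset.sum_congr rfl fun j _ => by ring
  simp only [h1, lintegral_lin_sq]
  have h2 : ∀ w : Fin N → ℝ, ENNReal.ofReal (v * ∑ j', (∑ j, w j * B j j') ^ 2)
      = ENNReal.ofReal v * ∑ j', ENNReal.ofReal ((∑ j, w j * B j j') ^ 2) := by
    intro w
    rw [ENNReal.ofReal_mul v.coe_nonneg, ENNReal.ofReal_sum_of_nonneg fun _ _ => sq_nonneg _]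
  simp only [h2]
  rw [lintegral_const_mul _ (by fun_prop), lintegral_finsetSum _ (by fun_prop)]
  simp only [lintegral_lin_sq]
  rw [← ENNReal.ofReal_sum_of_nonneg fun _ _ =>
      mul_nonneg v.coe_nonneg (Finset.sum_nonneg fun _ _ => sq_nonneg _),
    ← ENNReal.ofReal_mul v.coe_nonneg, ← Finset.mul_sum, Finset.sum_comm]
  congr 1
  ring

/-- Rotation by 45 degrees of each pair of coordinates preserves the Gaussian law; the two signs are
used for polarization. -/
theorem map_rotation (ε : ℝ) (hε : ε ^ 2 = 1) :
    ((gaussVec N v).prod (gaussVec N v)).map (fun p j => (p.1 j + ε * p.2 j) / √2)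
      = gaussVec N v := by
  have h1 : ((gaussianReal 0 v).prod (gaussianReal 0 v)).map (fun p => (p.1 + ε * p.2) / √2)
      = gaussianReal 0 v := by
    have hi : IndepFun (fun p : ℝ × ℝ => (1 / √2) * p.1) (fun p : ℝ × ℝ => (ε / √2) * p.2)
        ((gaussianReal 0 v).prod (gaussianReal 0 v)) :=
      indepFun_prod (by fun_prop) (by fun_prop)
    have hX : ((gaussianReal 0 v).prod (gaussianReal 0 v)).map (fun p => (1 / √2) * p.1)
        = gaussianReal 0 (NNReal.mk ((1 / √2) ^ 2) (sq_nonneg _) * v) := by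
      have := Measure.map_map (μ := (gaussianReal 0 v).prod (gaussianReal 0 v))
        (measurable_const_mul (1 / √2)) measurable_fst
      rw [Measure.map_fst_prod] at this
      simp only [measure_univ, one_smul, gaussianReal_map_const_mul, mul_zero] at this
      exact this.symm
    have hY : ((gaussianReal 0 v).prod (gaussianReal 0 v)).map (fun p => (ε / √2) * p.2)
        = gaussianReal 0 (NNReal.mk ((ε / √2) ^ 2) (sq_nonneg _) * v) := by
      have := Measure.map_map (μ := (gaussianReal 0 v).prod (gaussianReal 0 v))
        (measurable_const_mul (ε / √2)) measurable_snd
      rw [Measure.map_snd_prod] at this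
      simp only [measure_univ, one_smul, gaussianReal_map_const_mul, mul_zero] at this
      exact this.symm
    have := gaussianReal_add_gaussianReal_of_indepFun hi hX hY
    convert this using 2
    · ext p; simp only [Pi.add_apply]; ring
    · simp
    · apply NNReal.eq
      simp only [NNReal.coe_add, NNReal.coe_mul, NNReal.coe_mk, div_pow, hε,
        Real.sq_sqrt (by norm_num : (0 : ℝ) ≤ 2)]
      ring
  have h2 := (measurePreserving_arrowProdEquivProdArrow ℝ ℝ (Fin N)
    (fun _ => gaussianReal 0 v) (fun _ => gaussianReal 0 v)).map_eq
  rw [← h2, Measure.map_map (by fun_prop) (by fun_prop)]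
  have h3 := Measure.pi_map_pi (μ := fun _ : Fin N => (gaussianReal 0 v).prod (gaussianReal 0 v))
    (f := fun _ p => (p.1 + ε * p.2) / √2) fun _ => by fun_prop
  simp only [h1] at h3
  exact h3

/-- An off-diagonal bilinear form in two independent Gaussian vectors fluctuates no more than the
corresponding quadratic form. -/
theorem lintegral_bilin_le_quad {ι : Type*} [Fintype ι] (R : Fin N → ι → ℝ) (c : ℝ) :
    ∫⁻ p : (Fin N → ℝ) × (Fin N → ℝ),
        ENNReal.ofReal ((∑ i, (∑ j, p.1 j * R j i) * ∑ j, p.2 j * R j i) ^ 2)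
        ∂((gaussVec N v).prod (gaussVec N v))
      ≤ ∫⁻ w, ENNReal.ofReal ((∑ i, (∑ j, w j * R j i) * (∑ j, w j * R j i) - c) ^ 2)
        ∂(gaussVec N v) := by
  set Q : (Fin N → ℝ) → ℝ := fun w => ∑ i, (∑ j, w j * R j i) * (∑ j, w j * R j i) - c with hQ
  have hQm : Measurable fun w => ENNReal.ofReal (Q w ^ 2) := by fun_prop
  let rot : ℝ → (Fin N → ℝ) × (Fin N → ℝ) → Fin N → ℝ := fun ε p j => (p.1 j + ε * p.2 j) / √2
  have hrm : ∀ ε, Measurable (rot ε) := fun ε => by fun_prop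
  have hrot : ∀ ε : ℝ, ε ^ 2 = 1 →
      ∫⁻ p, ENNReal.ofReal (Q (rot ε p) ^ 2) ∂((gaussVec N v).prod (gaussVec N v))
        = ∫⁻ w, ENNReal.ofReal (Q w ^ 2) ∂(gaussVec N v) := by
    intro ε hε
    rw [← lintegral_map hQm (hrm ε)]
    congr 1
    exact map_rotation v ε hε
  have hlin : ∀ (ε : ℝ) (p : (Fin N → ℝ) × (Fin N → ℝ)) (i : ι),
      ∑ j, rot ε p j * R j i = ((∑ j, p.1 j * R j i) + ε * ∑ j, p.2 j * R j i) / √2 := by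
    intro ε p i
    rw [Finset.mul_sum, ← Finset.sum_add_distrib, Finset.sum_div]
    exact Finset.sum_congr rfl fun j _ => by simp only [rot]; ring
  -- Polarization at the rotated vectors; the constant `c` cancels in the difference, so it may be
  -- arbitrary.
  have hpol : ∀ p : (Fin N → ℝ) × (Fin N → ℝ),
      ∑ i, (∑ j, p.1 j * R j i) * ∑ j, p.2 j * R j i = (Q (rot 1 p) - Q (rot (-1) p)) / 2 := by
    intro p
    simp only [hQ, hlin]
    rw [sub_sub_sub_cancel_right, ← Finset.sum_sub_distrib, Finset.sum_div]
    refine Finset.sum_congr rfl fun i _ => ?_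
    have h2 : √2 * √2 = (2 : ℝ) := Real.mul_self_sqrt (by norm_num)
    rw [div_mul_div_comm, div_mul_div_comm, h2]
    ring
  have hle : ∀ p : (Fin N → ℝ) × (Fin N → ℝ),
      ENNReal.ofReal ((∑ i, (∑ j, p.1 j * R j i) * ∑ j, p.2 j * R j i) ^ 2)
        ≤ ENNReal.ofReal (1 / 2) * ENNReal.ofReal (Q (rot 1 p) ^ 2)
          + ENNReal.ofReal (1 / 2) * ENNReal.ofReal (Q (rot (-1) p) ^ 2) := by
    intro p
    rw [hpol, ← ENNReal.ofReal_mul (by norm_num), ← ENNReal.ofReal_mul (by norm_num),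
      ← ENNReal.ofReal_add (by positivity) (by positivity)]
    refine ENNReal.ofReal_le_ofReal ?_
    nlinarith [sq_nonneg (Q (rot 1 p) + Q (rot (-1) p))]
  refine (lintegral_mono hle).trans (le_of_eq ?_)
  have hm1 : Measurable fun p => ENNReal.ofReal (1 / 2) * ENNReal.ofReal (Q (rot 1 p) ^ 2) :=
    (hQm.comp (hrm 1)).const_mul _
  rw [lintegral_add_left hm1, lintegral_const_mul' _ _ ENNReal.ofReal_ne_top,
    lintegral_const_mul' _ _ ENNReal.ofReal_ne_top, hrot 1 (by norm_num), hrot (-1) (by norm_num),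
    ← add_mul, ← ENNReal.ofReal_add (by norm_num) (by norm_num)]
  norm_num
  rfl

/-- The identity ‖R R'ᵀ‖² = ⟨RᵀR, R'ᵀR'⟩. In this form the mixed term is an inner product of two
objects depending on one input each, so it is at most the mean of their squared norms. -/
theorem sum_sq_gram {ι : Type*} [Fintype ι] (R R' : Fin N → ι → ℝ) :
    ∑ j, ∑ j', (∑ i, R j i * R' j' i) ^ 2
      = ∑ i, ∑ i', (∑ j, R j i * R j i') * ∑ j', R' j' i * R' j' i' := by
  calc ∑ j, ∑ j', (∑ i, R j i * R' j' i) ^ 2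
      = ∑ j, ∑ j', ∑ i, ∑ i', R j i * R j i' * (R' j' i * R' j' i') := by
        refine Finset.sum_congr rfl fun j _ => Finset.sum_congr rfl fun j' _ => ?_
        rw [sq, Finset.sum_mul_sum]
        exact Finset.sum_congr rfl fun i _ => Finset.sum_congr rfl fun i' _ => by ring
    _ = ∑ j, ∑ i, ∑ i', ∑ j', R j i * R j i' * (R' j' i * R' j' i') := by
        refine Finset.sum_congr rfl fun j _ => ?_
        rw [Finset.sum_comm]
        exact Finset.sum_congr rfl fun i _ => Finset.sum_comm
    _ = ∑ i, ∑ i', ∑ j, ∑ j', R j i * R j i' * (R' j' i * R' j' i') := by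
        rw [Finset.sum_comm]
        exact Finset.sum_congr rfl fun i _ => Finset.sum_comm
    _ = _ := by
        refine Finset.sum_congr rfl fun i _ => Finset.sum_congr rfl fun i' _ => ?_
        rw [Finset.sum_mul_sum]

theorem sum_sq_gram_le {ι : Type*} [Fintype ι] (R R' : Fin N → ι → ℝ) :
    ∑ j, ∑ j', (∑ i, R j i * R' j' i) ^ 2
      ≤ (∑ j, ∑ j', (∑ i, R j i * R j' i) ^ 2 + ∑ j, ∑ j', (∑ i, R' j i * R' j' i) ^ 2) / 2 := by
  rw [sum_sq_gram, sum_sq_gram, sum_sq_gram, ← Finset.sum_add_distrib, Finset.sum_div]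
  refine Finset.sum_le_sum fun i _ => ?_
  rw [← Finset.sum_add_distrib, Finset.sum_div]
  refine Finset.sum_le_sum fun i' _ => ?_
  nlinarith [sq_nonneg ((∑ j, R j i * R j i') - ∑ j', R' j' i * R' j' i')]

theorem sum_mul_sum_eq_bilin {ι : Type*} [Fintype ι] (R R' : Fin N → ι → ℝ) (w w' : Fin N → ℝ) :
    ∑ i, (∑ j, w j * R j i) * ∑ j, w' j * R' j i
      = ∑ j, ∑ j', w j * w' j' * ∑ i, R j i * R' j' i := by
  have h : ∀ i, (∑ j, w j * R j i) * ∑ j, w' j * R' j i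
      = ∑ j, ∑ j', w j * R j i * (w' j' * R' j' i) := fun i => Finset.sum_mul_sum ..
  simp only [h]
  rw [Finset.sum_comm]
  refine Finset.sum_congr rfl fun j _ => ?_
  rw [Finset.sum_comm]
  refine Finset.sum_congr rfl fun j' _ => ?_
  rw [Finset.mul_sum]
  exact Finset.sum_congr rfl fun i _ => by ring

/-- The second moment of a bilinear form is v² times a squared Frobenius norm. `sum_sq_gram_le`
reduces two different inputs to equal ones, and polarization compares equal inputs with the
fluctuation of the quadratic form. -/
theorem lintegral_cross_le {ι : Type*} [Fintype ι] (R R' : Fin N → ι → ℝ) (c : ℝ) :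
    ∫⁻ p : (Fin N → ℝ) × (Fin N → ℝ),
        ENNReal.ofReal ((∑ i, (∑ j, p.1 j * R j i) * ∑ j, p.2 j * R' j i) ^ 2)
        ∂((gaussVec N v).prod (gaussVec N v))
      ≤ ENNReal.ofReal (1 / 2) *
          (∫⁻ w, ENNReal.ofReal ((∑ i, (∑ j, w j * R j i) * (∑ j, w j * R j i) - c) ^ 2)
            ∂(gaussVec N v)
          + ∫⁻ w, ENNReal.ofReal ((∑ i, (∑ j, w j * R' j i) * (∑ j, w j * R' j i) - c) ^ 2)
            ∂(gaussVec N v)) := by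
  have h1 := lintegral_bilin_le_quad v R c
  have h2 := lintegral_bilin_le_quad v R' c
  refine le_trans ?_ (mul_le_mul_right (add_le_add h1 h2) _)
  simp only [sum_mul_sum_eq_bilin, lintegral_bilin_sq]
  have hn : ∀ R R' : Fin N → ι → ℝ, 0 ≤ (v : ℝ) ^ 2 * ∑ j, ∑ j', (∑ i, R j i * R' j' i) ^ 2 :=
    fun R R' => mul_nonneg (sq_nonneg _)
      (Finset.sum_nonneg fun _ _ => Finset.sum_nonneg fun _ _ => sq_nonneg _)
  rw [← ENNReal.ofReal_add (hn _ _) (hn _ _), ← ENNReal.ofReal_mul (by norm_num)]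
  refine ENNReal.ofReal_le_ofReal ?_
  have := mul_le_mul_of_nonneg_left (sum_sq_gram_le R R') (sq_nonneg (v : ℝ))
  linarith

end Bilinear

/-! ### Backward overlaps of two different readout units -/

section Factor

variable {n : ℕ → ℕ} {H : ℕ}

/-- The second factor is the chain rule started at the units of the last hidden layer instead of the
readout; it contains no readout weight. -/
theorem back_eq_sum (φ : ℕ → ℝ → ℝ) (θ : Param n (H + 1) → ℝ) (x : Fin (n 0) → ℝ)
    (k : Fin (n (H + 1 + 1))) (l : ℕ) (hl : l ≤ H) (i : Fin (n (l + 1))) :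
    back φ θ x k l i = ∑ j : Fin (n (H + 1)), weight θ (H + 1) k j *
      (deriv (φ (H + 1)) (preact φ θ x H j) * backAux φ θ x j (H - l) l i) := by
  obtain ⟨d, hd⟩ : ∃ d, l + d = H := ⟨H - l, by omega⟩
  induction d generalizing l with
  | zero =>
    obtain rfl : l = H := by omega
    rw [back_of_lt φ θ x k (Nat.lt_succ_self l), Nat.sub_self]
    simp only [back_top, backAux, ite_mul, one_mul, zero_mul, Finset.sum_ite_eq',
      Finset.mem_univ, if_true, mul_ite, mul_one, mul_zero, Fin.val_inj, Finset.sum_ite_eq]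
    ring
  | succ d ih =>
    have hl' : l + 1 ≤ H := by omega
    rw [back_of_lt φ θ x k (by omega : l < H + 1)]
    have e : H - l = (H - (l + 1)) + 1 := by omega
    simp only [ih (l + 1) hl' _ (by omega), e, backAux, Finset.sum_mul, Finset.mul_sum]
    rw [Finset.sum_comm]
    exact Finset.sum_congr rfl fun j _ => Finset.sum_congr rfl fun i' _ => by ring

theorem backAux_resample (φ : ℕ → ℝ → ℝ) (θ θ' : Param n H → ℝ) (x : Fin (n 0) → ℝ) (k d l r : ℕ)
    (h : l + d < r) :
    backAux φ (resample (layerSet n H r) θ θ') x k d l = backAux φ θ x k d l := by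
  induction d generalizing l with
  | zero => rfl
  | succ d ih =>
    ext i
    have hne : l + 1 ≠ r := by omega
    simp only [backAux, ih (l + 1) (by omega), weight_resample, if_neg hne,
      preact_resample_of_lt φ θ θ' x r l (by omega)]

/-- Below the readout layer, backward signals are linear in the readout weights, with coefficients
that do not depend on the parameters of the readout layer. -/
theorem exists_back_factor (φ : ℕ → ℝ → ℝ) {l : ℕ} (hl : l < H) :
    ∃ R : (Param n H → ℝ) → (Fin (n 0) → ℝ) → Fin (n H) → Fin (n (l + 1)) → ℝ,
      (∀ θ θ' x, R (resample (layerSet n H H) θ θ') x = R θ x) ∧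
      ∀ θ x k i, back φ θ x k l i = ∑ j, weight θ H k j * R θ x j i := by
  obtain ⟨H', rfl⟩ : ∃ H', H = H' + 1 := ⟨H - 1, by omega⟩
  refine ⟨fun θ x j i => deriv (φ (H' + 1)) (preact φ θ x H' j) * backAux φ θ x j (H' - l) l i,
    fun θ θ' x => ?_, fun θ x k i => back_eq_sum φ θ x k l (by omega) i⟩
  ext j i
  dsimp only
  rw [preact_resample_of_lt φ θ θ' x (H' + 1) H' (by omega),
    backAux_resample φ θ θ' x j (H' - l) l (H' + 1) (by omega)]

variable (σw σb : ℝ)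

theorem measurable_row (k : Fin (n (H + 1))) :
    Measurable fun (θ : Param n H → ℝ) j => weight θ H k j :=
  measurable_pi_lambda _ fun j => measurable_weight H k j

theorem iIndepFun_weight : iIndepFun (fun (p : Fin (n (H + 1)) × Fin (n H)) (θ : Param n H → ℝ) =>
    weight θ H p.1 p.2) (paramLaw n H σw σb) := by
  have := (iIndepFun_param (n := n) (H := H) σw σb).precomp
    (g := fun p : Fin (n (H + 1)) × Fin (n H) =>
      (Sum.inl ⟨⟨H, Nat.lt_succ_self H⟩, p⟩ : Param n H)) fun p p' h => by simpa using h
  convert this using 3 with p θ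
  simp [weight]

theorem map_row (k : Fin (n (H + 1))) :
    (paramLaw n H σw σb).map (fun θ j => weight θ H k j)
      = gaussVec (n H) (σw ^ 2 / n H).toNNReal := by
  have h1 := (iIndepFun_weight (n := n) (H := H) σw σb).precomp
    (g := fun j : Fin (n H) => (k, j)) fun j j' h => by simpa using h
  rw [h1.map_fun_eq_pi_map fun j => (measurable_weight H k j).aemeasurable]
  congr 1
  ext1 j
  have : (fun θ : Param n H → ℝ => weight θ H k j)
      = fun θ => θ (Sum.inl ⟨⟨H, Nat.lt_succ_self H⟩, k, j⟩) := by
    ext θ; simp [weight]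
  rw [this, map_param]
  rfl

theorem map_row_pair {k k' : Fin (n (H + 1))} (hk : k ≠ k') :
    (paramLaw n H σw σb).map (fun θ => (fun j => weight θ H k j, fun j => weight θ H k' j))
      = (gaussVec (n H) (σw ^ 2 / n H).toNNReal).prod (gaussVec (n H) (σw ^ 2 / n H).toNNReal) := by
  have h1 := (iIndepFun_rows (fun p => measurable_weight H p.1 p.2)
    (iIndepFun_weight (n := n) (H := H) σw σb)).indepFun hk
  have h2 := (indepFun_iff_map_prod_eq_prod_map_map (measurable_row k).aemeasurable
    (measurable_row k').aemeasurable).1 h1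
  rw [h2, map_row, map_row]

/-- Overlaps of the backward signals of two different readout units have second moments bounded by
the mean square errors of the diagonal overlaps. -/
theorem lintegral_crossOverlap_le {T : ℕ} {φ : ℕ → ℝ → ℝ}
    (hφ : ∀ m, 1 ≤ m → m ≤ H → Measurable (φ m)) {l : ℕ} (hl : l < H)
    {k k' : Fin (n (H + 1))} (hk : k ≠ k') (s t : Fin T) (c : ℝ) :
    ∫⁻ ω, ENNReal.ofReal (crossOverlap φ ω.1 (ω.2 s) (ω.2 t) k k' l ^ 2) ∂(law n H T σw σb)
      ≤ ENNReal.ofReal (1 / 2) *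
        (∫⁻ ω, ENNReal.ofReal ((crossOverlap φ ω.1 (ω.2 s) (ω.2 s) k k l - c) ^ 2)
            ∂(law n H T σw σb)
          + ∫⁻ ω, ENNReal.ofReal ((crossOverlap φ ω.1 (ω.2 t) (ω.2 t) k k l - c) ^ 2)
            ∂(law n H T σw σb)) := by
  obtain ⟨R, hR, hback⟩ := exists_back_factor (n := n) φ hl
  have hw : ∀ (θ θ' : Param n H → ℝ) k j,
      weight (resample (layerSet n H H) θ θ') H k j = weight θ' H k j := by
    intro θ θ' k j
    rw [weight_resample, if_pos rfl]
  have hcross : ∀ (ω : (Param n H → ℝ) × (Fin T → Fin (n 0) → ℝ)) θ' k k' s t,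
      crossOverlap φ (resample (layerSet n H H) ω.1 θ') (ω.2 s) (ω.2 t) k k' l
        = ∑ i, (∑ j, weight θ' H k j * R ω.1 (ω.2 s) j i)
          * ∑ j, weight θ' H k' j * R ω.1 (ω.2 t) j i := by
    intro ω θ' k k' s t
    simp only [crossOverlap, hback, hR, hw]
  have hm1 := ((measurable_crossOverlap (T := T) s t k k' l hl.le hφ).pow_const 2).ennreal_ofReal
  have hm2 := fun r => (((measurable_crossOverlap (T := T) r r k k l hl.le hφ).sub_const
    c).pow_const 2).ennreal_ofReal
  have hm3 := fun r => ((hm2 r).comp (measurable_resample_law (T := T) (layerSet n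
    H H))).lintegral_prod_right'
    (ν := paramLaw n H σw σb)
  rw [lintegral_law_resample σw σb (layerSet n H H) hm1,
    lintegral_law_resample σw σb (layerSet n H H) (hm2 s),
    lintegral_law_resample σw σb (layerSet n H H) (hm2 t)]
  have hsum := lintegral_add_left (μ := law n H T σw σb) (hm3 s) fun ω =>
    ∫⁻ θ', ENNReal.ofReal
      ((crossOverlap φ (resample (layerSet n H H) ω.1 θ') (ω.2 t) (ω.2 t) k k l - c) ^ 2)
      ∂(paramLaw n H σw σb)
  simp only [Function.comp_apply] at hsum
  rw [← hsum, ← lintegral_const_mul' _ _ ENNReal.ofReal_ne_top]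
  -- With all layers below the readout frozen, only the two independent readout rows are random.
  refine lintegral_mono fun ω => ?_
  simp only [hcross]
  have h1 := lintegral_cross_le (σw ^ 2 / n H).toNNReal (R ω.1 (ω.2 s)) (R ω.1 (ω.2 t)) c
  have hp := (measurable_row (n := n) (H := H) k).prodMk (measurable_row (n := n) (H := H) k')
  rw [← map_row_pair σw σb hk, ← map_row σw σb k,
    lintegral_map (by fun_prop) hp, lintegral_map (by fun_prop) (measurable_row k),
    lintegral_map (by fun_prop) (measurable_row k)] at h1
  exact h1

end Factor

/-! ### Almost sure validity of the chain rule -/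

section Differentiability

variable {n : ℕ → ℕ} {H T : ℕ} {σw σb : ℝ}

/-- Almost surely, the activation functions are differentiable at all pre-activations of a layer
above a layer of non-vanishing activity. -/
theorem ae_differentiableAt_preact {φ : ℕ → ℝ → ℝ} (hσw : 0 < σw)
    (hφ : ∀ m, 1 ≤ m → m ≤ H → ∃ D, LipGrowth D (φ m)) (t : Fin T) {l : ℕ} (hl : l < H)
    (i : Fin (n (l + 1))) :
    ∀ᵐ ω ∂(law n H T σw σb), 0 < actDot φ ω.1 (ω.2 t) (ω.2 t) l →
      DifferentiableAt ℝ (φ (l + 1)) (preact φ ω.1 (ω.2 t) l i) := by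
  obtain ⟨D, hD⟩ := hφ (l + 1) (by omega) hl
  have hφm : ∀ m, 1 ≤ m → m ≤ l → Measurable (φ m) := fun m h1 h2 => by
    obtain ⟨D, hD⟩ := hφ m h1 (by omega)
    exact hD.continuous.measurable
  have hD0 : 0 ≤ D := zero_le_one.trans hD.one_le
  have hlip : LipschitzWith ⟨D, hD0⟩ (φ (l + 1)) := LipschitzWith.of_dist_le_mul fun x y => by
    rw [Real.dist_eq, Real.dist_eq]
    exact hD.lip x y
  set N := {x | ¬ DifferentiableAt ℝ (φ (l + 1)) x} with hN
  have hNm : MeasurableSet N := (measurableSet_of_differentiableAt ℝ (φ (l + 1))).compl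
  -- Rademacher's theorem for the Lipschitz activation function.
  have hN0 : volume N = 0 := hlip.ae_differentiableAt (μ := volume)
  set B := {ω : (Param n H → ℝ) × (Fin T → Fin (n 0) → ℝ) |
    0 < actDot φ ω.1 (ω.2 t) (ω.2 t) l ∧ preact φ ω.1 (ω.2 t) l i ∈ N} with hB
  have hBm : MeasurableSet B :=
    (measurableSet_lt measurable_const (measurable_actDot t t l hφm)).inter
      (measurable_preact t l hφm i hNm)
  suffices h : law n H T σw σb B = 0 by
    refine (ae_iff.2 (measure_mono_null (fun ω hω => ?_) h))
    simpa [hB, hN] using hω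
  rw [← lintegral_indicator_one hBm,
    lintegral_law_resample σw σb (layerSet n H l) (measurable_one.indicator hBm)]
  refine (lintegral_congr fun ω => ?_).trans lintegral_zero
  have hact : ∀ θ', act φ (resample (layerSet n H l) ω.1 θ') (ω.2 t) l = act φ ω.1 (ω.2 t) l :=
    fun θ' => act_resample φ ω.1 θ' (ω.2 t) l l le_rfl
  -- Given a nonzero activity vector below, the pre-activation is Gaussian with positive variance,
  -- so it avoids the null set `N` almost surely.
  by_cases hpos : 0 < actDot φ ω.1 (ω.2 t) (ω.2 t) l
  · have hind : ∀ θ', (B.indicator 1 (resample (layerSet n H l) ω.1 θ', ω.2) : ENNReal)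
        = (N.indicator 1 (linPre θ' l (act φ ω.1 (ω.2 t) l) i) : ENNReal) := by
      intro θ'
      have : (resample (layerSet n H l) ω.1 θ', ω.2) ∈ B
          ↔ linPre θ' l (act φ ω.1 (ω.2 t) l) i ∈ N := by
        rw [hB, Set.mem_ofPred_eq, preact_resample]
        simp only [actDot, hact]
        exact and_iff_right hpos
      by_cases h : linPre θ' l (act φ ω.1 (ω.2 t) l) i ∈ N
      · rw [Set.indicator_of_mem (this.2 h), Set.indicator_of_mem h]; rfl
      · rw [Set.indicator_of_notMem (mt this.1 h), Set.indicator_of_notMem h]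
    simp only [hind]
    have hg := gaussPair_linPre (n := n) (H := H) σw σb hl.le (act φ ω.1 (ω.2 t) l)
      (act φ ω.1 (ω.2 t) l) i
    rw [← lintegral_map (measurable_one.indicator hNm) hg.measX, lintegral_indicator_one hNm,
      hg.lawX]
    have hn : 0 < n l := by
      by_contra hn0
      have : IsEmpty (Fin (n l)) := by
        rw [Nat.eq_zero_of_not_pos hn0]; infer_instance
      simp [actDot] at hpos
    have hA : 0 < σw ^ 2 * ((∑ j, act φ ω.1 (ω.2 t) l j * act φ ω.1 (ω.2 t) l j) / n l)
        + σb ^ 2 := by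
      have : 0 < (∑ j, act φ ω.1 (ω.2 t) l j * act φ ω.1 (ω.2 t) l j) / n l :=
        div_pos hpos (by exact_mod_cast hn)
      positivity
    exact gaussianReal_absolutelyContinuous 0 (by simpa using hA) hN0
  · have hind : ∀ θ', (B.indicator 1 (resample (layerSet n H l) ω.1 θ', ω.2) : ENNReal)
        = 0 := by
      intro θ'
      refine Set.indicator_of_notMem (fun h => hpos ?_) _
      have := h.1
      simpa only [actDot, hact] using this
    simp only [hind, lintegral_zero]

end Differentiability

/-! ### Errors of the entries of the uncentered Gram matrix -/

namespace Model

variable {m : Model}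

theorem Regular.exists_forward_rate_sq (hm : m.Regular) :
    ∃ K : ℝ, 0 ≤ K ∧ ∀ᶠ M : ℕ in atTop, ∀ l ≤ m.H, ∀ s t : Fin (m.samples M),
      ∫⁻ ω, ENNReal.ofReal (m.fwdDev M l s t ω ^ 2) ∂(m.P M) ≤ ENNReal.ofReal (K / M) := by
  choose! K hK hrate using hm.exists_forward_rate
  refine ⟨∑ l ∈ Finset.range (m.H + 1), (K l + 1), Finset.sum_nonneg fun l hl => ?_, ?_⟩
  · have := hK l (by simpa [Nat.lt_succ_iff] using hl)
    linarith
  have hall : ∀ᶠ M : ℕ in atTop, ∀ l ≤ m.H, ∀ s t : Fin (m.samples M),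
      ∫⁻ ω, ENNReal.ofReal (m.fwdDev M l s t ω ^ 4) ∂(m.P M) ≤ ENNReal.ofReal (K l / (M : ℝ) ^ 2) :=
    (eventually_all_finite (Set.finite_le_nat m.H)).2 fun l hl => hrate l hl
  filter_upwards [hall, eventually_gt_atTop 0] with M hM hM0 l hl s t
  have hM' : (0 : ℝ) < M := by exact_mod_cast hM0
  -- Young's inequality x ≤ Mx² + 1/M turns the fourth-moment bound of order M⁻² into a
  -- second-moment bound of order M⁻¹.
  have hpt : ∀ ω, ENNReal.ofReal (m.fwdDev M l s t ω ^ 2)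
      ≤ ENNReal.ofReal M * ENNReal.ofReal (m.fwdDev M l s t ω ^ 4) + ENNReal.ofReal (1 / M) := by
    intro ω
    rw [← ENNReal.ofReal_mul hM'.le, ← ENNReal.ofReal_add (by positivity) (by positivity)]
    refine ENNReal.ofReal_le_ofReal ?_
    set x := m.fwdDev M l s t ω ^ 2
    have h1 : m.fwdDev M l s t ω ^ 4 = x ^ 2 := by simp only [x]; ring
    rw [h1]
    have h2 : M * x ^ 2 + 1 / M - 2 * x = M * (x - 1 / M) ^ 2 := by field_simp; ring
    have h3 : 0 ≤ M * (x - 1 / (M : ℝ)) ^ 2 := by positivity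
    have h4 : 0 ≤ x := sq_nonneg _
    linarith
  refine (lintegral_mono hpt).trans ?_
  rw [lintegral_add_right _ measurable_const, lintegral_const_mul' _ _ ENNReal.ofReal_ne_top,
    lintegral_const, measure_univ, mul_one]
  refine (add_le_add_left (mul_le_mul_right (hM l hl s t) _) _).trans ?_
  have hKl := hK l hl
  rw [← ENNReal.ofReal_mul hM'.le, ← ENNReal.ofReal_add (by positivity) (by positivity)]
  refine ENNReal.ofReal_le_ofReal ?_
  have h1 : (M : ℝ) * (K l / (M : ℝ) ^ 2) + 1 / M = (K l + 1) / M := by field_simp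
  rw [h1]
  refine div_le_div_of_nonneg_right ?_ hM'.le
  refine Finset.single_le_sum (f := fun l => K l + 1) (fun l hl => ?_)
    (Finset.mem_range.2 (Nat.lt_succ_of_le hl))
  have := hK l (by simpa [Nat.lt_succ_iff] using hl)
  linarith

/-- The event that all squared norms of activities are close to their limits. -/
def goodEvent (m : Model) (M : ℕ) : Set (m.Sample M) :=
  {ω | ∀ l ≤ m.H, ∀ t, |m.fwdDev M l t t ω| ≤ m.fwdT l / 2}

theorem Regular.samples_le (hm : m.Regular) (M : ℕ) : (m.samples M : ℝ) ≤ M / m.ρ :=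
  Nat.floor_le (div_nonneg (Nat.cast_nonneg _) hm.ρ_pos.le)

/-- Markov's inequality with fourth moments O(M⁻²), summed over the O(M) samples, leaves O(M⁻¹).
Second moments of order M⁻¹ would only give O(1), which is why the forward rate is established in
L⁴. -/
theorem Regular.tendsto_goodEvent_compl (hm : m.Regular) :
    Tendsto (fun M => m.P M (m.goodEvent M)ᶜ) atTop (𝓝 0) := by
  choose! K hK hrate using hm.exists_forward_rate
  have hall : ∀ᶠ M : ℕ in atTop, ∀ l ≤ m.H, ∀ s t : Fin (m.samples M),
      ∫⁻ ω, ENNReal.ofReal (m.fwdDev M l s t ω ^ 4) ∂(m.P M) ≤ ENNReal.ofReal (K l / (M : ℝ) ^ 2) :=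
    (eventually_all_finite (Set.finite_le_nat m.H)).2 fun l hl => hrate l hl
  set S : ℝ := ∑ l ∈ Finset.range (m.H + 1), K l / (m.fwdT l / 2) ^ 4 / m.ρ with hS
  have hlim : Tendsto (fun M : ℕ => ENNReal.ofReal (S / M)) atTop (𝓝 0) := by
    have := ENNReal.tendsto_ofReal (tendsto_const_div_atTop_nhds_zero_nat S)
    simpa using this
  refine tendsto_of_tendsto_of_tendsto_of_le_of_le' tendsto_const_nhds hlim
    (Eventually.of_forall fun _ => zero_le) ?_
  filter_upwards [hall, eventually_gt_atTop 0] with M hM hM0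
  have hM' : (0 : ℝ) < M := by exact_mod_cast hM0
  have hsub : (m.goodEvent M)ᶜ ⊆ ⋃ l ∈ Finset.range (m.H + 1), ⋃ t ∈ (Finset.univ :
      Finset (Fin (m.samples M))), {ω | ENNReal.ofReal ((m.fwdT l / 2) ^ 4)
        ≤ ENNReal.ofReal (m.fwdDev M l t t ω ^ 4)} := by
    intro ω hω
    simp only [goodEvent, Set.mem_compl_iff, Set.mem_ofPred_eq, not_forall, not_le] at hω
    obtain ⟨l, hl, t, hlt⟩ := hω
    simp only [Set.mem_iUnion, Finset.mem_range, Finset.mem_univ, Set.mem_ofPred_eq]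
    refine ⟨l, Nat.lt_succ_of_le hl, t, trivial, ENNReal.ofReal_le_ofReal ?_⟩
    have := pow_le_pow_left₀ (by linarith [hm.fwdT_pos hl]) hlt.le 4
    rwa [Even.pow_abs (by decide)] at this
  refine (measure_mono hsub).trans ((measure_biUnion_finset_le _ _).trans ?_)
  rw [hS, Finset.sum_div, ENNReal.ofReal_sum_of_nonneg]
  · refine Finset.sum_le_sum fun l hl => ?_
    have hl : l ≤ m.H := by simpa [Nat.lt_succ_iff] using hl
    have hr : 0 < (m.fwdT l / 2) ^ 4 := pow_pos (by linarith [hm.fwdT_pos hl]) 4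
    refine (measure_biUnion_finset_le _ _).trans ?_
    have hone : ∀ t : Fin (m.samples M), m.P M {ω | ENNReal.ofReal ((m.fwdT l / 2) ^ 4)
        ≤ ENNReal.ofReal (m.fwdDev M l t t ω ^ 4)}
        ≤ ENNReal.ofReal (K l / (M : ℝ) ^ 2 / (m.fwdT l / 2) ^ 4) := by
      intro t
      refine (meas_ge_le_lintegral_div
        ((hm.measurable_fwdDev M l hl t t).pow_const 4).ennreal_ofReal.aemeasurable
        (ENNReal.ofReal_pos.2 hr).ne' ENNReal.ofReal_ne_top).trans ?_
      rw [ENNReal.ofReal_div_of_pos hr]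
      exact ENNReal.div_le_div_right (hM l hl t t) _
    refine (Finset.sum_le_sum fun t _ => hone t).trans ?_
    rw [Finset.sum_const, Finset.card_univ, Fintype.card_fin, nsmul_eq_mul,
      ← ENNReal.ofReal_natCast, ← ENNReal.ofReal_mul (Nat.cast_nonneg _)]
    refine ENNReal.ofReal_le_ofReal ?_
    have hKl := hK l hl
    have hρ := hm.ρ_pos
    calc (m.samples M : ℝ) * (K l / (M : ℝ) ^ 2 / (m.fwdT l / 2) ^ 4)
        ≤ M / m.ρ * (K l / (M : ℝ) ^ 2 / (m.fwdT l / 2) ^ 4) :=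
          mul_le_mul_of_nonneg_right (hm.samples_le M) (by positivity)
      _ = _ := by field_simp
  · intro l hl
    have hl : l ≤ m.H := by simpa [Nat.lt_succ_iff] using hl
    have hr : 0 < (m.fwdT l / 2) ^ 4 := pow_pos (by linarith [hm.fwdT_pos hl]) 4
    have hKl := hK l hl
    have hρ := hm.ρ_pos
    positivity

/-- Limit of the overlap of the backward signals of the readout units `k` and `k'`. -/
def bwdLim (m : Model) {N T : ℕ} (l : ℕ) (k k' : Fin N) (s t : Fin T) : ℝ :=
  if k = k' then (if s = t then m.bwdT l else m.bwdST l) else 0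

/-- The rate assumption extends to pairs of different readout units. -/
theorem Regular.exists_backward_rate (hm : m.Regular) {q : ℝ} (hrate : m.BackwardRate q) :
    ∃ K : ℝ, 0 ≤ K ∧ ∀ᶠ M : ℕ in atTop, ∀ l ≤ m.H, ∀ (k k' : Fin (m.width M (m.H + 1)))
      (s t : Fin (m.samples M)),
      ∫⁻ ω, ENNReal.ofReal ((crossOverlap m.φ ω.1 (ω.2 s) (ω.2 t) k k' l
          - m.bwdLim l k k' s t) ^ 2) ∂(m.P M)
        ≤ ENNReal.ofReal ((K * (M : ℝ) ^ (-q)) ^ 2) := by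
  obtain ⟨K₀, hK₀⟩ := hrate
  refine ⟨max K₀ 0, le_max_right _ _, ?_⟩
  filter_upwards [hK₀] with M hM l hl k k' s t
  have hdiag : ∀ (k : Fin (m.width M (m.H + 1))) (s t : Fin (m.samples M)),
      ∫⁻ ω, ENNReal.ofReal ((crossOverlap m.φ ω.1 (ω.2 s) (ω.2 t) k k l
          - if s = t then m.bwdT l else m.bwdST l) ^ 2) ∂(m.P M)
        ≤ ENNReal.ofReal ((max K₀ 0 * (M : ℝ) ^ (-q)) ^ 2) := by
    intro k s t
    have h1 := (hM l hl k s t).trans (ENNReal.ofReal_le_ofReal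
      (mul_le_mul_of_nonneg_right (le_max_left K₀ 0) (Real.rpow_nonneg (Nat.cast_nonneg M) (-q))))
    have h2 := pow_le_pow_left₀ (zero_le) h1 2
    rw [← ENNReal.ofReal_pow (mul_nonneg (le_max_right _ _)
      (Real.rpow_nonneg (Nat.cast_nonneg M) (-q)))] at h2
    refine le_trans (le_of_eq ?_) h2
    rw [eLpNorm_eq_lintegral_rpow_enorm_toReal (by norm_num) (by norm_num),
      ENNReal.toReal_ofNat, ← ENNReal.rpow_natCast, ← ENNReal.rpow_mul]
    norm_num
    refine lintegral_congr fun ω => ?_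
    rw [Real.enorm_eq_ofReal_abs, ← ENNReal.ofReal_pow (abs_nonneg _), sq_abs]
    rfl
  by_cases hk : k = k'
  · subst hk
    simpa only [bwdLim, if_true] using hdiag k s t
  simp only [bwdLim, if_neg hk, sub_zero]
  -- Below the readout the comparison with quadratic forms applies, centered at `m.bwdT l`; at the
  -- readout the backward signals are indicators of different units and their overlap vanishes.
  rcases hl.lt_or_eq with hl' | rfl
  · refine (lintegral_crossOverlap_le m.σw m.σb (fun r h1 h2 => hm.measurable_φ r h1 h2) hl' hk s t
      (m.bwdT l)).trans ?_
    have h1 := hdiag k s s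
    have h2 := hdiag k t t
    simp only [if_true] at h1 h2
    refine (mul_le_mul_right (add_le_add h1 h2) _).trans (le_of_eq ?_)
    rw [← ENNReal.ofReal_add (sq_nonneg _) (sq_nonneg _), ← ENNReal.ofReal_mul (by norm_num)]
    congr 1
    ring
  · have h0 : ∀ ω : m.Sample M, crossOverlap m.φ ω.1 (ω.2 s) (ω.2 t) k k' m.H = 0 := by
      intro ω
      refine Finset.sum_eq_zero fun i _ => ?_
      rw [back_top, back_top]
      split_ifs with h1 h2 <;> simp_all
    simp [h0]

/-- Error of the entries of the uncentered reversed Fisher information matrix. -/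
def entryErr (m : Model) (M : ℕ) (k k' : Fin (m.width M (m.H + 1))) (s t : Fin (m.samples M))
    (ω : m.Sample M) : ℝ :=
  ∑ l ∈ Finset.range (m.H + 1),
      crossOverlap m.φ ω.1 (ω.2 s) (ω.2 t) k k' l * (actDot m.φ ω.1 (ω.2 s) (ω.2 t) l + 1)
    - if k = k' then m.alpha * M * (if s = t then m.kappa1 else m.kappa2) else 0

/-- A bound for the squared entry errors, up to a constant. -/
def entryBound (m : Model) (M : ℕ) (k k' : Fin (m.width M (m.H + 1))) (s t : Fin (m.samples M))
    (ω : m.Sample M) : ℝ :=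
  ∑ l ∈ Finset.range (m.H + 1),
    ((M : ℝ) ^ 2 * (crossOverlap m.φ ω.1 (ω.2 s) (ω.2 t) k k' l - m.bwdLim l k k' s t) ^ 2
      + (M : ℝ) ^ 2 * m.fwdDev M l s t ω ^ 2 + 1)

theorem entryBound_nonneg (M : ℕ) (k k' : Fin (m.width M (m.H + 1))) (s t : Fin (m.samples M))
    (ω : m.Sample M) : 0 ≤ m.entryBound M k k' s t ω :=
  Finset.sum_nonneg fun _ _ => by positivity

theorem abs_actDot_le {M l : ℕ} {ω : m.Sample M} (hω : ω ∈ m.goodEvent M) (hl : l ≤ m.H)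
    (hw : 0 < m.width M l) (s t : Fin (m.samples M)) :
    |actDot m.φ ω.1 (ω.2 s) (ω.2 t) l| ≤ m.width M l * (3 / 2 * m.fwdT l) := by
  have hw' : (0 : ℝ) < m.width M l := by exact_mod_cast hw
  have hdiag : ∀ t : Fin (m.samples M), ∑ j, act m.φ ω.1 (ω.2 t) l j ^ 2
      ≤ m.width M l * (3 / 2 * m.fwdT l) := by
    intro t
    have h1 := (le_abs_self _).trans (hω l hl t)
    simp only [fwdDev, if_true, sub_le_iff_le_add] at h1
    rw [div_le_iff₀ hw'] at h1
    simp only [actDot, ← sq] at h1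
    linarith
  have hnn : 0 ≤ m.width M l * (3 / 2 * m.fwdT l) :=
    (Finset.sum_nonneg fun _ _ => sq_nonneg _).trans (hdiag s)
  refine abs_le_of_sq_le_sq ?_ hnn
  refine (Finset.sum_mul_sq_le_sq_mul_sq _ _ _).trans ?_
  rw [sq]
  exact mul_le_mul (hdiag s) (hdiag t) (Finset.sum_nonneg fun _ _ => sq_nonneg _) hnn

theorem abs_bwdLim_le (hm : m.Regular) {l : ℕ} (hl : l ≤ m.H) {N T : ℕ} (k k' : Fin N)
    (s t : Fin T) : |m.bwdLim l k k' s t| ≤ m.bwdT l := by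
  have h := hm.abs_bwdST_le hl
  have h0 : 0 ≤ m.bwdT l := (abs_nonneg _).trans h
  unfold bwdLim
  split_ifs
  · rw [abs_of_nonneg h0]
  · exact h
  · simpa using h0

/-- The error is (B - b)(A + 1) + b(w·d + (w - aM)τ + 1). Since B - b is controlled only in L², the
factor A + 1 needs a deterministic bound O(M), supplied by the good event. Rounding the width and
the bias term cost O(1) each. -/
theorem abs_layer_error_le {B b A τ τT bT a M w d : ℝ} (hM : 1 ≤ M) (hA : |A| ≤ w * (3 / 2 * τT))
    (hAd : A = w * (d + τ)) (hb : |b| ≤ bT) (hτ : |τ| ≤ τT) (hw : 0 ≤ w) (hwa : w ≤ a * M)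
    (haw : a * M ≤ w + 1) :
    |B * (A + 1) - b * (a * M * τ)|
      ≤ (2 * a * τT + 1 + bT * a + bT * (τT + 1)) * (M * |B - b| + M * |d| + 1) := by
  have hbT := (abs_nonneg _).trans hb
  have hτT := (abs_nonneg _).trans hτ
  have ha : 0 ≤ a := by
    by_contra h
    nlinarith
  have e : B * (A + 1) - b * (a * M * τ)
      = (B - b) * (A + 1) + b * (w * d + ((w - a * M) * τ + 1)) := by rw [hAd]; ring
  have h1 : |A + 1| ≤ (2 * a * τT + 1) * M := by
    have h2 : w * (3 / 2 * τT) ≤ a * M * (2 * τT) :=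
      mul_le_mul hwa (by linarith) (by linarith) (by positivity)
    have := abs_add_le A 1
    rw [abs_one] at this
    linarith
  have h2 : |w * d + ((w - a * M) * τ + 1)| ≤ a * M * |d| + (τT + 1) := by
    have h3 : |(w - a * M) * τ| ≤ τT := by
      rw [abs_mul]
      have : |w - a * M| ≤ 1 := abs_le.2 ⟨by linarith, by linarith⟩
      calc |w - a * M| * |τ| ≤ 1 * τT := mul_le_mul this hτ (abs_nonneg _) zero_le_one
        _ = τT := one_mul _
    have h4 : |w * d| ≤ a * M * |d| := by
      rw [abs_mul, abs_of_nonneg hw]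
      exact mul_le_mul_of_nonneg_right hwa (abs_nonneg _)
    have h5 := abs_add_le (w * d) ((w - a * M) * τ + 1)
    have h6 := abs_add_le ((w - a * M) * τ) 1
    rw [abs_one] at h6
    linarith
  have h3 : |B - b| * |A + 1| ≤ |B - b| * ((2 * a * τT + 1) * M) :=
    mul_le_mul_of_nonneg_left h1 (abs_nonneg _)
  have h4 : |b| * |w * d + ((w - a * M) * τ + 1)| ≤ bT * (a * M * |d| + (τT + 1)) :=
    mul_le_mul hb h2 (abs_nonneg _) hbT
  have h5 := abs_add_le ((B - b) * (A + 1)) (b * (w * d + ((w - a * M) * τ + 1)))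
  rw [abs_mul, abs_mul, ← e] at h5
  have hx : 0 ≤ M * |B - b| := mul_nonneg (by linarith) (abs_nonneg _)
  have hy : 0 ≤ M * |d| := mul_nonneg (by linarith) (abs_nonneg _)
  have c1 : 0 ≤ 2 * a * τT + 1 := by positivity
  have c2 : 0 ≤ bT * a := by positivity
  have c3 : 0 ≤ bT * (τT + 1) := by positivity
  nlinarith [mul_nonneg c1 hy, mul_nonneg c2 hx, mul_nonneg c3 hx, mul_nonneg c3 hy]

theorem Regular.exists_sq_entryErr_le (hm : m.Regular) :
    ∃ c : ℝ, 0 ≤ c ∧ ∀ᶠ M : ℕ in atTop, ∀ ω ∈ m.goodEvent M,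
      ∀ (k k' : Fin (m.width M (m.H + 1))) (s t : Fin (m.samples M)),
        m.entryErr M k k' s t ω ^ 2 ≤ c * m.entryBound M k k' s t ω := by
  set cl : ℕ → ℝ := fun l => 2 * m.a l * m.fwdT l + 1 + m.bwdT l * m.a l
    + m.bwdT l * (m.fwdT l + 1) with hcl
  have hcl0 : ∀ l ∈ Finset.range (m.H + 1), 0 ≤ cl l := by
    intro l hl
    have hl : l ≤ m.H := by simpa [Nat.lt_succ_iff] using hl
    have h1 := hm.a_pos l hl
    have h2 := hm.fwdT_pos hl
    have h3 := (abs_nonneg _).trans (hm.abs_bwdST_le hl)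
    positivity
  set c := ∑ l ∈ Finset.range (m.H + 1), cl l with hc
  have hc0 : 0 ≤ c := Finset.sum_nonneg hcl0
  -- Cauchy–Schwarz over the `H + 1` layers and then over the three terms of each layer.
  refine ⟨c ^ 2 * (3 * (m.H + 1)), by positivity, ?_⟩
  filter_upwards [hm.eventually_width, eventually_ge_atTop 1] with M hM hM1 ω hω k k' s t
  have hM1' : (1 : ℝ) ≤ M := by exact_mod_cast hM1
  set τ : ℕ → ℝ := fun l => if s = t then m.fwdT l else m.fwdST l with hτ
  set B : ℕ → ℝ := fun l => crossOverlap m.φ ω.1 (ω.2 s) (ω.2 t) k k' l with hB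
  set A : ℕ → ℝ := fun l => actDot m.φ ω.1 (ω.2 s) (ω.2 t) l with hA
  set b : ℕ → ℝ := fun l => m.bwdLim l k k' s t with hb
  set d : ℕ → ℝ := fun l => m.fwdDev M l s t ω with hd
  have hα := hm.alpha_pos.ne'
  have hlead : (if k = k' then m.alpha * M * (if s = t then m.kappa1 else m.kappa2) else 0)
      = ∑ l ∈ Finset.range (m.H + 1), b l * (m.a l * M * τ l) := by
    simp only [hb, hτ, bwdLim, kappa1, kappa2]
    split_ifs
    · rw [Finset.mul_sum]
      exact Finset.sum_congr rfl fun l _ => by field_simp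
    · rw [Finset.mul_sum]
      exact Finset.sum_congr rfl fun l _ => by field_simp
    · simp
    · simp
  have hE : m.entryErr M k k' s t ω
      = ∑ l ∈ Finset.range (m.H + 1), (B l * (A l + 1) - b l * (m.a l * M * τ l)) := by
    rw [Finset.sum_sub_distrib, ← hlead]; rfl
  have hle : |m.entryErr M k k' s t ω|
      ≤ c * ∑ l ∈ Finset.range (m.H + 1), (M * |B l - b l| + M * |d l| + 1) := by
    rw [hE, Finset.mul_sum]
    refine (Finset.abs_sum_le_sum_abs _ _).trans (Finset.sum_le_sum fun l hlr => ?_)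
    have hl : l ≤ m.H := by simpa [Nat.lt_succ_iff] using hlr
    have hw : (0 : ℝ) < m.width M l := by exact_mod_cast (hM l hl).1
    refine (abs_layer_error_le (d := d l) hM1' (abs_actDot_le hω hl (hM l hl).1 s t) ?_
      (abs_bwdLim_le hm hl k k' s t) (τ := τ l) ?_ hw.le (width_le hm hl)
      (le_width_add_one m hl)).trans ?_
    · simp only [hd, hτ, fwdDev]
      field_simp
      ring
    · simp only [hτ]
      split_ifs
      · rw [abs_of_pos (hm.fwdT_pos hl)]
      · exact (hm.abs_fwdST_lt l hl).le
    · exact mul_le_mul_of_nonneg_right (Finset.single_le_sum hcl0 hlr) (by positivity)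
  have h1 := pow_le_pow_left₀ (abs_nonneg _) hle 2
  rw [sq_abs, mul_pow] at h1
  refine h1.trans ?_
  rw [mul_assoc]
  refine mul_le_mul_of_nonneg_left ?_ (sq_nonneg c)
  refine sq_sum_le_card_mul_sum_sq.trans ?_
  rw [Finset.card_range, entryBound, mul_comm 3, mul_assoc, Finset.mul_sum (a := (3 : ℝ))]
  push_cast
  refine mul_le_mul_of_nonneg_left (Finset.sum_le_sum fun l _ => ?_) (by positivity)
  have e1 : (M : ℝ) ^ 2 * (B l - b l) ^ 2 = (M * |B l - b l|) ^ 2 := by rw [mul_pow, sq_abs]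
  have e2 : (M : ℝ) ^ 2 * d l ^ 2 = (M * |d l|) ^ 2 := by rw [mul_pow, sq_abs]
  change _ ≤ 3 * ((M : ℝ) ^ 2 * (B l - b l) ^ 2 + (M : ℝ) ^ 2 * d l ^ 2 + 1)
  rw [e1, e2]
  set x := M * |B l - b l|
  set y := M * |d l|
  nlinarith [sq_nonneg (x - y), sq_nonneg (x - 1), sq_nonneg (y - 1)]

theorem Regular.measurable_entryBound (hm : m.Regular) (M : ℕ) (k k' : Fin (m.width M (m.H + 1)))
    (s t : Fin (m.samples M)) : Measurable (m.entryBound M k k' s t) := by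
  refine Finset.measurable_sum _ fun l hl => ?_
  have hl : l ≤ m.H := by simpa [Nat.lt_succ_iff] using hl
  exact (((((measurable_crossOverlap s t k k' l hl hm.measurable_φ).sub_const _).pow_const
    2).const_mul _).add (((hm.measurable_fwdDev M l hl s t).pow_const 2).const_mul _)).add_const _

/-- Multiplied by M², the backward mean square error is O(M^(2-2q)) and the forward one O(M). The
larger exponent is 2(1 - min q (1/2)), which is where q* comes from. -/
theorem Regular.exists_lintegral_entryBound_le (hm : m.Regular) {q : ℝ}
    (hrate : m.BackwardRate q) :
    ∃ K : ℝ, 0 ≤ K ∧ ∀ᶠ M : ℕ in atTop, ∀ (k k' : Fin (m.width M (m.H + 1)))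
      (s t : Fin (m.samples M)),
      ∫⁻ ω, ENNReal.ofReal (m.entryBound M k k' s t ω) ∂(m.P M)
        ≤ ENNReal.ofReal (K * (M : ℝ) ^ (2 * (1 - min q (1 / 2)))) := by
  obtain ⟨K₁, hK₁, h₁⟩ := hm.exists_backward_rate hrate
  obtain ⟨K₂, hK₂, h₂⟩ := hm.exists_forward_rate_sq
  refine ⟨(m.H + 1) * (K₁ ^ 2 + K₂ + 1), by positivity, ?_⟩
  filter_upwards [h₁, h₂, eventually_ge_atTop 1] with M hM₁ hM₂ hM k k' s t
  have hM1 : (1 : ℝ) ≤ M := by exact_mod_cast hM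
  have hM0 : (0 : ℝ) < M := by linarith
  set r := (M : ℝ) ^ (2 * (1 - min q (1 / 2))) with hr
  have hr0 : 0 ≤ r := Real.rpow_nonneg hM0.le _
  have hr1 : (M : ℝ) ^ 2 * (K₁ * (M : ℝ) ^ (-q)) ^ 2 ≤ K₁ ^ 2 * r := by
    have : (M : ℝ) ^ 2 * (K₁ * (M : ℝ) ^ (-q)) ^ 2 = K₁ ^ 2 * (M : ℝ) ^ (2 * (1 - q)) := by
      rw [mul_pow, ← Real.rpow_natCast ((M : ℝ) ^ (-q)), ← Real.rpow_mul hM0.le,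
        ← Real.rpow_natCast (M : ℝ), mul_left_comm, ← Real.rpow_add hM0]
      congr 2
      push_cast
      ring
    rw [this]
    refine mul_le_mul_of_nonneg_left (Real.rpow_le_rpow_of_exponent_le hM1 ?_) (sq_nonneg _)
    linarith [min_le_left q (1 / 2)]
  have hMr : (M : ℝ) ≤ r := by
    have := Real.rpow_le_rpow_of_exponent_le (z := 2 * (1 - min q (1 / 2))) hM1
      (y := 1) (by linarith [min_le_right q (1 / 2)])
    rwa [Real.rpow_one] at this
  have hr2 : (M : ℝ) ^ 2 * (K₂ / M) ≤ K₂ * r := by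
    have : (M : ℝ) ^ 2 * (K₂ / M) = K₂ * M := by field_simp
    rw [this]
    exact mul_le_mul_of_nonneg_left hMr hK₂
  simp only [entryBound]
  have hnn : ∀ l ω, 0 ≤ (M : ℝ) ^ 2 * (crossOverlap m.φ ω.1 (ω.2 s) (ω.2 t) k k' l
      - m.bwdLim l k k' s t) ^ 2 + (M : ℝ) ^ 2 * m.fwdDev M l s t ω ^ 2 + 1 :=
    fun l ω => by positivity
  have hsplit : ∀ (l : ℕ) (ω : m.Sample M), ENNReal.ofReal ((M : ℝ) ^ 2 *
      (crossOverlap m.φ ω.1 (ω.2 s) (ω.2 t) k k' l - m.bwdLim l k k' s t) ^ 2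
        + (M : ℝ) ^ 2 * m.fwdDev M l s t ω ^ 2 + 1)
      = ENNReal.ofReal ((M : ℝ) ^ 2) * ENNReal.ofReal
          ((crossOverlap m.φ ω.1 (ω.2 s) (ω.2 t) k k' l - m.bwdLim l k k' s t) ^ 2)
        + ENNReal.ofReal ((M : ℝ) ^ 2) * ENNReal.ofReal (m.fwdDev M l s t ω ^ 2) + 1 := by
    intro l ω
    rw [ENNReal.ofReal_add (by positivity) zero_le_one, ENNReal.ofReal_add (by positivity)
      (by positivity), ENNReal.ofReal_mul (by positivity), ENNReal.ofReal_mul (by positivity),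
      ENNReal.ofReal_one]
  simp only [fun ω : m.Sample M => ENNReal.ofReal_sum_of_nonneg
    (s := Finset.range (m.H + 1)) (fun l _ => hnn l ω)]
  have hm1 := fun l (hl : l ≤ m.H) => ((((measurable_crossOverlap (T := m.samples M) s t k k' l hl
    hm.measurable_φ).sub_const (m.bwdLim l k k' s t)).pow_const 2).ennreal_ofReal)
  have hm2 := fun l (hl : l ≤ m.H) => ((hm.measurable_fwdDev M l hl s t).pow_const
    2).ennreal_ofReal
  rw [lintegral_finsetSum']
  · refine (Finset.sum_le_sum fun l hl => ?_).trans (le_of_eq (?_ :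
      ∑ l ∈ Finset.range (m.H + 1), ENNReal.ofReal ((K₁ ^ 2 + K₂ + 1) * r) = _))
    · have hl : l ≤ m.H := by simpa [Nat.lt_succ_iff] using hl
      simp only [hsplit]
      rw [lintegral_add_right _ measurable_const, lintegral_add_right _ ((hm2 l hl).const_mul _),
        lintegral_const_mul' _ _ ENNReal.ofReal_ne_top,
        lintegral_const_mul' _ _ ENNReal.ofReal_ne_top, lintegral_const, measure_univ, mul_one]
      refine (add_le_add_left (add_le_add (mul_le_mul_right (hM₁ l hl k k' s t) _)
        (mul_le_mul_right (hM₂ l hl s t) _)) _).trans ?_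
      rw [← ENNReal.ofReal_mul (by positivity), ← ENNReal.ofReal_mul (by positivity),
        ← ENNReal.ofReal_add (by positivity) (by positivity), ← ENNReal.ofReal_one,
        ← ENNReal.ofReal_add (by positivity) (by positivity)]
      refine ENNReal.ofReal_le_ofReal ?_
      nlinarith
    · rw [Finset.sum_const, Finset.card_range, nsmul_eq_mul, ← ENNReal.ofReal_natCast,
        ← ENNReal.ofReal_mul (Nat.cast_nonneg _)]
      congr 1
      push_cast
      ring
  · intro l hl
    have hl : l ≤ m.H := by simpa [Nat.lt_succ_iff] using hl
    simp only [hsplit]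
    exact ((((hm1 l hl).const_mul _).add ((hm2 l hl).const_mul _)).add_const _).aemeasurable

end Model

/-! ### Expectations of sums and averages -/

section Averages

variable {Ω : Type*} [MeasurableSpace Ω] {P : Measure Ω} {ι : Type*} [Fintype ι]
  {f : ι → Ω → ℝ} {R : ℝ}

theorem lintegral_ofReal_sum_le (hfm : ∀ i, Measurable (f i)) (hf : ∀ i ω, 0 ≤ f i ω)
    (h : ∀ i, ∫⁻ ω, ENNReal.ofReal (f i ω) ∂P ≤ ENNReal.ofReal R) :
    ∫⁻ ω, ENNReal.ofReal (∑ i, f i ω) ∂P ≤ ENNReal.ofReal (Fintype.card ι * R) := by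
  simp only [fun ω => ENNReal.ofReal_sum_of_nonneg (s := Finset.univ) fun i _ => hf i ω]
  rw [lintegral_finsetSum _ fun i _ => (hfm i).ennreal_ofReal]
  refine (Finset.sum_le_sum fun i _ => h i).trans (le_of_eq ?_)
  rw [Finset.sum_const, Finset.card_univ, nsmul_eq_mul, ENNReal.ofReal_mul (Nat.cast_nonneg _),
    ENNReal.ofReal_natCast]

theorem lintegral_ofReal_mean_le (hfm : ∀ i, Measurable (f i)) (hf : ∀ i ω, 0 ≤ f i ω)
    (hR : 0 ≤ R) (h : ∀ i, ∫⁻ ω, ENNReal.ofReal (f i ω) ∂P ≤ ENNReal.ofReal R) :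
    ∫⁻ ω, ENNReal.ofReal ((∑ i, f i ω) / Fintype.card ι) ∂P ≤ ENNReal.ofReal R := by
  have h1 : ∀ ω, ENNReal.ofReal ((∑ i, f i ω) / Fintype.card ι)
      = ENNReal.ofReal (1 / Fintype.card ι) * ENNReal.ofReal (∑ i, f i ω) := by
    intro ω
    rw [← ENNReal.ofReal_mul (by positivity), one_div_mul_eq_div]
  simp only [h1]
  rw [lintegral_const_mul' _ _ ENNReal.ofReal_ne_top]
  refine (mul_le_mul_right (lintegral_ofReal_sum_le hfm hf h) _).trans ?_
  rw [← ENNReal.ofReal_mul (by positivity)]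
  refine ENNReal.ofReal_le_ofReal ?_
  rw [← mul_assoc, one_div_mul_eq_div]
  exact mul_le_of_le_one_left hR (div_self_le_one _)

end Averages

/-- The centered trace over T is the diagonal average minus the overall average, and both are
bounded by Jensen. So the trace of the remainder has the order of a single entry error;
Cauchy–Schwarz against the Frobenius norm would lose a factor √T. -/
theorem sq_center_trace_le {T : ℕ} (E : Fin T → Fin T → ℝ) :
    ((∑ t, center E t t) / T) ^ 2
      ≤ 2 * ((∑ t, E t t ^ 2) / T + (∑ s, ∑ t, E s t ^ 2) / (T : ℝ) ^ 2) := by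
  rcases Nat.eq_zero_or_pos T with rfl | hT
  · simp
  have hT' : (0 : ℝ) < T := by exact_mod_cast hT
  have h1 : (∑ t, E t t) ^ 2 ≤ T * ∑ t, E t t ^ 2 := by
    have := sq_sum_le_card_mul_sum_sq (s := Finset.univ) (f := fun t => E t t)
    simpa using this
  have h2 : (∑ s, ∑ t, E s t) ^ 2 ≤ (T : ℝ) ^ 2 * ∑ s, ∑ t, E s t ^ 2 := by
    have := sq_sum_le_card_mul_sum_sq (s := Finset.univ) (f := fun p : Fin T × Fin T => E p.1 p.2)
    simpa [Fintype.sum_prod_type, sq] using this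
  have h3 : (∑ t, center E t t) / T = (∑ t, E t t) / T - (∑ s, ∑ t, E s t) / (T : ℝ) ^ 2 := by
    rw [sum_center_diag]
    field_simp
  have h4 : ((∑ t, E t t) / T) ^ 2 ≤ (∑ t, E t t ^ 2) / T := by
    rw [div_pow, div_le_div_iff₀ (by positivity) hT']
    nlinarith
  have h5 : ((∑ s, ∑ t, E s t) / (T : ℝ) ^ 2) ^ 2 ≤ (∑ s, ∑ t, E s t ^ 2) / (T : ℝ) ^ 2 := by
    rw [div_pow, div_le_div_iff₀ (by positivity) (by positivity)]
    nlinarith [mul_le_mul_of_nonneg_right h2 (sq_nonneg (T : ℝ))]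
  rw [h3]
  nlinarith [sq_nonneg ((∑ t, E t t) / T + (∑ s, ∑ t, E s t) / (T : ℝ) ^ 2)]

/-! ### The remainder and the eigenvalue bounds -/

namespace Model

variable {m : Model}

/-- Reversed Fisher information matrix minus its leading term. -/
def remErr (m : Model) (M : ℕ) (ω : m.Sample M)
    (a b : Fin (m.width M (m.H + 1)) × Fin (m.samples M)) : ℝ :=
  revFim m.φ m.β ω.1 ω.2 a b - m.leading M a b

/-- The activation functions are differentiable at all pre-activations. -/
def Smooth (m : Model) (M : ℕ) (ω : m.Sample M) : Prop :=
  ∀ t, ∀ l < m.H, ∀ i, DifferentiableAt ℝ (m.φ (l + 1)) (preact m.φ ω.1 (ω.2 t) l i)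

/-- The leading term is exactly the centering of the limiting two-valued matrix, so by linearity
only the entry errors remain. -/
theorem remErr_eq {M : ℕ} {ω : m.Sample M} (hd : m.Smooth M ω)
    (k k' : Fin (m.width M (m.H + 1))) (s t : Fin (m.samples M)) :
    m.remErr M ω (k, s) (k', t)
      = center (fun s t => m.entryErr M k k' s t ω) s t / m.samples M := by
  rw [remErr, revFim_eq_center m.φ m.β ω.1 ω.2 hd]
  set x := if k = k' then m.alpha * M * m.kappa1 else 0 with hx
  set y := if k = k' then m.alpha * M * m.kappa2 else 0 with hy
  have h : ∀ s t, ∑ l ∈ Finset.range (m.H + 1),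
      crossOverlap m.φ ω.1 (ω.2 s) (ω.2 t) k k' l * (actDot m.φ ω.1 (ω.2 s) (ω.2 t) l + 1)
      = m.entryErr M k k' s t ω + if s = t then x else y := by
    intro s t
    simp only [entryErr, hx, hy]
    split_ifs <;> ring
  simp only [h]
  rw [center_add (fun s t => m.entryErr M k k' s t ω) (fun s t => if s = t then x else y),
    center_ite, add_div, add_sub_assoc, add_eq_left, sub_eq_zero, leading, hx, hy]
  dsimp only
  split_ifs <;> ring

/-- Sum of the entry bounds controlling the remainder. -/
def totalBound (m : Model) (M : ℕ) (ω : m.Sample M) : ℝ :=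
  ∑ p : Fin (m.width M (m.H + 1)) × Fin (m.width M (m.H + 1)),
    ((∑ t, m.entryBound M p.1 p.2 t t ω) / Fintype.card (Fin (m.samples M))
      + (∑ r : Fin (m.samples M) × Fin (m.samples M), m.entryBound M p.1 p.2 r.1 r.2 ω)
        / Fintype.card (Fin (m.samples M) × Fin (m.samples M)))

theorem Regular.exists_lintegral_totalBound_le (hm : m.Regular) {q : ℝ}
    (hrate : m.BackwardRate q) :
    ∃ K : ℝ, 0 ≤ K ∧ ∀ᶠ M : ℕ in atTop, ∫⁻ ω, ENNReal.ofReal (m.totalBound M ω) ∂(m.P M)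
        ≤ ENNReal.ofReal (K * (M : ℝ) ^ (2 * (1 - min q (1 / 2)))) := by
  obtain ⟨K, hK, h⟩ := hm.exists_lintegral_entryBound_le hrate
  refine ⟨m.C ^ 2 * (2 * K), by positivity, ?_⟩
  filter_upwards [h] with M hM
  set R := K * (M : ℝ) ^ (2 * (1 - min q (1 / 2))) with hRdef
  have hR : 0 ≤ R := mul_nonneg hK (Real.rpow_nonneg (Nat.cast_nonneg _) _)
  have hV := fun k k' s t => hm.measurable_entryBound M k k' s t
  refine (lintegral_ofReal_sum_le (R := 2 * R) (fun p => ?_) (fun p ω => ?_)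
    fun p => ?_).trans (le_of_eq ?_)
  · exact ((Finset.measurable_sum _ fun t _ => hV _ _ t t).div_const _).add
      ((Finset.measurable_sum _ fun r _ => hV _ _ r.1 r.2).div_const _)
  · exact add_nonneg
      (div_nonneg (Finset.sum_nonneg fun _ _ => entryBound_nonneg ..) (Nat.cast_nonneg _))
      (div_nonneg (Finset.sum_nonneg fun _ _ => entryBound_nonneg ..) (Nat.cast_nonneg _))
  · have h1 := lintegral_ofReal_mean_le (P := m.P M)
      (f := fun t ω => m.entryBound M p.1 p.2 t t ω) (fun t => hV _ _ t t)
      (fun t ω => entryBound_nonneg ..) hR fun t => hM _ _ t t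
    have h2 := lintegral_ofReal_mean_le (P := m.P M)
      (f := fun (r : Fin (m.samples M) × Fin (m.samples M)) ω =>
        m.entryBound M p.1 p.2 r.1 r.2 ω) (fun r => hV _ _ r.1 r.2)
      (fun t ω => entryBound_nonneg ..) hR fun r => hM _ _ r.1 r.2
    rw [two_mul, ENNReal.ofReal_add hR hR]
    refine le_trans ?_ (add_le_add h1 h2)
    rw [← lintegral_add_right _
      ((Finset.measurable_sum _ fun r _ => hV _ _ r.1 r.2).div_const _).ennreal_ofReal]
    exact lintegral_mono fun ω => ENNReal.ofReal_add_le
  · rw [Fintype.card_prod, Fintype.card_fin, width_top]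
    congr 1
    push_cast
    ring

/-- The remainder is of order `M ^ (2 (1 - r))` in squared Frobenius norm, its squared trace is of
the same order, and the sums of the entries of its diagonal blocks vanish. -/
structure RemBound (m : Model) (r K : ℝ) (M : ℕ) (ω : m.Sample M) : Prop where
  sq_le : ∑ a, ∑ b, m.remErr M ω a b ^ 2 ≤ K * (M : ℝ) ^ (2 * (1 - r))
  trace_sq_le : (∑ a, m.remErr M ω a a) ^ 2 ≤ K * (M : ℝ) ^ (2 * (1 - r))
  sum_eq_zero : ∀ k, ∑ s, ∑ t, m.remErr M ω (k, s) (k, t) = 0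

theorem sum_remErr_sq_le {M : ℕ} {ω : m.Sample M} (hd : m.Smooth M ω) {c : ℝ} (hc : 0 ≤ c)
    (hE : ∀ k k' s t, m.entryErr M k k' s t ω ^ 2 ≤ c * m.entryBound M k k' s t ω) :
    ∑ a, ∑ b, m.remErr M ω a b ^ 2 ≤ c * m.totalBound M ω := by
  have h1 : ∑ a, ∑ b, m.remErr M ω a b ^ 2
      = ∑ p : Fin (m.width M (m.H + 1)) × Fin (m.width M (m.H + 1)),
        (∑ s, ∑ t, center (fun s t => m.entryErr M p.1 p.2 s t ω) s t ^ 2)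
          / (m.samples M : ℝ) ^ 2 := by
    simp only [Fintype.sum_prod_type, remErr_eq hd, div_pow, Finset.sum_div]
    refine Finset.sum_congr rfl fun k _ => ?_
    rw [Finset.sum_comm]
  rw [h1, totalBound, Finset.mul_sum]
  refine Finset.sum_le_sum fun p _ => ?_
  have h2 : ∑ s, ∑ t, center (fun s t => m.entryErr M p.1 p.2 s t ω) s t ^ 2
      ≤ c * ∑ r : Fin (m.samples M) × Fin (m.samples M), m.entryBound M p.1 p.2 r.1 r.2 ω := by
    refine (sum_center_sq_le _).trans ?_
    rw [Fintype.sum_prod_type, Finset.mul_sum]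
    refine Finset.sum_le_sum fun s _ => ?_
    rw [Finset.mul_sum]
    exact Finset.sum_le_sum fun t _ => hE ..
  have h3 : 0 ≤ (∑ t, m.entryBound M p.1 p.2 t t ω) / Fintype.card (Fin (m.samples M)) :=
    div_nonneg (Finset.sum_nonneg fun _ _ => entryBound_nonneg ..) (Nat.cast_nonneg _)
  rw [mul_add]
  refine le_trans ?_ (le_add_of_nonneg_left (mul_nonneg hc h3))
  rw [Fintype.card_prod, Fintype.card_fin, ← mul_div_assoc]
  push_cast
  rw [← sq]
  exact div_le_div_of_nonneg_right h2 (sq_nonneg _)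

theorem sq_trace_remErr_le {M : ℕ} {ω : m.Sample M} (hd : m.Smooth M ω) {c : ℝ} (hc : 0 ≤ c)
    (hE : ∀ k k' s t, m.entryErr M k k' s t ω ^ 2 ≤ c * m.entryBound M k k' s t ω) :
    (∑ a, m.remErr M ω a a) ^ 2 ≤ 2 * m.C * c * m.totalBound M ω := by
  set G : Fin (m.width M (m.H + 1)) × Fin (m.width M (m.H + 1)) → ℝ := fun p =>
    (∑ t, m.entryBound M p.1 p.2 t t ω) / Fintype.card (Fin (m.samples M))
      + (∑ r : Fin (m.samples M) × Fin (m.samples M), m.entryBound M p.1 p.2 r.1 r.2 ω)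
        / Fintype.card (Fin (m.samples M) × Fin (m.samples M)) with hG
  have hG0 : ∀ p, 0 ≤ G p := fun p => add_nonneg
      (div_nonneg (Finset.sum_nonneg fun _ _ => entryBound_nonneg ..) (Nat.cast_nonneg _))
      (div_nonneg (Finset.sum_nonneg fun _ _ => entryBound_nonneg ..) (Nat.cast_nonneg _))
  have h1 : ∑ a, m.remErr M ω a a
      = ∑ k, (∑ t, center (fun s t => m.entryErr M k k s t ω) t t) / m.samples M := by
    simp only [Fintype.sum_prod_type, remErr_eq hd, Finset.sum_div]
  have h2 : ∀ k, ((∑ t, center (fun s t => m.entryErr M k k s t ω) t t) / m.samples M) ^ 2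
      ≤ 2 * c * G (k, k) := by
    intro k
    refine (sq_center_trace_le _).trans ?_
    rw [mul_assoc, hG]
    dsimp only
    rw [Fintype.card_prod, Fintype.card_fin, mul_add c, ← mul_div_assoc, ← mul_div_assoc,
      Fintype.sum_prod_type, Finset.mul_sum, Finset.mul_sum]
    push_cast
    rw [← sq]
    refine mul_le_mul_of_nonneg_left (add_le_add (div_le_div_of_nonneg_right
      (Finset.sum_le_sum fun t _ => hE ..) (Nat.cast_nonneg _)) (div_le_div_of_nonneg_right
      (Finset.sum_le_sum fun s _ => ?_) (sq_nonneg _))) zero_le_two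
    rw [Finset.mul_sum]
    exact Finset.sum_le_sum fun t _ => hE ..
  have h3 : ∑ k, G (k, k) ≤ m.totalBound M ω := by
    change _ ≤ ∑ p, G p
    rw [Fintype.sum_prod_type]
    exact Finset.sum_le_sum fun k _ =>
      Finset.single_le_sum (f := fun k' => G (k, k')) (fun k' _ => hG0 _) (Finset.mem_univ k)
  rw [h1]
  refine sq_sum_le_card_mul_sum_sq.trans ?_
  have hw : (m.width M (m.H + 1) : ℝ) = m.C := by rw [width_top]
  rw [Finset.card_univ, Fintype.card_fin, hw, mul_right_comm 2, mul_comm (2 * c), mul_assoc]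
  refine mul_le_mul_of_nonneg_left ((Finset.sum_le_sum fun k _ => h2 k).trans ?_)
    (Nat.cast_nonneg _)
  rw [← Finset.mul_sum]
  exact mul_le_mul_of_nonneg_left h3 (by positivity)

/-- On the good event no activity vector vanishes, which is the condition for avoiding the kinks of
the activation functions. -/
theorem Regular.ae_smooth (hm : m.Regular) (M : ℕ) (hM : ∀ l ≤ m.H, 0 < m.width M l) :
    ∀ᵐ ω ∂(m.P M), ω ∈ m.goodEvent M → m.Smooth M ω := by
  have h : ∀ᵐ ω ∂(m.P M), ∀ t l, l < m.H → ∀ i, 0 < actDot m.φ ω.1 (ω.2 t) (ω.2 t) l →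
      DifferentiableAt ℝ (m.φ (l + 1)) (preact m.φ ω.1 (ω.2 t) l i) :=
    ae_all_iff.2 fun t => ae_all_iff.2 fun l => ae_all_iff.2 fun hl => ae_all_iff.2 fun i =>
      ae_differentiableAt_preact hm.σw_pos hm.lip t hl i
  filter_upwards [h] with ω hω hg t l hl i
  refine hω t l hl i ?_
  have hw : (0 : ℝ) < m.width M l := by exact_mod_cast hM l hl.le
  have h1 := (abs_le.1 (hg l hl.le t)).1
  simp only [fwdDev, if_true] at h1
  have h2 := hm.fwdT_pos hl.le
  have h3 : 0 < actDot m.φ ω.1 (ω.2 t) (ω.2 t) l / m.width M l := by linarith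
  exact (div_pos_iff_of_pos_right hw).1 h3

theorem Regular.exists_remBound (hm : m.Regular) {q : ℝ} (hrate : m.BackwardRate q)
    {η : ENNReal} (hη : 0 < η) :
    ∃ K : ℝ, 0 ≤ K ∧ ∀ᶠ M : ℕ in atTop,
      m.P M {ω | ¬ m.RemBound (min q (1 / 2)) K M ω} ≤ η := by
  -- `η` may be infinite, so a finite positive level below η/2 is chosen; the threshold Q = (K₀ +
  -- 1)/δ then makes Markov's quotient K₀/Q at most δ.
  obtain ⟨δ, hδ0, hδ⟩ := ENNReal.lt_iff_exists_nnreal_btwn.1 (ENNReal.half_pos hη.ne')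
  have hδ0 : (0 : ℝ) < δ := by exact_mod_cast hδ0
  obtain ⟨c, hc, hE⟩ := hm.exists_sq_entryErr_le
  obtain ⟨K₀, hK₀, hZ⟩ := hm.exists_lintegral_totalBound_le hrate
  have hgood := (ENNReal.tendsto_nhds_zero.1 hm.tendsto_goodEvent_compl) (η / 2)
    (ENNReal.half_pos hη.ne')
  set Q := (K₀ + 1) / (δ : ℝ) with hQ
  have hQ0 : 0 < Q := by positivity
  refine ⟨(1 + 2 * m.C) * c * Q, by positivity, ?_⟩
  filter_upwards [hE, hZ, hgood, hm.eventually_width, eventually_gt_atTop 0]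
    with M hEM hZM hgM hwM hM
  have hM0 : (0 : ℝ) < M := by exact_mod_cast hM
  set r := (M : ℝ) ^ (2 * (1 - min q (1 / 2))) with hr
  have hr0 : 0 < r := Real.rpow_pos_of_pos hM0 _
  have hsm := hm.ae_smooth M fun l hl => (hwM l hl).1
  have hsub : {ω | ¬ m.RemBound (min q (1 / 2)) ((1 + 2 * m.C) * c * Q) M ω}
      ⊆ (m.goodEvent M)ᶜ ∪ {ω | ENNReal.ofReal (Q * r) ≤ ENNReal.ofReal (m.totalBound M ω)}
        ∪ {ω | ¬ (ω ∈ m.goodEvent M → m.Smooth M ω)} := by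
    intro ω hω
    by_contra hcon
    simp only [Set.mem_union, Set.mem_compl_iff, Set.mem_ofPred_eq, not_or, not_not, not_le]
      at hcon
    obtain ⟨⟨hg, hz⟩, hs⟩ := hcon
    have hs := hs hg
    have hz : m.totalBound M ω ≤ Q * r :=
      (ENNReal.ofReal_lt_ofReal_iff_of_nonneg
        (Finset.sum_nonneg fun p _ => add_nonneg
          (div_nonneg (Finset.sum_nonneg fun _ _ => entryBound_nonneg ..) (Nat.cast_nonneg _))
          (div_nonneg (Finset.sum_nonneg fun _ _ => entryBound_nonneg ..)
            (Nat.cast_nonneg _)))).1 hz |>.le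
    refine hω ⟨?_, ?_, fun k => ?_⟩
    · refine (sum_remErr_sq_le hs hc (hEM ω hg)).trans ((mul_le_mul_of_nonneg_left hz hc).trans ?_)
      have : 0 ≤ 2 * m.C * (c * (Q * r)) := by positivity
      linarith
    · refine (sq_trace_remErr_le hs hc (hEM ω hg)).trans ((mul_le_mul_of_nonneg_left hz
        (by positivity)).trans ?_)
      have : 0 ≤ c * (Q * r) := by positivity
      linarith
    · simp only [remErr_eq hs, ← Finset.sum_div, sum_center, zero_div]
  have hmarkov : m.P M {ω | ENNReal.ofReal (Q * r) ≤ ENNReal.ofReal (m.totalBound M ω)}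
      ≤ η / 2 := by
    have hmeas : Measurable (m.totalBound M) := by
      refine Finset.measurable_sum _ fun p _ => ?_
      exact ((Finset.measurable_sum _ fun t _ => hm.measurable_entryBound M _ _ t t).div_const
        _).add ((Finset.measurable_sum _ fun r _ =>
          hm.measurable_entryBound M _ _ r.1 r.2).div_const _)
    refine (meas_ge_le_lintegral_div hmeas.ennreal_ofReal.aemeasurable
      (ENNReal.ofReal_pos.2 (by positivity)).ne' ENNReal.ofReal_ne_top).trans ?_
    refine (ENNReal.div_le_div_right hZM _).trans ?_
    rw [← ENNReal.ofReal_div_of_pos (by positivity)]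
    refine le_trans (ENNReal.ofReal_le_ofReal (q := δ) ?_) (by simpa using hδ.le)
    rw [mul_div_mul_right _ _ hr0.ne', hQ, div_div_eq_mul_div, div_le_iff₀ (by positivity)]
    nlinarith
  calc _ ≤ _ := measure_mono hsub
    _ ≤ _ := measure_union_le _ _
    _ ≤ _ := add_le_add (measure_union_le _ _) le_rfl
    _ ≤ η / 2 + η / 2 + 0 := add_le_add (add_le_add hgM hmarkov) (le_of_eq (ae_iff.1 hsm))
    _ = η := by rw [add_zero, ENNReal.add_halves]

/-- Scale of the leading term. -/
def leadScale (m : Model) (M : ℕ) : ℝ := m.alpha * (M / m.samples M) * (m.kappa1 - m.kappa2)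

/-- In each diagonal block the leading term is a multiple of I - 11ᵀ/T, so pairing with it sees only
the trace and the block sum. -/
theorem sum_leading_mul {M : ℕ}
    (F : Fin (m.width M (m.H + 1)) × Fin (m.samples M) →
      Fin (m.width M (m.H + 1)) × Fin (m.samples M) → ℝ) :
    ∑ a, ∑ b, m.leading M a b * F a b
      = m.leadScale M * ∑ k, (∑ s, F (k, s) (k, s)
          - (∑ s, ∑ t, F (k, s) (k, t)) / m.samples M) := by
  have h : ∀ k s, ∑ b, m.leading M (k, s) b * F (k, s) b
      = m.leadScale M * (F (k, s) (k, s) - (∑ t, F (k, s) (k, t)) / m.samples M) := by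
    intro k s
    rw [Fintype.sum_prod_type, Finset.sum_eq_single k]
    · have h1 : ∀ t, m.leading M (k, s) (k, t) * F (k, s) (k, t)
          = m.leadScale M * ((if s = t then F (k, s) (k, t) else 0)
            - F (k, s) (k, t) / m.samples M) := by
        intro t
        simp only [leading, leadScale, if_true]
        split_ifs <;> ring
      simp only [h1]
      rw [← Finset.mul_sum, Finset.sum_sub_distrib, Finset.sum_ite_eq, ← Finset.sum_div,
        if_pos (Finset.mem_univ s)]
    · intro k' _ hk
      exact Finset.sum_eq_zero fun t _ => by simp [leading, Ne.symm hk]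
    · simp
  rw [Fintype.sum_prod_type]
  simp only [h, ← Finset.mul_sum, Finset.sum_sub_distrib, ← Finset.sum_div]

theorem sum_leading_diag {M : ℕ} (hT : 0 < m.samples M) (k : Fin (m.width M (m.H + 1))) :
    ∑ s, m.leading M (k, s) (k, s) = m.leadScale M * (m.samples M - 1) := by
  have hT' : (m.samples M : ℝ) ≠ 0 := by positivity
  simp only [leading, leadScale, if_true, Finset.sum_const, Finset.card_univ, Fintype.card_fin,
    nsmul_eq_mul]
  field_simp

theorem sum_leading_block {M : ℕ} (hT : 0 < m.samples M) (k : Fin (m.width M (m.H + 1))) :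
    ∑ s, ∑ t, m.leading M (k, s) (k, t) = 0 := by
  have hT' : (m.samples M : ℝ) ≠ 0 := by positivity
  refine Finset.sum_eq_zero fun s _ => ?_
  simp only [leading, if_true, ← Finset.mul_sum, Finset.sum_sub_distrib, Finset.sum_ite_eq,
    Finset.mem_univ, Finset.sum_const, Finset.card_univ, Fintype.card_fin, nsmul_eq_mul]
  field_simp
  simp

theorem trace_revFim {M : ℕ} (hT : 0 < m.samples M) (ω : m.Sample M) :
    ∑ a, revFim m.φ m.β ω.1 ω.2 a a
      = m.C * m.leadScale M * (m.samples M - 1) + ∑ a, m.remErr M ω a a := by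
  have h : ∀ a, revFim m.φ m.β ω.1 ω.2 a a = m.leading M a a + m.remErr M ω a a := fun a => by
    rw [remErr]; ring
  have hw : (m.width M (m.H + 1) : ℝ) = m.C := by rw [width_top]
  simp only [h, Finset.sum_add_distrib]
  congr 1
  rw [Fintype.sum_prod_type]
  simp only [sum_leading_diag hT, Finset.sum_const, Finset.card_univ, Fintype.card_fin,
    nsmul_eq_mul]
  rw [hw]
  ring

/-- Because the diagonal blocks of the remainder sum to zero, the cross term of the expanded square
depends on the remainder only through its trace. -/
theorem sum_revFim_sq {M : ℕ} (hT : 0 < m.samples M) {ω : m.Sample M}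
    (h0 : ∀ k, ∑ s, ∑ t, m.remErr M ω (k, s) (k, t) = 0) :
    ∑ a, ∑ b, revFim m.φ m.β ω.1 ω.2 a b ^ 2
      = m.C * m.leadScale M ^ 2 * (m.samples M - 1) + 2 * m.leadScale M * ∑ a, m.remErr M ω a a
        + ∑ a, ∑ b, m.remErr M ω a b ^ 2 := by
  have h : ∀ a b, revFim m.φ m.β ω.1 ω.2 a b ^ 2 = m.leading M a b * m.leading M a b
      + 2 * (m.leading M a b * m.remErr M ω a b) + m.remErr M ω a b ^ 2 := fun a b => by
    rw [remErr]; ring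
  have hw : (m.width M (m.H + 1) : ℝ) = m.C := by rw [width_top]
  simp only [h, Finset.sum_add_distrib, ← Finset.mul_sum]
  congr 1
  have e : ∑ a, ∑ b, m.leading M a b * m.leading M a b = m.leadScale M *
      ∑ k, (∑ s, m.leading M (k, s) (k, s)
        - (∑ s, ∑ t, m.leading M (k, s) (k, t)) / m.samples M) :=
    sum_leading_mul fun a b => m.leading M a b
  rw [e, sum_leading_mul (m.remErr M ω)]
  simp only [sum_leading_diag hT, sum_leading_block hT, h0, zero_div, sub_zero,
    Finset.sum_const, Finset.card_univ, Fintype.card_fin, nsmul_eq_mul]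
  rw [hw, Fintype.sum_prod_type]
  ring

theorem rpow_two_mul_one_sub {x : ℝ} (hx : 0 ≤ x) (r : ℝ) :
    x ^ (2 * (1 - r)) = (x ^ (1 - r)) ^ 2 := by
  rw [mul_comm, Real.rpow_mul hx, Real.rpow_ofNat]

theorem Regular.leadScale_nonneg (hm : m.Regular) (M : ℕ) : 0 ≤ m.leadScale M :=
  mul_nonneg (mul_nonneg hm.alpha_pos.le (by positivity)) (sub_nonneg.2 hm.kappa2_le)

theorem Regular.remErr_sq_eq (hm : m.Regular) {M : ℕ} (hM : 0 < M) (r : ℝ) (ω : m.Sample M) :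
    ∑ a, ∑ b, m.remErr M ω a b ^ 2
      = m.alpha * ((M : ℝ) ^ (1 - r)) ^ 2 * m.remainder r M ω := by
  have hM' : (0 : ℝ) < M := by exact_mod_cast hM
  have hα := hm.alpha_pos.ne'
  have h : ((M : ℝ) ^ (1 - r)) ^ 2 * (M : ℝ) ^ (2 * r) = (M : ℝ) ^ 2 := by
    rw [← Real.rpow_natCast, ← Real.rpow_mul hM'.le, ← Real.rpow_add hM', ← Real.rpow_natCast]
    congr 1
    push_cast
    ring
  have e : m.remainder r M ω = (M : ℝ) ^ (2 * r) *
      ((∑ a, ∑ b, m.remErr M ω a b ^ 2) / (m.alpha * (M : ℝ) ^ 2)) := rfl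
  rw [e, mul_assoc, ← mul_assoc (((M : ℝ) ^ (1 - r)) ^ 2), h]
  field_simp

/-- Moment bounds for the largest eigenvalue in terms of the remainder. -/
theorem Regular.lam_bounds (hm : m.Regular) {M : ℕ} (hM : 0 < M) (hT : 0 < m.samples M) {r K : ℝ}
    (hK : 0 ≤ K) {ω : m.Sample M} (h : m.RemBound r K M ω) :
    m.remainder r M ω ≤ K / m.alpha ∧
    m.lam M ω ^ 2 ≤ m.C * m.leadScale M ^ 2 * (m.samples M - 1)
      + 2 * m.leadScale M * (√K * (M : ℝ) ^ (1 - r))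
      + m.alpha * ((M : ℝ) ^ (1 - r)) ^ 2 * m.remainder r M ω ∧
    m.C * m.leadScale M ^ 2 * (m.samples M - 1)
      - 2 * m.leadScale M * (√K * (M : ℝ) ^ (1 - r))
      + m.alpha * ((M : ℝ) ^ (1 - r)) ^ 2 * m.remainder r M ω
      ≤ m.lam M ω * (m.C * m.leadScale M * (m.samples M - 1) + √K * (M : ℝ) ^ (1 - r)) := by
  have hM' : (0 : ℝ) < M := by exact_mod_cast hM
  have hy : 0 < (M : ℝ) ^ (1 - r) := Real.rpow_pos_of_pos hM' _
  have hy2 : (M : ℝ) ^ (2 * (1 - r)) = ((M : ℝ) ^ (1 - r)) ^ 2 :=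
    rpow_two_mul_one_sub hM'.le r
  have htr : |∑ a, m.remErr M ω a a| ≤ √K * (M : ℝ) ^ (1 - r) := by
    refine abs_le_of_sq_le_sq ?_ (by positivity)
    rw [mul_pow, Real.sq_sqrt hK, ← hy2]
    exact h.trace_sq_le
  obtain ⟨htr1, htr2⟩ := abs_le.1 htr
  have hx := hm.leadScale_nonneg M
  obtain ⟨b0, b1, b2⟩ := lamMax_bounds m.φ m.β ω.1 ω.2
  have hsq := sum_revFim_sq hT h.sum_eq_zero
  have hrem := hm.remErr_sq_eq hM r ω
  refine ⟨?_, ?_, ?_⟩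
  · have h1 := h.sq_le
    rw [hrem, hy2] at h1
    rw [le_div_iff₀ hm.alpha_pos]
    have h2 : 0 < ((M : ℝ) ^ (1 - r)) ^ 2 := by positivity
    nlinarith
  · refine b1.trans ?_
    rw [hsq, hrem]
    have := mul_le_mul_of_nonneg_left htr2 (by positivity : 0 ≤ 2 * m.leadScale M)
    linarith
  · rw [hsq, hrem, trace_revFim hT] at b2
    have h1 := mul_le_mul_of_nonneg_left htr1 (by positivity : 0 ≤ 2 * m.leadScale M)
    have h2 := mul_le_mul_of_nonneg_left htr2 b0
    change _ ≤ lamMax m.φ m.β ω.1 ω.2 * _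
    rw [mul_add] at b2 ⊢
    linarith

theorem lam_nonneg (M : ℕ) (ω : m.Sample M) : 0 ≤ m.lam M ω :=
  (lamMax_bounds m.φ m.β ω.1 ω.2).1

theorem Regular.tendsto_samples (hm : m.Regular) :
    Tendsto (fun M : ℕ => (M : ℝ) / m.samples M) atTop (𝓝 m.ρ) ∧
    Tendsto (fun M : ℕ => (m.samples M : ℝ)) atTop atTop := by
  have hρ := hm.ρ_pos
  constructor
  · have h1 := (tendsto_nat_floor_mul_div_atTop (inv_nonneg.2 hρ.le)).comp
      tendsto_natCast_atTop_atTop (α := ℕ)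
    have h2 := h1.inv₀ (inv_ne_zero hρ.ne')
    rw [inv_inv] at h2
    refine h2.congr fun M => ?_
    simp only [Function.comp_apply, inv_div, samples]
    rw [inv_mul_eq_div]
  · exact tendsto_natCast_atTop_atTop.comp (tendsto_nat_floor_atTop.comp
      (tendsto_natCast_atTop_atTop.atTop_div_const hρ))

/-- The rounding of T costs nothing: M ≤ ρ(T + 1) and (T + 1)(T - 1) ≤ T². Hence the coefficient of
M in the upper bound carries no 1 + o(1). -/
theorem Regular.leadScale_sq_le (hm : m.Regular) {M : ℕ} (hT : 0 < m.samples M) :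
    m.leadScale M ^ 2 * (m.samples M - 1)
      ≤ m.alpha ^ 2 * m.ρ * (m.kappa1 - m.kappa2) ^ 2 * M := by
  have hT' : (1 : ℝ) ≤ m.samples M := by exact_mod_cast hT
  have hρ := hm.ρ_pos
  have h1 : (M : ℝ) ≤ m.ρ * (m.samples M + 1) := by
    have := (Nat.lt_floor_add_one ((M : ℝ) / m.ρ)).le
    rwa [div_le_iff₀' hρ] at this
  have h2 : (M : ℝ) / m.samples M * ((m.samples M - 1) / m.samples M) ≤ m.ρ := by
    rw [div_mul_div_comm, div_le_iff₀ (by positivity)]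
    nlinarith [mul_le_mul_of_nonneg_right h1 (sub_nonneg.2 hT')]
  have h3 : m.leadScale M ^ 2 * (m.samples M - 1)
      = m.alpha ^ 2 * (m.kappa1 - m.kappa2) ^ 2 * M *
        ((M : ℝ) / m.samples M * ((m.samples M - 1) / m.samples M)) := by
    rw [leadScale]; field_simp
  rw [h3]
  refine (mul_le_mul_of_nonneg_left h2 (by positivity)).trans (le_of_eq (by ring))

theorem tendsto_rpow_neg_nat {r : ℝ} (hr : 0 < r) :
    Tendsto (fun M : ℕ => (M : ℝ) ^ (-r)) atTop (𝓝 0) :=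
  (tendsto_rpow_neg_atTop hr).comp tendsto_natCast_atTop_atTop

theorem Regular.exists_upper_bound (hm : m.Regular) {q : ℝ} (hrate : m.BackwardRate q)
    {η : ENNReal} (hη : 0 < η) :
    ∃ c₂ : ℝ, 0 ≤ c₂ ∧ ∀ᶠ M : ℕ in atTop, m.P M {ω | ¬ (m.remainder (min q (1 / 2)) M ω ≤ c₂ ∧
        m.lam M ω ≤ √(m.C * m.alpha ^ 2 * m.ρ * (m.kappa1 - m.kappa2) ^ 2 * M
          + c₂ * (M : ℝ) ^ (2 * (1 - min q (1 / 2)))))} ≤ η := by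
  obtain ⟨K, hK, hKM⟩ := hm.exists_remBound hrate hη
  set r := min q (1 / 2) with hr
  have hα := hm.alpha_pos
  have hρ := hm.ρ_pos
  have hD := sub_nonneg.2 hm.kappa2_le
  set D := m.kappa1 - m.kappa2 with hDdef
  -- The three summands pay for the cross term (with M/T ≤ 2ρ and y ≤ y²), for the squared
  -- remainder, and for the bound on S_M itself.
  refine ⟨4 * m.alpha * m.ρ * D * √K + K + K / m.alpha, by positivity, ?_⟩
  filter_upwards [hKM, eventually_gt_atTop 0, hm.tendsto_samples.2.eventually_gt_atTop 0,
    hm.tendsto_samples.1.eventually_le_const (by linarith : m.ρ < 2 * m.ρ)] with M hM hM0 hT hu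
  refine (measure_mono fun ω hω => ?_).trans hM
  refine fun hRB => hω ?_
  have hM1 : (1 : ℝ) ≤ M := by exact_mod_cast hM0
  have hT : 0 < m.samples M := by exact_mod_cast hT
  obtain ⟨h1, h2, -⟩ := hm.lam_bounds hM0 hT hK hRB
  have hS0 : 0 ≤ 4 * m.alpha * m.ρ * D * √K := by positivity
  refine ⟨h1.trans (by linarith), Real.le_sqrt_of_sq_le (h2.trans ?_)⟩
  set y := (M : ℝ) ^ (1 - r) with hy
  have hy1 : 1 ≤ y := Real.one_le_rpow hM1 (by linarith [min_le_right q (1 / 2)])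
  have hy2 : (M : ℝ) ^ (2 * (1 - r)) = y ^ 2 :=
    rpow_two_mul_one_sub (by linarith) r
  rw [hy2]
  have e1 := mul_le_mul_of_nonneg_left (hm.leadScale_sq_le hT) (Nat.cast_nonneg (α := ℝ) m.C)
  have e2 : 2 * m.leadScale M * (√K * y) ≤ 4 * m.alpha * m.ρ * D * √K * y ^ 2 := by
    have h3 : m.leadScale M ≤ m.alpha * (2 * m.ρ) * D :=
      mul_le_mul_of_nonneg_right (mul_le_mul_of_nonneg_left hu hα.le) hD
    have h4 : √K * y ≤ √K * y ^ 2 := mul_le_mul_of_nonneg_left (by nlinarith) (Real.sqrt_nonneg _)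
    have := mul_le_mul h3 h4 (by positivity) (by positivity)
    linarith
  have e3 : m.alpha * y ^ 2 * m.remainder r M ω ≤ K * y ^ 2 := by
    have := mul_le_mul_of_nonneg_left h1 (by positivity : 0 ≤ m.alpha * y ^ 2)
    refine this.trans (le_of_eq ?_)
    field_simp
  have e4 : 0 ≤ K / m.alpha * y ^ 2 := by positivity
  linarith

theorem Regular.tendsto_prob_lam_gt (hm : m.Regular) {q : ℝ} (hq : 0 < q)
    (hrate : m.BackwardRate q) {ε : ℝ} (hε : 0 < ε) :
    Tendsto (fun M : ℕ => m.P M {ω | ε * M < m.lam M ω}) atTop (𝓝 0) := by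
  rw [ENNReal.tendsto_nhds_zero]
  intro η hη
  obtain ⟨c₂, hc₂, h⟩ := hm.exists_upper_bound hrate hη
  set r := min q (1 / 2) with hr
  have hr0 : 0 < r := lt_min hq (by norm_num)
  set c := m.C * m.alpha ^ 2 * m.ρ * (m.kappa1 - m.kappa2) ^ 2
  -- The squared upper bound divided by M²; both terms vanish because q* > 0.
  have hlim : Tendsto (fun M : ℕ => c / M + c₂ * (M : ℝ) ^ (-(2 * r))) atTop (𝓝 (0 + c₂ * 0)) :=
    (tendsto_const_div_atTop_nhds_zero_nat c).add
      ((tendsto_rpow_neg_nat (by linarith)).const_mul c₂)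
  rw [mul_zero, add_zero] at hlim
  filter_upwards [h, hlim.eventually_le_const (pow_pos hε 2), eventually_gt_atTop 0]
    with M hM hle hM0
  refine (measure_mono fun ω hω => ?_).trans hM
  have hM' : (0 : ℝ) < M := by exact_mod_cast hM0
  rintro ⟨-, h2⟩
  refine absurd (h2.trans ?_) (not_le.2 hω)
  refine Real.sqrt_le_iff.2 ⟨by positivity, ?_⟩
  have e : (M : ℝ) ^ (2 * (1 - r)) = (M : ℝ) ^ 2 * (M : ℝ) ^ (-(2 * r)) := by
    rw [← Real.rpow_natCast, ← Real.rpow_add hM']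
    congr 1
    push_cast
    ring
  calc _ = (M : ℝ) ^ 2 * (c / M + c₂ * (M : ℝ) ^ (-(2 * r))) := by rw [e]; field_simp
    _ ≤ (M : ℝ) ^ 2 * ε ^ 2 := mul_le_mul_of_nonneg_left hle (sq_nonneg _)
    _ = _ := by ring

/-- The second moment divided by the trace. `hvM` and `hwM` are deterministic facts about large `M`:
the leading second moment is at least 1 - ε/2 times its limit after the cross term, and the trace
error is at most ε/2 times the leading trace. -/
theorem Regular.le_lam_of_remBound (hm : m.Regular) (hD0 : 0 < m.kappa1 - m.kappa2) {M : ℕ}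
    (hM0 : 0 < M) (hTn : 0 < m.samples M) {r K c₀ ε : ℝ} (hK : 0 ≤ K) (hc₀ : 0 ≤ c₀) (hε : 0 < ε)
    (hvM : (1 - ε / 2) * (m.C * m.alpha ^ 2 * (m.kappa1 - m.kappa2) ^ 2 * m.ρ)
      ≤ m.C * m.alpha ^ 2 * (m.kappa1 - m.kappa2) ^ 2 *
        ((M : ℝ) / m.samples M - (M : ℝ) / m.samples M * (m.samples M : ℝ)⁻¹)
        - 2 * m.alpha * (m.kappa1 - m.kappa2) * √K * ((M : ℝ) / m.samples M * (M : ℝ) ^ (-r)))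
    (hwM : √K * (M : ℝ) ^ (-r) ≤ ε / 2 * (m.C * m.alpha * (m.kappa1 - m.kappa2)))
    {ω : m.Sample M} (hRB : m.RemBound r K M ω) (hSω : c₀ ≤ m.remainder r M ω) :
    (1 - ε) * (m.ρ * m.alpha * (m.kappa1 - m.kappa2)
      + c₀ / (m.C * (m.kappa1 - m.kappa2)) * (M : ℝ) ^ (1 - 2 * r)) ≤ m.lam M ω := by
  by_contra! hω
  have hM' : (0 : ℝ) < M := by exact_mod_cast hM0
  have hT1 : (1 : ℝ) ≤ m.samples M := by exact_mod_cast hTn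
  have hα := hm.alpha_pos
  have hρ := hm.ρ_pos
  have hC : (0 : ℝ) < m.C := by exact_mod_cast hm.C_pos
  set D := m.kappa1 - m.kappa2 with hDdef
  obtain ⟨-, -, h3⟩ := hm.lam_bounds hM0 hTn hK hRB
  have hlam := lam_nonneg M ω
  set y := (M : ℝ) ^ (1 - r) with hy
  set x := m.leadScale M with hx
  have hyM : y = M * (M : ℝ) ^ (-r) := by
    rw [hy, sub_eq_add_neg, Real.rpow_add hM', Real.rpow_one]
  have hy2 : y ^ 2 = M * (M : ℝ) ^ (1 - 2 * r) := by
    rw [hy, ← Real.rpow_natCast, ← Real.rpow_mul hM'.le]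
    conv_rhs => rw [← Real.rpow_one (M : ℝ), ← Real.rpow_mul hM'.le, ← Real.rpow_add hM']
    congr 1
    push_cast
    ring
  -- Leading order of the trace. Multiplying the claimed bound by `G` gives the limiting second
  -- moment plus the c₀ part of the squared remainder.
  set G := m.C * m.alpha * D * M with hG
  have hG0 : 0 < G := by positivity
  have hW : √K * y ≤ ε / 2 * G := by
    have := mul_le_mul_of_nonneg_right hwM hM'.le
    rw [hyM, hG]
    linarith
  have htrace : m.C * x * (m.samples M - 1) + √K * y ≤ (1 + ε / 2) * G := by
    have h1 : x * (m.samples M - 1) ≤ m.alpha * D * M := by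
      have : x * m.samples M = m.alpha * D * M := by rw [hx, leadScale, ← hDdef]; field_simp
      have hx0 : 0 ≤ x := hm.leadScale_nonneg M
      linarith
    have h2 := mul_le_mul_of_nonneg_left h1 hC.le
    rw [hG] at hW ⊢
    linarith
  have hlow : (1 - ε / 2) * (m.C * m.alpha ^ 2 * D ^ 2 * m.ρ) * M
      ≤ m.C * x ^ 2 * (m.samples M - 1) - 2 * x * (√K * y) := by
    refine (mul_le_mul_of_nonneg_right hvM hM'.le).trans (le_of_eq ?_)
    rw [hyM, hx, leadScale, ← hDdef]
    field_simp
  have hSy : m.alpha * y ^ 2 * c₀ ≤ m.alpha * y ^ 2 * m.remainder r M ω :=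
    mul_le_mul_of_nonneg_left hSω (by positivity)
  have hYG : (m.ρ * m.alpha * D + c₀ / (m.C * D) * (M : ℝ) ^ (1 - 2 * r)) * G
      = m.C * m.alpha ^ 2 * D ^ 2 * m.ρ * M + m.alpha * y ^ 2 * c₀ := by
    rw [hy2, hG]
    field_simp
  clear_value G y x D
  have h4 := mul_le_mul_of_nonneg_left htrace hlam
  have h5 := mul_lt_mul_of_pos_right hω (mul_pos (by linarith : 0 < 1 + ε / 2) hG0)
  have h6 : (1 - ε) * (m.ρ * m.alpha * D + c₀ / (m.C * D) * (M : ℝ) ^ (1 - 2 * r))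
      * ((1 + ε / 2) * G) = (1 - ε) * (1 + ε / 2)
        * (m.C * m.alpha ^ 2 * D ^ 2 * m.ρ * M + m.alpha * y ^ 2 * c₀) := by
    rw [← hYG]; ring
  have hnn1 : 0 ≤ m.C * m.alpha ^ 2 * D ^ 2 * m.ρ * M := by positivity
  have hnn2 : 0 ≤ m.alpha * y ^ 2 * c₀ := by positivity
  -- Half of ε is spent on the second moment and half on the trace; the product falls short of 1 -
  -- ε/2 by ε²/2.
  have hε2 : (1 - ε) * (1 + ε / 2) ≤ 1 - ε / 2 := by nlinarith [sq_nonneg ε]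
  have h7 : (1 - ε) * (1 + ε / 2)
        * (m.C * m.alpha ^ 2 * D ^ 2 * m.ρ * M + m.alpha * y ^ 2 * c₀)
      ≤ (1 - ε / 2) * (m.C * m.alpha ^ 2 * D ^ 2 * m.ρ * M + m.alpha * y ^ 2 * c₀) :=
    mul_le_mul_of_nonneg_right hε2 (add_nonneg hnn1 hnn2)
  have h8 := mul_nonneg hε.le hnn2
  linarith

theorem Regular.tendsto_prob_lam_lt (hm : m.Regular) {q : ℝ} (hq : 0 < q)
    (hrate : m.BackwardRate q) {c₀ : ℝ} (hc₀ : 0 ≤ c₀)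
    (hS : Tendsto (fun M : ℕ => m.P M {ω | m.remainder (min q (1 / 2)) M ω < c₀}) atTop (𝓝 0))
    {ε : ℝ} (hε : 0 < ε) :
    Tendsto (fun M : ℕ => m.P M {ω | m.lam M ω < (1 - ε) *
      (m.ρ * m.alpha * (m.kappa1 - m.kappa2)
        + c₀ / (m.C * (m.kappa1 - m.kappa2)) * (M : ℝ) ^ (1 - 2 * min q (1 / 2)))})
      atTop (𝓝 0) := by
  set r := min q (1 / 2) with hr
  have hr0 : 0 < r := lt_min hq (by norm_num)
  have hα := hm.alpha_pos
  have hρ := hm.ρ_pos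
  have hD := sub_nonneg.2 hm.kappa2_le
  set D := m.kappa1 - m.kappa2 with hDdef
  have hY : ∀ M : ℕ, 0 ≤ m.ρ * m.alpha * D + c₀ / (m.C * D) * (M : ℝ) ^ (1 - 2 * r) :=
    fun M => by positivity
  -- A nonpositive bound is trivial as λ_max ≥ 0. This disposes of ε ≥ 1 and of κ₁ = κ₂, where
  -- division by zero makes the constant in front of the power 0.
  have htriv : (∀ M : ℕ, (1 - ε) *
      (m.ρ * m.alpha * D + c₀ / (m.C * D) * (M : ℝ) ^ (1 - 2 * r)) ≤ 0) →
      Tendsto (fun M : ℕ => m.P M {ω | m.lam M ω < (1 - ε) *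
        (m.ρ * m.alpha * D + c₀ / (m.C * D) * (M : ℝ) ^ (1 - 2 * r))}) atTop (𝓝 0) := by
    intro h
    refine tendsto_const_nhds.congr fun M => ?_
    rw [Set.eq_empty_of_forall_notMem (s := {ω | m.lam M ω < _}) fun ω hω =>
      absurd (hω.trans_le (h M)) (not_lt.2 (lam_nonneg M ω)), measure_empty]
  rcases hD.eq_or_lt with hD0 | hD0
  · exact htriv fun M => by simp [← hD0]
  rcases le_or_gt 1 ε with hε1 | hε1
  · exact htriv fun M => mul_nonpos_of_nonpos_of_nonneg (by linarith) (hY M)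
  have hC : (0 : ℝ) < m.C := by exact_mod_cast hm.C_pos
  rw [ENNReal.tendsto_nhds_zero]
  intro η hη
  have hη2 := ENNReal.half_pos hη.ne'
  obtain ⟨K, hK, hKM⟩ := hm.exists_remBound hrate hη2
  obtain ⟨hu, hT⟩ := hm.tendsto_samples
  have hrp := tendsto_rpow_neg_nat hr0
  have hv : Tendsto (fun M : ℕ => m.C * m.alpha ^ 2 * D ^ 2 *
        ((M : ℝ) / m.samples M - (M : ℝ) / m.samples M * (m.samples M : ℝ)⁻¹)
        - 2 * m.alpha * D * √K * ((M : ℝ) / m.samples M * (M : ℝ) ^ (-r))) atTop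
      (𝓝 (m.C * m.alpha ^ 2 * D ^ 2 * (m.ρ - m.ρ * 0) - 2 * m.alpha * D * √K * (m.ρ * 0))) :=
    ((hu.sub (hu.mul (tendsto_inv_atTop_zero.comp hT))).const_mul _).sub
      ((hu.mul hrp).const_mul _)
  have hw : Tendsto (fun M : ℕ => √K * (M : ℝ) ^ (-r)) atTop (𝓝 (√K * 0)) := hrp.const_mul _
  simp only [mul_zero, sub_zero] at hv hw
  have hlt : (1 - ε / 2) * (m.C * m.alpha ^ 2 * D ^ 2 * m.ρ) < m.C * m.alpha ^ 2 * D ^ 2 * m.ρ := by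
    have : 0 < m.C * m.alpha ^ 2 * D ^ 2 * m.ρ := by positivity
    nlinarith
  filter_upwards [hKM, (ENNReal.tendsto_nhds_zero.1 hS) _ hη2, eventually_gt_atTop 0,
    hT.eventually_gt_atTop 0, hv.eventually_const_le hlt,
    hw.eventually_le_const (by positivity : 0 < ε / 2 * (m.C * m.alpha * D))]
    with M hM hSM hM0 hT0 hvM hwM
  have hM' : (0 : ℝ) < M := by exact_mod_cast hM0
  have hTn : 0 < m.samples M := by exact_mod_cast hT0
  have hT1 : (1 : ℝ) ≤ m.samples M := by exact_mod_cast hTn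
  suffices hsub : {ω | m.lam M ω < (1 - ε) *
      (m.ρ * m.alpha * D + c₀ / (m.C * D) * (M : ℝ) ^ (1 - 2 * r))}
      ⊆ {ω | ¬ m.RemBound r K M ω} ∪ {ω | m.remainder r M ω < c₀} by
    calc _ ≤ _ := measure_mono hsub
      _ ≤ _ := measure_union_le _ _
      _ ≤ η / 2 + η / 2 := add_le_add hM hSM
      _ = η := ENNReal.add_halves η
  intro ω hω
  by_contra hcon
  simp only [Set.mem_union, Set.mem_ofPred_eq, not_or, not_not, not_lt] at hcon hω
  obtain ⟨hRB, hSω⟩ := hcon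
  exact absurd hω (not_lt.2 (hm.le_lam_of_remBound hD0 hM0 hTn hK hc₀ hε hvM hwM hRB hSω))

end Model

end WideNet
end

/-! ### The theorem -/

open WideNet
theorem theoremB1 (m : Model) (hH : 1 ≤ m.H) (hC : 1 ≤ m.C)
    (ha : ∀ l ≤ m.H, 0 < m.a l) (hσw : 0 < m.σw) (hρ : 0 < m.ρ)
    (hLip : ∀ l, 1 ≤ l → l ≤ m.H → ∃ B, LipschitzWith B (m.φ l))
    (hconst : ∀ l, 1 ≤ l → l ≤ m.H → ∃ x y, m.φ l x ≠ m.φ l y)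
    (hcent : m.NonCentered)
    (q : ℝ) (hq : 0 < q) (hrate : m.BackwardRate q)
    (qs : ℝ) (hqs : qs = min q (1 / 2)) :
    (∀ c₀ : ℝ, 0 ≤ c₀ →
      Tendsto (fun M : ℕ => m.P M {ω | m.remainder qs M ω < c₀}) atTop (𝓝 0) →
      ∀ c₁ : ℝ, c₁ = c₀ / (m.C * (m.kappa1 - m.kappa2)) → 0 ≤ c₁ ∧
        ∀ ε : ℝ, 0 < ε →
          Tendsto (fun M : ℕ => m.P M {ω |
            m.lam M ω < (1 - ε) * (m.ρ * m.alpha * (m.kappa1 - m.kappa2)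
              + c₁ * (M : ℝ) ^ (1 - 2 * qs))}) atTop (𝓝 0)) ∧
    (∀ η : ENNReal, 0 < η → ∃ c₂ : ℝ, 0 ≤ c₂ ∧
      ∀ᶠ M : ℕ in atTop, m.P M {ω | ¬ (m.remainder qs M ω ≤ c₂ ∧
        m.lam M ω ≤ √(m.C * m.alpha ^ 2 * m.ρ * (m.kappa1 - m.kappa2) ^ 2 * M
          + c₂ * (M : ℝ) ^ (2 * (1 - qs))))} ≤ η) ∧
    (∀ ε : ℝ, 0 < ε →
      Tendsto (fun M : ℕ => m.P M {ω | ε * M < m.lam M ω}) atTop (𝓝 0)) := by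
  have hm : m.Regular :=
    { a_pos := ha, σw_pos := hσw, ρ_pos := hρ, H_pos := hH, C_pos := hC
      lip := fun l h1 h2 => by
        obtain ⟨B, hB⟩ := hLip l h1 h2
        exact LipschitzWith.exists_lipGrowth hB
      nonconst := hconst }
  subst hqs
  refine ⟨fun c₀ hc₀ hS c₁ hc₁ => ?_, fun η hη => hm.exists_upper_bound hrate hη,
    fun ε hε => hm.tendsto_prob_lam_gt hq hrate hε⟩
  subst hc₁
  exact ⟨div_nonneg hc₀ (mul_nonneg (Nat.cast_nonneg _) (sub_nonneg.2 hm.kappa2_le)),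
    fun ε hε => hm.tendsto_prob_lam_lt hq hrate hc₀ hS hε⟩
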